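/- Rings are associative and unital, ring homomorphisms are unital. For a ring $R$, let $R\text{-mod}$ be the category of left $R$-modules, and for an additive category $\mathsf E$ let $\mathrm{Hot}(\mathsf E)$ be the homotopy category of unbounded complexes over $\mathsf E$. Let $\mathsf E$ be an abelian category, or a full additive subcategory of an abelian category with the class of short exact sequences inherited from it. A complex over $\mathsf E$ is called *coacyclic* (respectively, *contraacyclic*) in $\mathsf E$ if it belongs to the smallest strictly full triangulated subcategory of $\mathrm{Hot}(\mathsf E)$ that contains the total complexes of all short exact sequences $0\to K^\bullet\to L^\bullet\to M^\bullet\to 0$ of complexes over $\mathsf E$ and is closed under infinite direct sums (respectively, infinite products). A ring $A$ is *left coherent* if all its finitely generated left ideals are finitely presented left modules; right coherence is defined similarly. Over a left coherent ring $A$, a left module $J$ is *fp-injective* if $\operatorname{Hom}_A(-,J)$ takes short exact sequences of finitely presented left $A$-modules to short exact sequences. **(a)** Let $A\to R$ be a homomorphism of rings; assume that $A$ is left coherent and $R$ is a flat right $A$-module. Let $\mathsf D^{\mathsf{sico}}_A(R\text{-mod})$ be the Verdier quotient of $\mathrm{Hot}(R\text{-mod})$ by the complexes of $R$-modules that are coacyclic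 as complexes of left $A$-modules. Let $R\text{-mod}_{A\text{-fpi}}\subset R\text{-mod}$ be the full subcategory of modules that are fp-injective over $A$, and let $\mathsf D^{\mathsf{sico}}_A(R\text{-mod}_{A\text{-fpi}})$ be the Verdier quotient of $\mathrm{Hot}(R\text{-mod}_{A\text{-fpi}})$ by the complexes that are coacyclic in the exact category of fp-injective left $A$-modules. Then the embedding $R\text{-mod}_{A\text{-fpi}}\to R\text{-mod}$ induces a well-defined triangulated functor $$\mathsf D^{\mathsf{sico}}_A(R\text{-mod}_{A\text{-fpi}})\longrightarrow \mathsf D^{\mathsf{sico}}_A(R\text{-mod}),$$ and this functor is an equivalence of triangulated categories. **(b)** Let $B\to S$ be a homomorphism of rings; assume that $B$ is right coherent and $S$ is a flat left $B$-module. Let $\mathsf D^{\mathsf{sictr}}_B(S\text{-mod})$ be the Verdier quotient of $\mathrm{Hot}(S\text{-mod})$ by the complexes of $S$-modules that are contraacyclic as complexes of left $B$-modules. Let $S\text{-mod}_{B\text{-fl}}\subset S\text{-mod}$ be the full subcategory of modules that are flat over $B$, and let $\mathsf D^{\mathsf{sictr}}_B(S\text{-mod}_{B\text{-fl}})$ be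 the Verdier quotient of $\mathrm{Hot}(S\text{-mod}_{B\text{-fl}})$ by the complexes that are contraacyclic in the exact category of flat left $B$-modules. Then the embedding $S\text{-mod}_{B\text{-fl}}\to S\text{-mod}$ induces a well-defined triangulated functor $$\mathsf D^{\mathsf{sictr}}_B(S\text{-mod}_{B\text{-fl}})\longrightarrow \mathsf D^{\mathsf{sictr}}_B(S\text{-mod}),$$ and this functor is an equivalence of triangulated categories. -/

import Mathlib

universe u v u₁ u₂ v₁ v₂

open CategoryTheory Limits TensorProduct

noncomputable section

namespace Semiderived

/-! ### Coherent rings, fp-injective modules, flat modules over noncommutative rings -/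

/-- A ring is left coherent if every finitely generated left ideal is a finitely presented
left module. -/
def IsLeftCoherent (A : Type u) [Ring A] : Prop :=
  ∀ I : Submodule A A, I.FG → Module.FinitePresentation A I

/-- A ring is right coherent if every finitely generated right ideal is a finitely presented
right module. Right `B`-modules are modules over `Bᵐᵒᵖ`. -/
def IsRightCoherent (B : Type u) [Ring B] : Prop :=
  ∀ I : Submodule Bᵐᵒᵖ B, I.FG → Module.FinitePresentation Bᵐᵒᵖ I

/-- A left module `J` over a (left coherent) ring `A` is fp-injective if `Hom_A(-, J)` takes short
exact sequences `0 → K → L → M → 0` of finitely presented modules to short exact sequences.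
As `Hom_A(-, J)` is left exact, this says that every `K ⟶ J` extends to `L`. -/
def fpInjective (A : Type u) [Ring A] : ObjectProperty (ModuleCat.{u} A) := fun J =>
  ∀ S : ShortComplex (ModuleCat.{u} A), S.ShortExact →
    Module.FinitePresentation A S.X₁ → Module.FinitePresentation A S.X₂ →
    Module.FinitePresentation A S.X₃ →
    ∀ g : S.X₁ ⟶ J, ∃ h : S.X₂ ⟶ J, S.f ≫ h = g

section Tensor

variable (A : Type u) [Ring A]

/-- The relations `n a ⊗ x = n ⊗ a x` in `N ⊗_ℤ F`, for a right `A`-module `N` and a left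
`A`-module `F`. -/
def balancedRel (N F : Type u) [AddCommGroup N] [Module Aᵐᵒᵖ N] [AddCommGroup F] [Module A F] :
    AddSubgroup (N ⊗[ℤ] F) :=
  AddSubgroup.closure {t | ∃ (n : N) (a : A) (x : F),
    t = (MulOpposite.op a • n) ⊗ₜ[ℤ] x - n ⊗ₜ[ℤ] (a • x)}

/-- The tensor product `N ⊗_A F` of a right `A`-module `N` and a left `A`-module `F`. -/
abbrev BalancedTensor (N F : Type u) [AddCommGroup N] [Module Aᵐᵒᵖ N]
    [AddCommGroup F] [Module A F] : Type u :=
  (N ⊗[ℤ] F) ⧸ balancedRel A N F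

variable {N N' N'' F F' F'' : Type u} [AddCommGroup N] [Module Aᵐᵒᵖ N] [AddCommGroup N']
  [Module Aᵐᵒᵖ N'] [AddCommGroup N''] [Module Aᵐᵒᵖ N''] [AddCommGroup F] [Module A F]
  [AddCommGroup F'] [Module A F'] [AddCommGroup F''] [Module A F'']

/-- The homomorphism `i ⊗ j : N ⊗_A F → N' ⊗_A F'`. -/
def BalancedTensor.map (i : N →ₗ[Aᵐᵒᵖ] N') (j : F →ₗ[A] F') :
    BalancedTensor A N F →+ BalancedTensor A N' F' :=
  QuotientAddGroup.map (balancedRel A N F) (balancedRel A N' F')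
    (TensorProduct.map i.toAddMonoidHom.toIntLinearMap
      j.toAddMonoidHom.toIntLinearMap).toAddMonoidHom <| by
      rw [balancedRel, AddSubgroup.closure_le]
      rintro _ ⟨n, a, x, rfl⟩
      exact AddSubgroup.subset_closure ⟨i n, a, j x, by simp⟩

lemma BalancedTensor.hom_ext {G : Type u} [AddCommGroup G]
    {φ ψ : BalancedTensor A N F →+ G}
    (h : ∀ n x, φ (QuotientAddGroup.mk (n ⊗ₜ x)) = ψ (QuotientAddGroup.mk (n ⊗ₜ x))) :
    φ = ψ := by
  refine DFunLike.ext _ _ fun t => ?_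
  obtain ⟨t, rfl⟩ := QuotientAddGroup.mk_surjective t
  induction t with
  | zero => rw [QuotientAddGroup.mk_zero, map_zero, map_zero]
  | tmul n x => exact h n x
  | add t t' ht ht' => rw [QuotientAddGroup.mk_add, map_add, map_add, ht, ht']

lemma BalancedTensor.map_mk (i : N →ₗ[Aᵐᵒᵖ] N') (j : F →ₗ[A] F') (n : N) (x : F) :
    BalancedTensor.map A i j (QuotientAddGroup.mk (n ⊗ₜ x)) =
      QuotientAddGroup.mk (i n ⊗ₜ j x) := rfl

lemma BalancedTensor.map_map (i : N →ₗ[Aᵐᵒᵖ] N') (i' : N' →ₗ[Aᵐᵒᵖ] N'') (j : F →ₗ[A] F')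
    (j' : F' →ₗ[A] F'') (t : BalancedTensor A N F) :
    BalancedTensor.map A i' j' (BalancedTensor.map A i j t) =
      BalancedTensor.map A (i' ∘ₗ i) (j' ∘ₗ j) t := by
  have : (BalancedTensor.map A i' j').comp (BalancedTensor.map A i j) =
      BalancedTensor.map A (i' ∘ₗ i) (j' ∘ₗ j) := BalancedTensor.hom_ext A (fun _ _ => rfl)
  exact DFunLike.congr_fun this t

lemma BalancedTensor.map_id (t : BalancedTensor A N F) :
    BalancedTensor.map A LinearMap.id LinearMap.id t = t := by
  have : BalancedTensor.map A (LinearMap.id : N →ₗ[Aᵐᵒᵖ] N) (LinearMap.id : F →ₗ[A] F) =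
      AddMonoidHom.id _ := BalancedTensor.hom_ext A (fun _ _ => rfl)
  exact DFunLike.congr_fun this t

lemma BalancedTensor.map_add_right (i : N →ₗ[Aᵐᵒᵖ] N') (j j' : F →ₗ[A] F')
    (t : BalancedTensor A N F) :
    BalancedTensor.map A i (j + j') t =
      BalancedTensor.map A i j t + BalancedTensor.map A i j' t := by
  have : BalancedTensor.map A i (j + j') =
      BalancedTensor.map A i j + BalancedTensor.map A i j' :=
    BalancedTensor.hom_ext A (fun n x => by
      rw [AddMonoidHom.add_apply, map_mk, map_mk, map_mk, ← QuotientAddGroup.mk_add,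
        ← TensorProduct.tmul_add, LinearMap.add_apply])
  exact DFunLike.congr_fun this t

end Tensor

/-- A left `A`-module `F` is flat if `- ⊗_A F` preserves injectivity of homomorphisms of
right `A`-modules. -/
def flatLeft (A : Type u) [Ring A] : ObjectProperty (ModuleCat.{u} A) := fun F =>
  ∀ (N N' : ModuleCat.{u} Aᵐᵒᵖ) (i : N ⟶ N'), Function.Injective i.hom →
    Function.Injective (BalancedTensor.map A i.hom (LinearMap.id : F →ₗ[A] F))

/-- A right `A`-module `N` is flat if `N ⊗_A -` preserves injectivity of homomorphisms of
left `A`-modules. -/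
def flatRight (A : Type u) [Ring A] : ObjectProperty (ModuleCat.{u} Aᵐᵒᵖ) := fun N =>
  ∀ (F F' : ModuleCat.{u} A) (j : F ⟶ F'), Function.Injective j.hom →
    Function.Injective (BalancedTensor.map A (LinearMap.id : N →ₗ[Aᵐᵒᵖ] N) j.hom)

/-! The full subcategories of fp-injective and of flat modules are additive. -/

/-- `P` contains every direct sum of two objects of `P`. -/
def ClosedUnderSplit {C : Type u₁} [Category.{v₁} C] [Preadditive C] (P : ObjectProperty C) :
    Prop :=
  ∀ (X Y Z : C) (i₁ : X ⟶ Z) (p₁ : Z ⟶ X) (i₂ : Y ⟶ Z) (p₂ : Z ⟶ Y),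
    p₁ ≫ i₁ + p₂ ≫ i₂ = 𝟙 Z → P X → P Y → P Z

lemma ClosedUnderSplit.iso {C : Type u₁} [Category.{v₁} C] [Preadditive C] {P : ObjectProperty C}
    (hP : ClosedUnderSplit P) : P.IsClosedUnderIsomorphisms :=
  ⟨fun {X Y} e hX => hP X X Y e.hom e.inv 0 0 (by simp) hX hX⟩

lemma ClosedUnderSplit.prod {C : Type u₁} [Category.{v₁} C] [Preadditive C]
    [HasBinaryBiproducts C] {P : ObjectProperty C} (hP : ClosedUnderSplit P) :
    P.IsClosedUnderBinaryProducts := by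
  have := hP.iso
  refine .mk' ?_
  rintro _ ⟨F, hF⟩
  let e : limit F ≅ F.obj ⟨.left⟩ ⊞ F.obj ⟨.right⟩ :=
    HasLimit.isoOfNatIso (diagramIsoPair F) ≪≫ (biprod.isoProd _ _).symm
  exact P.prop_of_iso e.symm
    (hP _ _ _ biprod.inl biprod.fst biprod.inr biprod.snd biprod.total (hF _) (hF _))

lemma fpInjective_split (A : Type u) [Ring A] : ClosedUnderSplit (fpInjective A) :=
  fun X Y Z i₁ p₁ i₂ p₂ h hX hY S hS h₁ h₂ h₃ g => by
    obtain ⟨a, ha⟩ := hX S hS h₁ h₂ h₃ (g ≫ p₁)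
    obtain ⟨b, hb⟩ := hY S hS h₁ h₂ h₃ (g ≫ p₂)
    refine ⟨a ≫ i₁ + b ≫ i₂, ?_⟩
    rw [Preadditive.comp_add, reassoc_of% ha, reassoc_of% hb, ← Preadditive.comp_add, h,
      Category.comp_id]

lemma flatLeft_split (A : Type u) [Ring A] : ClosedUnderSplit (flatLeft A) :=
  fun X Y Z i₁ p₁ i₂ p₂ h hX hY N N' i hi => by
    rw [injective_iff_map_eq_zero]
    intro t ht
    have key : ∀ {W : ModuleCat.{u} A} (_ : flatLeft A W) (p : Z ⟶ W),
        BalancedTensor.map A (LinearMap.id : N →ₗ[Aᵐᵒᵖ] N) p.hom t = 0 := by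
      intro W hW p
      apply (injective_iff_map_eq_zero _).1 (hW N N' i hi)
      have h0 := congrArg (BalancedTensor.map A (LinearMap.id : N' →ₗ[Aᵐᵒᵖ] N') p.hom) ht
      rw [BalancedTensor.map_map, map_zero] at h0
      rw [BalancedTensor.map_map]
      exact h0
    have hid : (LinearMap.id : Z →ₗ[A] Z) = i₁.hom ∘ₗ p₁.hom + i₂.hom ∘ₗ p₂.hom :=
      (congrArg ModuleCat.Hom.hom h).symm
    rw [← BalancedTensor.map_id A t, hid, BalancedTensor.map_add_right]
    have e₁ := BalancedTensor.map_map A (LinearMap.id : N →ₗ[Aᵐᵒᵖ] N)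
      (LinearMap.id : N →ₗ[Aᵐᵒᵖ] N) p₁.hom i₁.hom t
    have e₂ := BalancedTensor.map_map A (LinearMap.id : N →ₗ[Aᵐᵒᵖ] N)
      (LinearMap.id : N →ₗ[Aᵐᵒᵖ] N) p₂.hom i₂.hom t
    rw [key hX, map_zero, LinearMap.id_comp] at e₁
    rw [key hY, map_zero, LinearMap.id_comp] at e₂
    rw [← e₁, ← e₂, add_zero]

instance (A : Type u) [Ring A] : (fpInjective A).IsClosedUnderIsomorphisms :=
  (fpInjective_split A).iso

instance (A : Type u) [Ring A] : (fpInjective A).IsClosedUnderBinaryProducts :=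
  (fpInjective_split A).prod

instance (A : Type u) [Ring A] : (fpInjective A).ContainsZero where
  exists_zero := ⟨_, isZero_zero _, fun _ _ _ _ _ _ =>
    ⟨0, (isZero_zero _).eq_of_tgt _ _⟩⟩

instance (A : Type u) [Ring A] : (flatLeft A).IsClosedUnderIsomorphisms :=
  (flatLeft_split A).iso

instance (A : Type u) [Ring A] : (flatLeft A).IsClosedUnderBinaryProducts :=
  (flatLeft_split A).prod

instance (A : Type u) [Ring A] : (flatLeft A).ContainsZero where
  exists_zero := ⟨ModuleCat.of A PUnit.{u + 1}, ModuleCat.isZero_of_subsingleton _,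
    fun N N' i _ => by
      rw [injective_iff_map_eq_zero]
      intro t _
      have : AddMonoidHom.id (BalancedTensor A N PUnit.{u + 1}) = 0 :=
        BalancedTensor.hom_ext A fun n x => by
          rw [Subsingleton.elim x 0, TensorProduct.tmul_zero]; rfl
      exact DFunLike.congr_fun this t⟩

instance {C : Type u₁} [Category.{v₁} C] [Preadditive C] [HasFiniteProducts C]
    (P : ObjectProperty C) [P.IsClosedUnderBinaryProducts] :
    HasBinaryBiproducts P.FullSubcategory :=
  have : HasBinaryProducts P.FullSubcategory := inferInstance
  HasBinaryBiproducts.of_hasBinaryProducts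

instance {C : Type u₁} {D : Type u₂} [Category.{v₁} C] [Category.{v₂} D] [Preadditive C]
    [Preadditive D] [HasZeroObject C] (F : C ⥤ D) [F.Additive] (P : ObjectProperty D)
    [P.IsClosedUnderIsomorphisms] [P.ContainsZero] :
    (P.inverseImage F).ContainsZero where
  exists_zero := ⟨_, isZero_zero C,
    P.prop_of_isZero (F.map_isZero (isZero_zero _))⟩

/-! ### Coacyclic and contraacyclic complexes -/

section Acyclic

variable {E : Type u} [Category.{v} E] [Preadditive E] [HasZeroObject E] [HasBinaryBiproducts E]

variable (E) in
/-- The homotopy category of unbounded complexes over an additive category. -/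
abbrev Hot := HomotopyCategory E (ComplexShape.up ℤ)

/-- The class of a complex in the homotopy category. -/
abbrev toHot (K : CochainComplex E ℤ) : Hot E := (HomotopyCategory.quotient E _).obj K

/-- The total complex of `K ⟶ L ⟶ M` viewed as a bicomplex with three rows, with `M` placed in
row zero: it is the cone of the morphism `cone (K ⟶ L) ⟶ M`. -/
def tot (S : ShortComplex (CochainComplex E ℤ)) : CochainComplex E ℤ :=
  CochainComplex.mappingCone
    (CochainComplex.mappingCone.desc S.f 0 S.g (by simp) :
      CochainComplex.mappingCone S.f ⟶ S.X₃)

/-- `P` contains the total complexes of all short exact sequences of complexes over `E`, where the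
exact structure of `E` is given by its class `conf` of short exact sequences. -/
def ContainsTot (conf : ObjectProperty (ShortComplex E)) (P : ObjectProperty (Hot E)) : Prop :=
  ∀ S : ShortComplex (CochainComplex E ℤ),
    (∀ n : ℤ, conf (S.map (HomologicalComplex.eval E _ n))) → P (toHot (tot S))

/-- `P` is closed under infinite direct sums of complexes. -/
def ClosedUnderSums (P : ObjectProperty (Hot E)) : Prop :=
  ∀ (J : Type v) (K : J → CochainComplex E ℤ) (c : Cofan K) (_ : IsColimit c),
    (∀ j, P (toHot (K j))) → P (toHot c.pt)

/-- `P` is closed under infinite products of complexes. -/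
def ClosedUnderProds (P : ObjectProperty (Hot E)) : Prop :=
  ∀ (J : Type v) (K : J → CochainComplex E ℤ) (c : Fan K) (_ : IsLimit c),
    (∀ j, P (toHot (K j))) → P (toHot c.pt)

/-- The coacyclic complexes over the exact category `(E, conf)`: the smallest (strictly full)
triangulated subcategory of the homotopy category which contains the total complexes of short
exact sequences of complexes and is closed under infinite direct sums. -/
def coacyclic (conf : ObjectProperty (ShortComplex E)) : ObjectProperty (Hot E) := fun X =>
  ∀ P : ObjectProperty (Hot E), P.IsTriangulated → P.IsClosedUnderIsomorphisms →
    ContainsTot conf P → ClosedUnderSums P → P X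

/-- The contraacyclic complexes over the exact category `(E, conf)`: the smallest (strictly full)
triangulated subcategory of the homotopy category which contains the total complexes of short
exact sequences of complexes and is closed under infinite products. -/
def contraacyclic (conf : ObjectProperty (ShortComplex E)) : ObjectProperty (Hot E) := fun X =>
  ∀ P : ObjectProperty (Hot E), P.IsTriangulated → P.IsClosedUnderIsomorphisms →
    ContainsTot conf P → ClosedUnderProds P → P X

variable (conf : ObjectProperty (ShortComplex E))

instance : (coacyclic conf).IsClosedUnderIsomorphisms where
  of_iso e hX P h₁ h₂ h₃ h₄ := P.prop_of_iso e (hX P h₁ h₂ h₃ h₄)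

instance : (contraacyclic conf).IsClosedUnderIsomorphisms where
  of_iso e hX P h₁ h₂ h₃ h₄ := P.prop_of_iso e (hX P h₁ h₂ h₃ h₄)

instance : (coacyclic conf).IsTriangulated where
  exists_zero := ⟨_, isZero_zero (Hot E), fun P _ _ _ _ => P.prop_of_isZero (isZero_zero _)⟩
  isStableUnderShiftBy n := ⟨fun _ hX P h₁ h₂ h₃ h₄ => P.le_shift n _ (hX P h₁ h₂ h₃ h₄)⟩
  toIsTriangulatedClosed₂ := .mk' fun T hT hX hY P h₁ h₂ h₃ h₄ =>
    P.ext_of_isTriangulatedClosed₂ T hT (hX P h₁ h₂ h₃ h₄) (hY P h₁ h₂ h₃ h₄)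

instance : (contraacyclic conf).IsTriangulated where
  exists_zero := ⟨_, isZero_zero (Hot E), fun P _ _ _ _ => P.prop_of_isZero (isZero_zero _)⟩
  isStableUnderShiftBy n := ⟨fun _ hX P h₁ h₂ h₃ h₄ => P.le_shift n _ (hX P h₁ h₂ h₃ h₄)⟩
  toIsTriangulatedClosed₂ := .mk' fun T hT hX hY P h₁ h₂ h₃ h₄ =>
    P.ext_of_isTriangulatedClosed₂ T hT (hX P h₁ h₂ h₃ h₄) (hY P h₁ h₂ h₃ h₄)

end Acyclic

/-- The exact structure of an abelian category. -/
def abelianConf (C : Type u₁) [Category.{v₁} C] [Abelian C] : ObjectProperty (ShortComplex C) :=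
  fun S => S.ShortExact

/-- The exact structure that a full subcategory inherits from an abelian category. -/
def inducedConf {C : Type u₁} [Category.{v₁} C] [Abelian C] (P : ObjectProperty C) :
    ObjectProperty (ShortComplex P.FullSubcategory) :=
  fun S => (S.map P.ι).ShortExact

/-! ### Verdier quotients -/

section Quotient

variable {T : Type u₁} [Category.{v₁} T] [HasZeroObject T] [HasShift T ℤ] [Preadditive T]
  [∀ n : ℤ, (shiftFunctor T n).Additive] [Pretriangulated T] [IsTriangulated T]
  {T' : Type u₂} [Category.{v₂} T'] [HasZeroObject T'] [HasShift T' ℤ] [Preadditive T']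
  [∀ n : ℤ, (shiftFunctor T' n).Additive] [Pretriangulated T'] [IsTriangulated T']

/-- The quotient of a triangulated category by a triangulated subcategory: the localization
at the morphisms whose cone lies in the subcategory. -/
abbrev VerdierQuotient (P : ObjectProperty T) [P.IsTriangulated] := P.trW.Localization

/-- A triangulated functor taking `P` into `P'`, as a functor compatible with localizations. -/
def quotientMorphism (G : T ⥤ T') [G.CommShift ℤ] [G.IsTriangulated] (P : ObjectProperty T)
    (P' : ObjectProperty T') [P'.IsClosedUnderIsomorphisms] (h : P ≤ P'.inverseImage G) :
    LocalizerMorphism P.trW P'.trW where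
  functor := G
  map _ _ s hs := (P'.inverseImage_trW_iff G s).1 (ObjectProperty.trW_monotone h s hs)

instance (G : T ⥤ T') [G.CommShift ℤ] [G.IsTriangulated] (P : ObjectProperty T)
    (P' : ObjectProperty T') [P'.IsClosedUnderIsomorphisms] (h : P ≤ P'.inverseImage G) :
    (quotientMorphism G P P' h).functor.CommShift ℤ := inferInstanceAs (G.CommShift ℤ)

/-- The functor between Verdier quotients induced by a triangulated functor `G` that takes
`P` into `P'`. -/
abbrev quotientFunctor (G : T ⥤ T') [G.CommShift ℤ] [G.IsTriangulated] (P : ObjectProperty T)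
    [P.IsTriangulated] (P' : ObjectProperty T') [P'.IsTriangulated] [P'.IsClosedUnderIsomorphisms]
    (h : P ≤ P'.inverseImage G) : VerdierQuotient P ⥤ VerdierQuotient P' :=
  (quotientMorphism G P P' h).localizedFunctor P.trW.Q P'.trW.Q

end Quotient

/-! ### Semicoderived and semicontraderived categories -/

/-- For `f : A → R` and a class `P` of left `A`-modules: the left `R`-modules that belong to `P`
as `A`-modules. -/
abbrev restrictProp {A R : Type u} [Ring A] [Ring R] (f : A →+* R)
    (P : ObjectProperty (ModuleCat.{u} A)) : ObjectProperty (ModuleCat.{u} R) :=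
  P.inverseImage (ModuleCat.restrictScalars.{u} f)

section Semi

variable {A R : Type u} [Ring A] [Ring R] (f : A →+* R) (P : ObjectProperty (ModuleCat.{u} A))

/-- Restriction of scalars for complexes of modules up to homotopy. -/
abbrev restrictHot : Hot (ModuleCat.{u} R) ⥤ Hot (ModuleCat.{u} A) :=
  (ModuleCat.restrictScalars.{u} f).mapHomotopyCategory (ComplexShape.up ℤ)

/-- Restriction of scalars from the `R`-modules that belong to `P` over `A`
to the `A`-modules in `P`. -/
abbrev restrictSub : (restrictProp f P).FullSubcategory ⥤ P.FullSubcategory :=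
  P.lift ((restrictProp f P).ι ⋙ ModuleCat.restrictScalars.{u} f) fun X => X.property

variable [P.ContainsZero] [P.IsClosedUnderIsomorphisms] [P.IsClosedUnderBinaryProducts]

instance : (restrictSub f P).Additive where
  map_add := rfl

/-- The functor `restrictSub` on complexes up to homotopy. -/
abbrev restrictSubHot :
    Hot (restrictProp f P).FullSubcategory ⥤ Hot P.FullSubcategory :=
  (restrictSub f P).mapHomotopyCategory (ComplexShape.up ℤ)

/-- The functor on homotopy categories of complexes induced by the embedding of the category of
`R`-modules that belong to `P` over `A` into the category of `R`-modules. -/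
abbrev embedHot : Hot (restrictProp f P).FullSubcategory ⥤ Hot (ModuleCat.{u} R) :=
  (restrictProp f P).ι.mapHomotopyCategory (ComplexShape.up ℤ)

end Semi

section Semico

variable {A R : Type u} [Ring A] [Ring R] (f : A →+* R)

/-- Complexes of left `R`-modules that are coacyclic as complexes of left `A`-modules. -/
abbrev semicoAcyclic : ObjectProperty (Hot (ModuleCat.{u} R)) :=
  (coacyclic (abelianConf (ModuleCat.{u} A))).inverseImage (restrictHot f)

/-- Complexes of `A`-fp-injective left `R`-modules that are coacyclic in the exact category of
fp-injective left `A`-modules. -/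
abbrev semicoAcyclicFpi :
    ObjectProperty (Hot (restrictProp f (fpInjective A)).FullSubcategory) :=
  (coacyclic (inducedConf (fpInjective A))).inverseImage (restrictSubHot f (fpInjective A))

/-- The `R/A`-semicoderived category of left `R`-modules. -/
abbrev Dsico := VerdierQuotient (semicoAcyclic f)

/-- The `R/A`-semicoderived category of `A`-fp-injective left `R`-modules. -/
abbrev DsicoFpi := VerdierQuotient (semicoAcyclicFpi f)

/-- The functor between semicoderived categories induced by the embedding of the
`A`-fp-injective `R`-modules into the `R`-modules; `h` says that it is well defined. -/
abbrev sicoFunctor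
    (h : semicoAcyclicFpi f ≤ (semicoAcyclic f).inverseImage (embedHot f (fpInjective A))) :
    DsicoFpi f ⥤ Dsico f :=
  quotientFunctor (embedHot f (fpInjective A)) (semicoAcyclicFpi f) (semicoAcyclic f) h

end Semico

section Semictr

variable {B S : Type u} [Ring B] [Ring S] (f : B →+* S)

/-- Complexes of left `S`-modules that are contraacyclic as complexes of left `B`-modules. -/
abbrev semictrAcyclic : ObjectProperty (Hot (ModuleCat.{u} S)) :=
  (contraacyclic (abelianConf (ModuleCat.{u} B))).inverseImage (restrictHot f)

/-- Complexes of `B`-flat left `S`-modules that are contraacyclic in the exact category of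
flat left `B`-modules. -/
abbrev semictrAcyclicFl : ObjectProperty (Hot (restrictProp f (flatLeft B)).FullSubcategory) :=
  (contraacyclic (inducedConf (flatLeft B))).inverseImage (restrictSubHot f (flatLeft B))

/-- The `S/B`-semicontraderived category of left `S`-modules. -/
abbrev Dsictr := VerdierQuotient (semictrAcyclic f)

/-- The `S/B`-semicontraderived category of `B`-flat left `S`-modules. -/
abbrev DsictrFl := VerdierQuotient (semictrAcyclicFl f)

/-- The functor between semicontraderived categories induced by the embedding of the
`B`-flat `S`-modules into the `S`-modules; `h` says that it is well defined. -/
abbrev sictrFunctor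
    (h : semictrAcyclicFl f ≤ (semictrAcyclic f).inverseImage (embedHot f (flatLeft B))) :
    DsictrFl f ⥤ Dsictr f :=
  quotientFunctor (embedHot f (flatLeft B)) (semictrAcyclicFl f) (semictrAcyclic f) h

end Semictr

end Semiderived

end

noncomputable section

namespace Semiderived

set_option linter.unusedSectionVars false

/-! ### Equivalences between Verdier quotients -/

section QuotientEquivalence

open Pretriangulated

variable {T : Type u₁} [Category.{v₁} T] [HasZeroObject T] [HasShift T ℤ] [Preadditive T]
  [∀ n : ℤ, (shiftFunctor T n).Additive] [Pretriangulated T] [IsTriangulated T]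
  {T' : Type u₂} [Category.{v₂} T'] [HasZeroObject T'] [HasShift T' ℤ] [Preadditive T']
  [∀ n : ℤ, (shiftFunctor T' n).Additive] [Pretriangulated T'] [IsTriangulated T']
  (G : T ⥤ T') [G.CommShift ℤ] [G.IsTriangulated]
  (P : ObjectProperty T) [P.IsTriangulated]
  (P' : ObjectProperty T') [P'.IsTriangulated] [P'.IsClosedUnderIsomorphisms]
  (h : P ≤ P'.inverseImage G)

/-! Both equivalences come from one principle. Let `G : T ⥤ T'` be a fully faithful triangulated
functor, let `P` be the whole preimage of `P'`, and let every object of `T'` map to an object of `T`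
(or receive a map from one) with cone in `P'`. Then fractions in `T'` can be rewritten inside `T`,
so the functor of quotients is an equivalence: `quotientFunctor_isEquivalence_of_right` and
`quotientFunctor_isEquivalence_of_left`. Two facts remain, described here for (a).

Preimage (`semicoAcyclicFpi_eq`). A complex of fp-injective `A`-modules that is coacyclic among all
`A`-modules must be coacyclic among the fp-injective ones. Consider the complexes `N` such that
every homotopy class from `N` to a complex `J` of fp-injectives factors through a complex coacyclic
among fp-injectives. They form a triangulated class closed under sums. The class contains the total
complexes of exact sequences: embed `J` in a complex `I` of injectives with quotient `J'`; coherence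
makes `J'` fp-injective, and every map to `J` from such a total complex factors through a shift of
the total complex of `J ⟶ I ⟶ J'` (`exists_fac_tot_of_injective`). Hence the class contains all
coacyclic complexes. When `N` itself has fp-injective terms, its identity factors, so `N` is a
retract of a coacyclic complex, and Eilenberg's swindle finishes the argument.

Resolutions (`exists_trW_coacyclic`). Any complex `M` over `R` embeds with contractible quotient in
a complex `X'` so that in each degree the embedding factors through an injective module by
monomorphisms. Iterate and pass to the colimit `J`. In each degree `J` is also the colimit of a
sequence of split monomorphisms between injectives, hence a retract of their direct sum. Injective
`R`-modules are injective over `A` because `R` is flat, and fp-injectives are closed under sums and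
retracts, so `J` has `A`-fp-injective terms. The cone of `M ⟶ J` is coacyclic by the telescope
sequence.

Part (b) is dual, with projectives, kernels, products and sequential limits along epimorphisms.
Coherence now enters through Chase's theorem that products of flat modules are flat (`flatLeft_pi`);
closure of flats under kernels of epimorphisms is seen on character modules (`flatLeft_X₁`). -/

lemma quotientFunctor_isTriangulated : (quotientFunctor G P P' h).IsTriangulated := by
  have : (quotientMorphism G P P' h).functor.IsTriangulated := inferInstanceAs G.IsTriangulated
  have : P.trW.Q.mapArrow.EssSurj := Localization.essSurj_mapArrow _ P.trW
  exact Functor.isTriangulated_of_precomp_iso (F := P.trW.Q)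
    (CatCommSq.iso (quotientMorphism G P P' h).functor P.trW.Q P'.trW.Q
      (quotientFunctor G P P' h)).symm

lemma quotientFunctor_additive : (quotientFunctor G P P' h).Additive := by
  have := quotientFunctor_isTriangulated G P P' h
  infer_instance

variable {P P'} [G.Full] [G.Faithful]

/-- The quotient functor is an equivalence if every object of `T'` admits a right resolution
by an object of `T`. -/
lemma quotientFunctor_isEquivalence_of_right
    (h' : P'.inverseImage G ≤ P) (hres : ∀ Y : T', ∃ (X : T) (s : Y ⟶ G.obj X), P'.trW s) :
    (quotientFunctor G P P' h).IsEquivalence := by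
  let F := quotientFunctor G P P' h
  have : F.Additive := quotientFunctor_additive G P P' h
  let e : G ⋙ P'.trW.Q ≅ P.trW.Q ⋙ F :=
    CatCommSq.iso (quotientMorphism G P P' h).functor P.trW.Q P'.trW.Q F
  -- Resolving the target of a denominator brings it into the image of `G`; fullness of `G` and the
  -- hypothesis `h'` then make it a denominator of `T`.
  have key : ∀ {X : T} {Y : T'} (s : G.obj X ⟶ Y), P'.trW s → ∃ (Z : T) (t : X ⟶ Z)
      (b : Y ⟶ G.obj Z), P.trW t ∧ s ≫ b = G.map t := fun {X Y} s hs => by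
    obtain ⟨Z, b, hb⟩ := hres Y
    exact ⟨Z, G.preimage (s ≫ b), b, ObjectProperty.trW_monotone h' _ <| (P'.inverseImage_trW_iff G _).2 (by
      rw [G.map_preimage]; exact P'.trW.comp_mem _ _ hs hb), (G.map_preimage _).symm⟩
  have : P.trW.Q.EssSurj := Localization.essSurj P.trW.Q P.trW
  have : P'.trW.Q.EssSurj := Localization.essSurj P'.trW.Q P'.trW
  have hfull : F.Full := by
    refine F.full_of_comp_essSurj P.trW.Q (fun X₁ X₂ φ => ?_)
    obtain ⟨φ', rfl⟩ : ∃ φ', φ = e.inv.app X₁ ≫ φ' ≫ e.hom.app X₂ :=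
      ⟨e.hom.app X₁ ≫ φ ≫ e.inv.app X₂, by simp⟩
    -- Expanding this fraction by `b` gives numerator and denominator between objects of `T`, hence
    -- a preimage of `φ`.
    obtain ⟨f, hf⟩ := Localization.exists_leftFraction P'.trW.Q P'.trW φ'
    obtain ⟨X₃, t, b, ht, fac⟩ := key f.s f.hs
    have := Localization.inverts P.trW.Q _ _ ht
    refine ⟨P.trW.Q.map (G.preimage (f.f ≫ b)) ≫ inv (P.trW.Q.map t), ?_⟩
    rw [← cancel_mono (F.map (P.trW.Q.map t)), ← F.map_comp, Category.assoc, IsIso.inv_hom_id,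
      Category.comp_id]
    have n₁ := e.hom.naturality (G.preimage (f.f ≫ b))
    have n₂ := e.hom.naturality t
    dsimp at n₁ n₂
    have n₃ := f.map_comp_map_s P'.trW.Q (Localization.inverts _ _)
    rw [G.map_preimage] at n₁
    rw [← cancel_epi (e.hom.app X₁), ← n₁, Category.assoc, Category.assoc, ← n₂, ← fac, hf,
      Functor.map_comp, Functor.map_comp, Iso.hom_inv_id_app_assoc, Category.assoc,
      Category.assoc, reassoc_of% n₃]
  have hfaith : F.Faithful := by
    refine Functor.faithful_of_comp_cancel_zero_of_hasLeftCalculusOfFractions P.trW.Q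
      P.trW F (fun X₁ X₂ f hf => ?_)
    have hf' : P'.trW.Q.map (G.map f) = P'.trW.Q.map 0 := by
      have n₁ := e.hom.naturality f
      dsimp at n₁
      rw [hf, comp_zero] at n₁
      rw [← cancel_mono (e.hom.app X₂), n₁, Functor.map_zero, zero_comp]
    rw [MorphismProperty.map_eq_iff_postcomp P'.trW.Q P'.trW] at hf'
    obtain ⟨X₃, s, hs, fac⟩ := hf'
    obtain ⟨X₄, t, b, ht, fac'⟩ := key s hs
    have := Localization.inverts P.trW.Q _ _ ht
    have h0 : f ≫ t = 0 := G.map_injective (by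
      rw [G.map_comp, ← fac', reassoc_of% fac, zero_comp, G.map_zero])
    rw [← cancel_mono (P.trW.Q.map t), ← Functor.map_comp, h0, Functor.map_zero, zero_comp]
  have hess : F.EssSurj := ⟨fun Y => by
    obtain ⟨X, s, hs⟩ := hres (P'.trW.Q.objPreimage Y)
    have := Localization.inverts P'.trW.Q _ _ hs
    exact ⟨P.trW.Q.obj X, ⟨(e.app X).symm ≪≫ (asIso (P'.trW.Q.map s)).symm ≪≫
      P'.trW.Q.objObjPreimageIso Y⟩⟩⟩
  exact {}

/-- The quotient functor is an equivalence if every object of `T'` admits a left resolution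
by an object of `T`. -/
lemma quotientFunctor_isEquivalence_of_left
    (h' : P'.inverseImage G ≤ P) (hres : ∀ Y : T', ∃ (X : T) (s : G.obj X ⟶ Y), P'.trW s) :
    (quotientFunctor G P P' h).IsEquivalence := by
  let F := quotientFunctor G P P' h
  have : F.Additive := quotientFunctor_additive G P P' h
  let e : G ⋙ P'.trW.Q ≅ P.trW.Q ⋙ F :=
    CatCommSq.iso (quotientMorphism G P P' h).functor P.trW.Q P'.trW.Q F
  have key : ∀ {X : T} {Y : T'} (s : Y ⟶ G.obj X), P'.trW s → ∃ (Z : T) (t : Z ⟶ X)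
      (b : G.obj Z ⟶ Y), P.trW t ∧ b ≫ s = G.map t := fun {X Y} s hs => by
    obtain ⟨Z, b, hb⟩ := hres Y
    exact ⟨Z, G.preimage (b ≫ s), b, ObjectProperty.trW_monotone h' _ <| (P'.inverseImage_trW_iff G _).2 (by
      rw [G.map_preimage]; exact P'.trW.comp_mem _ _ hb hs), (G.map_preimage _).symm⟩
  have : P.trW.Q.EssSurj := Localization.essSurj P.trW.Q P.trW
  have : P'.trW.Q.EssSurj := Localization.essSurj P'.trW.Q P'.trW
  have hfull : F.Full := by
    refine F.full_of_comp_essSurj P.trW.Q (fun X₁ X₂ φ => ?_)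
    obtain ⟨φ', rfl⟩ : ∃ φ', φ = e.inv.app X₁ ≫ φ' ≫ e.hom.app X₂ :=
      ⟨e.hom.app X₁ ≫ φ ≫ e.inv.app X₂, by simp⟩
    obtain ⟨f, hf⟩ := Localization.exists_rightFraction P'.trW.Q P'.trW φ'
    obtain ⟨X₃, t, b, ht, fac⟩ := key f.s f.hs
    have := Localization.inverts P.trW.Q _ _ ht
    refine ⟨inv (P.trW.Q.map t) ≫ P.trW.Q.map (G.preimage (b ≫ f.f)), ?_⟩
    rw [← cancel_epi (F.map (P.trW.Q.map t)), ← F.map_comp, IsIso.hom_inv_id_assoc]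
    have n₁ := e.hom.naturality (G.preimage (b ≫ f.f))
    have n₂ := e.inv.naturality t
    dsimp at n₁ n₂
    have n₃ := f.map_s_comp_map P'.trW.Q (Localization.inverts _ _)
    rw [G.map_preimage] at n₁
    rw [reassoc_of% n₂, ← cancel_epi (e.hom.app X₃), ← n₁, Iso.hom_inv_id_app_assoc, ← fac, hf,
      Functor.map_comp, Functor.map_comp, Category.assoc, Category.assoc, reassoc_of% n₃]
  have hfaith : F.Faithful := by
    refine Functor.faithful_of_comp_cancel_zero_of_hasLeftCalculusOfFractions P.trW.Q
      P.trW F (fun X₁ X₂ f hf => ?_)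
    have hf' : P'.trW.Q.map (G.map f) = P'.trW.Q.map 0 := by
      have n₁ := e.hom.naturality f
      dsimp at n₁
      rw [hf, comp_zero] at n₁
      rw [← cancel_mono (e.hom.app X₂), n₁, Functor.map_zero, zero_comp]
    rw [MorphismProperty.map_eq_iff_precomp P'.trW.Q P'.trW] at hf'
    obtain ⟨X₃, s, hs, fac⟩ := hf'
    obtain ⟨X₄, t, b, ht, fac'⟩ := key s hs
    have := Localization.inverts P.trW.Q _ _ ht
    have h0 : t ≫ f = 0 := G.map_injective (by
      rw [G.map_comp, ← fac', Category.assoc, fac, comp_zero, comp_zero, G.map_zero])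
    rw [← cancel_epi (P.trW.Q.map t), ← Functor.map_comp, h0, Functor.map_zero, comp_zero]
  have hess : F.EssSurj := ⟨fun Y => by
    obtain ⟨X, s, hs⟩ := hres (P'.trW.Q.objPreimage Y)
    have := Localization.inverts P'.trW.Q _ _ hs
    exact ⟨P.trW.Q.obj X, ⟨(e.app X).symm ≪≫ asIso (P'.trW.Q.map s) ≪≫
      P'.trW.Q.objObjPreimageIso Y⟩⟩⟩
  exact {}

end QuotientEquivalence

/-! ### Morphisms to and from the total complex of a short exact sequence -/

section TotalComplex

open CochainComplex CochainComplex.HomComplex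

variable {C : Type u₁} [Category.{v₁} C] [Abelian C]

/-- Cochains need not commute with differentials, so the extension can be chosen in each degree
independently. -/
lemma exists_ofHom_comp_eq_of_injective {X Y I : CochainComplex C ℤ} (f : X ⟶ Y)
    (hf : ∀ n, Mono (f.f n)) (hI : ∀ n, Injective (I.X n)) {n : ℤ} (c : Cochain X I n) :
    ∃ c' : Cochain Y I n, (Cochain.ofHom f).comp c' (zero_add n) = c :=
  ⟨Cochain.mk fun p q hpq => Injective.factorThru (c.v p q hpq) (f.f p), by ext; simp⟩

lemma exists_comp_ofHom_eq_of_projective {P Y Z : CochainComplex C ℤ} (g : Y ⟶ Z)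
    (hg : ∀ n, Epi (g.f n)) (hP : ∀ n, Projective (P.X n)) {n : ℤ} (c : Cochain P Z n) :
    ∃ c' : Cochain P Y n, c'.comp (Cochain.ofHom g) (add_zero n) = c :=
  ⟨Cochain.mk fun p q hpq => Projective.factorThru (c.v p q hpq) (g.f q), by ext; simp⟩

variable {S : ShortComplex (CochainComplex C ℤ)}
  (hS : ∀ n : ℤ, (S.map (HomologicalComplex.eval C _ n)).ShortExact)

include hS in
lemma exists_g_comp_eq {W : CochainComplex C ℤ} {n : ℤ} (c : Cochain S.X₂ W n)
    (hc : (Cochain.ofHom S.f).comp c (zero_add n) = 0) :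
    ∃ c' : Cochain S.X₃ W n, (Cochain.ofHom S.g).comp c' (zero_add n) = c := by
  have h : ∀ p q hpq, S.f.f p ≫ c.v p q hpq = 0 := fun p q hpq => by
    simpa using Cochain.congr_v hc p q hpq
  have := fun p => (hS p).epi_g
  exact ⟨Cochain.mk fun p q hpq => (hS p).exact.desc (c.v p q hpq) (h p q hpq), by
    ext p q hpq
    rw [Cochain.zero_cochain_comp_v, Cochain.ofHom_v]
    exact (hS p).exact.g_desc (c.v p q hpq) (h p q hpq)⟩

include hS in
lemma exists_comp_f_eq {W : CochainComplex C ℤ} {n : ℤ} (c : Cochain W S.X₂ n)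
    (hc : c.comp (Cochain.ofHom S.g) (add_zero n) = 0) :
    ∃ c' : Cochain W S.X₁ n, c'.comp (Cochain.ofHom S.f) (add_zero n) = c := by
  have h : ∀ p q hpq, c.v p q hpq ≫ S.g.f q = 0 := fun p q hpq => by
    simpa using Cochain.congr_v hc p q hpq
  have := fun p => (hS p).mono_f
  exact ⟨Cochain.mk fun p q hpq => (hS q).exact.lift (c.v p q hpq) (h p q hpq), by
    ext p q hpq
    rw [Cochain.comp_zero_cochain_v, Cochain.ofHom_v]
    exact (hS q).exact.lift_f (c.v p q hpq) (h p q hpq)⟩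

include hS in
lemma g_comp_injective {W : CochainComplex C ℤ} {n : ℤ} {c c' : Cochain S.X₃ W n}
    (h : (Cochain.ofHom S.g).comp c (zero_add n) = (Cochain.ofHom S.g).comp c' (zero_add n)) :
    c = c' := by
  ext p q hpq
  have : Epi (S.g.f p) := (hS p).epi_g
  rw [← cancel_epi (S.g.f p)]
  simpa using Cochain.congr_v h p q hpq

include hS in
lemma comp_f_injective {W : CochainComplex C ℤ} {n : ℤ} {c c' : Cochain W S.X₁ n}
    (h : c.comp (Cochain.ofHom S.f) (add_zero n) = c'.comp (Cochain.ofHom S.f) (add_zero n)) :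
    c = c' := by
  ext p q hpq
  have : Mono (S.f.f q) := (hS q).mono_f
  rw [← cancel_mono (S.f.f q)]
  simpa using Cochain.congr_v h p q hpq

/-- The morphism `cone (K ⟶ L) ⟶ M` whose cone is the total complex of `K ⟶ L ⟶ M`. -/
abbrev totMap (S : ShortComplex (CochainComplex C ℤ)) : mappingCone S.f ⟶ S.X₃ :=
  mappingCone.desc S.f 0 S.g (by simp)

/-- The cochain on the total complex of `K ⟶ L ⟶ M` with given components. -/
def totDesc (S : ShortComplex (CochainComplex C ℤ)) {W : CochainComplex C ℤ} {n m l : ℤ}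
    (a : Cochain S.X₁ W l) (b : Cochain S.X₂ W m) (c : Cochain S.X₃ W n)
    (h : m + 1 = n) (h' : l + 1 = m) : Cochain (mappingCone (totMap S)) W n :=
  mappingCone.descCochain (totMap S) (mappingCone.descCochain S.f a b h') c h

lemma totDesc_surjective {W : CochainComplex C ℤ} {n m l : ℤ}
    (γ : Cochain (mappingCone (totMap S)) W n) (h : m + 1 = n) (h' : l + 1 = m) :
    ∃ a b c, γ = totDesc S a b c h h' := by
  refine ⟨(mappingCone.inl S.f).comp ((mappingCone.inl (totMap S)).comp γ
    (show -1 + n = m by lia)) (by lia), (Cochain.ofHom (mappingCone.inr S.f)).comp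
    ((mappingCone.inl (totMap S)).comp γ (show -1 + n = m by lia)) (zero_add _),
    (Cochain.ofHom (mappingCone.inr (totMap S))).comp γ (zero_add _), ?_⟩
  unfold totDesc
  rw [mappingCone.ext_cochain_from_iff (totMap S) m n h]
  rw [mappingCone.inl_descCochain, mappingCone.inr_descCochain]
  refine ⟨?_, rfl⟩
  rw [mappingCone.ext_cochain_from_iff _ l m h', mappingCone.inl_descCochain,
    mappingCone.inr_descCochain]
  exact ⟨rfl, rfl⟩

lemma totDesc_eq_iff {W : CochainComplex C ℤ} {n m l : ℤ}
    {a a' : Cochain S.X₁ W l} {b b' : Cochain S.X₂ W m} {c c' : Cochain S.X₃ W n}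
    (h : m + 1 = n) (h' : l + 1 = m) :
    totDesc S a b c h h' = totDesc S a' b' c' h h' ↔ a = a' ∧ b = b' ∧ c = c' := by
  refine ⟨fun H => ?_, by rintro ⟨rfl, rfl, rfl⟩; rfl⟩
  unfold totDesc at H
  rw [mappingCone.ext_cochain_from_iff (totMap S) m n h, mappingCone.inl_descCochain,
    mappingCone.inl_descCochain, mappingCone.inr_descCochain, mappingCone.inr_descCochain,
    mappingCone.ext_cochain_from_iff _ l m h', mappingCone.inl_descCochain,
    mappingCone.inl_descCochain, mappingCone.inr_descCochain, mappingCone.inr_descCochain] at H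
  exact ⟨H.1.1, H.1.2, H.2⟩

/-- This turns equations between cochains on the total complex into triples of equations on the
three rows, with the signs of the two iterated cones made explicit. -/
lemma δ_totDesc {W : CochainComplex C ℤ} {n m l n' : ℤ}
    (a : Cochain S.X₁ W l) (b : Cochain S.X₂ W m) (c : Cochain S.X₃ W n)
    (h : m + 1 = n) (h' : l + 1 = m) (hn : n + 1 = n') :
    δ n n' (totDesc S a b c h h') =
      totDesc S (δ l m a + n.negOnePow • (Cochain.ofHom S.f).comp b (zero_add m))
        (δ m n b + n'.negOnePow • (Cochain.ofHom S.g).comp c (zero_add n)) (δ n n' c) hn h := by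
  unfold totDesc
  rw [mappingCone.δ_descCochain _ _ _ _ _ hn]
  rw [mappingCone.δ_descCochain _ _ _ _ _ h, mappingCone.descCochain]
  congr 2
  rw [mappingCone.ext_cochain_from_iff _ m n h]
  simp [mappingCone.descCochain]

lemma totDesc_comp {W V : CochainComplex C ℤ} {n m l : ℤ}
    (a : Cochain S.X₁ W l) (b : Cochain S.X₂ W m) (c : Cochain S.X₃ W n)
    (h : m + 1 = n) (h' : l + 1 = m) (φ : W ⟶ V) :
    (totDesc S a b c h h').comp (Cochain.ofHom φ) (add_zero n) =
      totDesc S (a.comp (Cochain.ofHom φ) (add_zero l)) (b.comp (Cochain.ofHom φ) (add_zero m))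
        (c.comp (Cochain.ofHom φ) (add_zero n)) h h' := by
  unfold totDesc
  simp [mappingCone.descCochain]

lemma totDesc_add {W : CochainComplex C ℤ} {n m l : ℤ}
    (a a' : Cochain S.X₁ W l) (b b' : Cochain S.X₂ W m) (c c' : Cochain S.X₃ W n)
    (h : m + 1 = n) (h' : l + 1 = m) :
    totDesc S a b c h h' + totDesc S a' b' c' h h' = totDesc S (a + a') (b + b') (c + c') h h' := by
  unfold totDesc
  simp [mappingCone.descCochain]
  abel

lemma totDesc_zero {W : CochainComplex C ℤ} {n m l : ℤ} (h : m + 1 = n) (h' : l + 1 = m) :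
    totDesc S (0 : Cochain S.X₁ W l) 0 0 h h' = 0 := by
  unfold totDesc
  simp [mappingCone.descCochain]

end TotalComplex

/-! ### Factorizations through total complexes with injective or projective middle row. -/

section TotalComplex

open CochainComplex CochainComplex.HomComplex

variable {C : Type u₁} [Category.{v₁} C] [Abelian C] {S S' : ShortComplex (CochainComplex C ℤ)}

/-- A degree `-2` cocycle with values in the total complex of `J ⟶ I ⟶ J'` is a triple: a map `g` to
`J`, a null-homotopy `β'` of its composite to `I` up to sign, and a cochain `β''` to `J'` whose
coboundary is minus the image of `β'`. The total complex of an exact sequence has only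
null-homotopic maps to complexes of injectives, which yields `β'`; building it row by row also
yields `β''`. -/
lemma exists_cocycle_tot_tot
    (hS : ∀ n : ℤ, (S.map (HomologicalComplex.eval C _ n)).ShortExact)
    (hI : ∀ n, Injective (S'.X₂.X n)) (g : mappingCone (totMap S) ⟶ S'.X₁) :
    ∃ z : Cocycle (mappingCone (totMap S)) (mappingCone (totMap S')) (-2),
      (z.1.comp (mappingCone.fst (totMap S')).1 (show -2 + 1 = -1 by lia)).comp
        (mappingCone.fst S'.f).1 (neg_add_cancel 1) = Cochain.ofHom g := by
  have hf : ∀ n, Mono (S.f.f n) := fun n => (hS n).mono_f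
  have e₁ : (-1 : ℤ) + 1 = 0 := rfl
  have e₂ : (-2 : ℤ) + 1 = -1 := rfl
  have e₃ : (-3 : ℤ) + 1 = -2 := rfl
  have e₄ : (-4 : ℤ) + 1 = -3 := rfl
  obtain ⟨t, s, h, hg⟩ := totDesc_surjective (Cochain.ofHom g) e₁ e₂
  -- The only use of injectivity. Adding the coboundary of `β₀` makes the component on the first row
  -- vanish, so the cocycle condition lets the next component descend to the third row.
  obtain ⟨t', ht'⟩ := exists_ofHom_comp_eq_of_injective S.f hf hI
    (t.comp (Cochain.ofHom S'.f) (add_zero _))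
  let β₀ : Cochain (mappingCone (totMap S)) S'.X₂ (-1) := totDesc S 0 t' 0 e₂ e₃
  obtain ⟨x, s', h', hγ⟩ := totDesc_surjective
    ((Cochain.ofHom g).comp (Cochain.ofHom S'.f) (add_zero 0) + δ (-1) 0 β₀) e₁ e₂
  have hγ' := hγ
  rw [δ_totDesc _ _ _ _ _ e₁, hg, totDesc_comp, totDesc_add, totDesc_eq_iff] at hγ'
  obtain ⟨hx, hs', hh'⟩ := hγ'
  have hx0 : x = 0 := by rw [← hx, ht']; simp
  have hcoc := congrArg (δ 0 1) hγ
  rw [δ_add, δ_δ, ← Cochain.ofHom_comp, δ_ofHom, zero_add, δ_totDesc _ _ _ _ _ (zero_add 1), hx0,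
    ← totDesc_zero (zero_add 1) e₁, totDesc_eq_iff] at hcoc
  obtain ⟨hc₁, hc₂, hc₃⟩ := hcoc
  obtain ⟨s'', hs''⟩ := exists_g_comp_eq hS s' (by simpa using hc₁.symm)
  have hδ : δ (-1) 0 s'' = h' := g_comp_injective hS (by
    rw [← δ_ofHom_comp, hs'']
    simpa [sub_eq_zero, add_neg_eq_zero] using hc₂.symm)
  let β₁ : Cochain (mappingCone (totMap S)) S'.X₂ (-1) := totDesc S 0 0 s'' e₂ e₃
  have hβ₁ : δ (-1) 0 β₁ = totDesc S x s' h' e₁ e₂ := by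
    rw [δ_totDesc _ _ _ _ _ e₁, totDesc_eq_iff]
    simp [hx0, hs'', hδ]
  -- On the first row `t'` restricts to a cochain coming from `J`, which dies in `J'`; so the image
  -- of `t'` in `J'` descends to the third row.
  obtain ⟨τ, hτ⟩ := exists_g_comp_eq hS (t'.comp (Cochain.ofHom S'.g) (add_zero _)) (by
    rw [← Cochain.comp_assoc_of_first_is_zero_cochain, ht',
      Cochain.comp_assoc_of_second_is_zero_cochain, ← Cochain.ofHom_comp, S'.zero]
    simp)
  have hδτ : δ (-2) (-1) τ = s''.comp (Cochain.ofHom S'.g) (add_zero _) := g_comp_injective hS (by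
    rw [← δ_ofHom_comp, hτ, ← Cochain.comp_assoc_of_first_is_zero_cochain, hs'', ← hs',
      δ_comp_ofHom]
    simp [← Cochain.ofHom_comp])
  let β' := β₀ - β₁
  let β'' : Cochain (mappingCone (totMap S)) S'.X₃ (-2) := totDesc S 0 0 τ e₃ e₄
  have hβ' : δ (-1) 0 β' + (Cocycle.ofHom g).1.comp (Cochain.ofHom S'.f) (add_zero _) = 0 := by
    rw [δ_sub, hβ₁, ← hγ]
    simp
  have hβ'' : δ (-2) (-1) β'' + β'.comp (Cochain.ofHom S'.g) (add_zero _) = 0 := by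
    have H : δ (-2) (-1) β'' + β₀.comp (Cochain.ofHom S'.g) (add_zero _) =
        β₁.comp (Cochain.ofHom S'.g) (add_zero _) := by
      rw [δ_totDesc _ _ _ _ _ e₂, totDesc_comp, totDesc_comp, totDesc_add, totDesc_eq_iff]
      simp [hτ, hδτ]
    rw [Cochain.sub_comp, ← add_sub_assoc, H, sub_self]
  refine ⟨mappingCone.liftCocycle (totMap S')
    (mappingCone.liftCocycle S'.f (Cocycle.ofHom g) β' e₁ hβ') β'' e₂ ?_, ?_⟩
  · rw [mappingCone.ofHom_desc, ← hβ'']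
    simp [mappingCone.liftCocycle, mappingCone.liftCochain, mappingCone.descCochain]
  · simp

lemma exists_comp_eq_of_cocycle_comp {K L J : CochainComplex C ℤ} (z : Cocycle K L (-2))
    (π : Cocycle L J 2) (g : K ⟶ J) (h : z.1.comp π.1 (neg_add_cancel 2) = Cochain.ofHom g) :
    ∃ (a : K ⟶ L⟦(-2 : ℤ)⟧) (b : L⟦(-2 : ℤ)⟧ ⟶ J), a ≫ b = g := by
  refine ⟨Cocycle.homOf (z.rightShift (-2) 0 rfl), -Cocycle.homOf (π.leftShift (-2) 0 rfl), ?_⟩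
  ext n
  have := Cochain.congr_v h n n (add_zero n)
  rw [Cochain.comp_v _ _ _ n (n - 2) n (by lia) (by lia), Cochain.ofHom_v] at this
  rw [← this]
  have e₁ := Cochain.rightShift_v z.1 (-2) 0 rfl n n (add_zero n) (n - 2) (by lia)
  have e₂ := Cochain.leftShift_v π.1 (-2) 0 rfl n n (add_zero n) (n - 2) (by lia)
  -- Left shifting the degree 2 cocycle introduces this sign, which the minus in the chosen second
  -- morphism cancels.
  have e₃ : Int.negOnePow (-2 * 0 + -2 * (-2 - 1) / 2) = -1 := rfl
  rw [HomologicalComplex.comp_f, HomologicalComplex.neg_f_apply, Preadditive.comp_neg]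
  change -((z.1.rightShift (-2) 0 rfl).v n n (add_zero n) ≫
    (π.1.leftShift (-2) 0 rfl).v n n (add_zero n)) = _
  rw [e₁, e₂, e₃, Category.assoc, Units.neg_smul, one_smul, Preadditive.comp_neg,
    Preadditive.comp_neg, neg_neg, Iso.inv_hom_id_assoc]

/-- For a short exact sequence `0 ⟶ J ⟶ I ⟶ J' ⟶ 0` of complexes with termwise injective `I`, every
morphism to `J` from the total complex of a short exact sequence factors through a shift of the
total complex of `J ⟶ I ⟶ J'`. -/
lemma exists_fac_tot_of_injective
    (hS : ∀ n : ℤ, (S.map (HomologicalComplex.eval C _ n)).ShortExact)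
    (hI : ∀ n, Injective (S'.X₂.X n)) (g : tot S ⟶ S'.X₁) :
    ∃ (a : tot S ⟶ (tot S')⟦(-2 : ℤ)⟧) (b : (tot S')⟦(-2 : ℤ)⟧ ⟶ S'.X₁), a ≫ b = g := by
  obtain ⟨z, hz⟩ := exists_cocycle_tot_tot hS hI g
  exact exists_comp_eq_of_cocycle_comp z (.mk ((mappingCone.fst (totMap S')).1.comp
    (mappingCone.fst S'.f).1 one_add_one_eq_two) 3 rfl
    (by rw [δ_comp _ _ _ 2 2 3 rfl rfl rfl]; simp)) g
    (by rw [← hz]; exact (Cochain.comp_assoc _ _ _ _ one_add_one_eq_two rfl).symm)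

/-- The cochain to the total complex of `K ⟶ L ⟶ M` with given components. -/
def totLift (S : ShortComplex (CochainComplex C ℤ)) {W : CochainComplex C ℤ} {n m l : ℤ}
    (a : Cochain W S.X₁ l) (b : Cochain W S.X₂ m) (c : Cochain W S.X₃ n)
    (h : n + 1 = m) (h' : m + 1 = l) : Cochain W (mappingCone (totMap S)) n :=
  mappingCone.liftCochain (totMap S) (mappingCone.liftCochain S.f a b h') c h

lemma totLift_surjective {W : CochainComplex C ℤ} {n m l : ℤ}
    (γ : Cochain W (mappingCone (totMap S)) n) (h : n + 1 = m) (h' : m + 1 = l) :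
    ∃ a b c, γ = totLift S a b c h h' := by
  refine ⟨(γ.comp (mappingCone.fst (totMap S)).1 h).comp (mappingCone.fst S.f).1 h',
    (γ.comp (mappingCone.fst (totMap S)).1 h).comp (mappingCone.snd S.f) (add_zero _),
    γ.comp (mappingCone.snd (totMap S)) (add_zero _), ?_⟩
  unfold totLift
  rw [mappingCone.ext_cochain_to_iff (totMap S) n m h,
    mappingCone.liftCochain_fst, mappingCone.liftCochain_snd]
  refine ⟨?_, rfl⟩
  rw [mappingCone.ext_cochain_to_iff _ m l h', mappingCone.liftCochain_fst,
    mappingCone.liftCochain_snd]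
  exact ⟨rfl, rfl⟩

lemma totLift_eq_iff {W : CochainComplex C ℤ} {n m l : ℤ}
    {a a' : Cochain W S.X₁ l} {b b' : Cochain W S.X₂ m} {c c' : Cochain W S.X₃ n}
    (h : n + 1 = m) (h' : m + 1 = l) :
    totLift S a b c h h' = totLift S a' b' c' h h' ↔ a = a' ∧ b = b' ∧ c = c' := by
  refine ⟨fun H => ?_, by rintro ⟨rfl, rfl, rfl⟩; rfl⟩
  unfold totLift at H
  rw [mappingCone.ext_cochain_to_iff (totMap S) n m h, mappingCone.liftCochain_fst,
    mappingCone.liftCochain_fst, mappingCone.liftCochain_snd, mappingCone.liftCochain_snd,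
    mappingCone.ext_cochain_to_iff _ m l h', mappingCone.liftCochain_fst,
    mappingCone.liftCochain_fst, mappingCone.liftCochain_snd, mappingCone.liftCochain_snd] at H
  exact ⟨H.1.1, H.1.2, H.2⟩

lemma δ_totLift {W : CochainComplex C ℤ} {n m l k : ℤ}
    (a : Cochain W S.X₁ l) (b : Cochain W S.X₂ m) (c : Cochain W S.X₃ n)
    (h : n + 1 = m) (h' : m + 1 = l) (hk : l + 1 = k) :
    δ n m (totLift S a b c h h') =
      totLift S (δ l k a) (-(δ m l b + a.comp (Cochain.ofHom S.f) (add_zero l)))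
        (δ n m c + b.comp (Cochain.ofHom S.g) (add_zero m)) h' hk := by
  unfold totLift
  rw [mappingCone.δ_liftCochain _ _ _ _ _ h', mappingCone.δ_liftCochain _ _ _ _ _ hk,
    mappingCone.liftCochain]
  congr 2
  · simp [mappingCone.liftCochain]
    abel
  · rw [mappingCone.ofHom_desc]
    simp [mappingCone.descCochain]

lemma ofHom_comp_totLift {W V : CochainComplex C ℤ} {n m l : ℤ} (φ : V ⟶ W)
    (a : Cochain W S.X₁ l) (b : Cochain W S.X₂ m) (c : Cochain W S.X₃ n)
    (h : n + 1 = m) (h' : m + 1 = l) :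
    (Cochain.ofHom φ).comp (totLift S a b c h h') (zero_add n) =
      totLift S ((Cochain.ofHom φ).comp a (zero_add l)) ((Cochain.ofHom φ).comp b (zero_add m))
        ((Cochain.ofHom φ).comp c (zero_add n)) h h' := by
  unfold totLift
  simp [mappingCone.liftCochain, Cochain.comp_assoc_of_first_is_zero_cochain]

lemma totLift_add {W : CochainComplex C ℤ} {n m l : ℤ}
    (a a' : Cochain W S.X₁ l) (b b' : Cochain W S.X₂ m) (c c' : Cochain W S.X₃ n)
    (h : n + 1 = m) (h' : m + 1 = l) :
    totLift S a b c h h' + totLift S a' b' c' h h' = totLift S (a + a') (b + b') (c + c') h h' := by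
  unfold totLift
  simp [mappingCone.liftCochain]
  abel

lemma totLift_zero {W : CochainComplex C ℤ} {n m l : ℤ} (h : n + 1 = m) (h' : m + 1 = l) :
    totLift S (0 : Cochain W S.X₁ l) 0 0 h h' = 0 := by
  unfold totLift
  simp [mappingCone.liftCochain]

/-- For a short exact sequence `0 ⟶ J' ⟶ P ⟶ J ⟶ 0` of complexes with termwise projective `P`,
every morphism from `J` to the total complex of a short exact sequence factors through the
total complex of `J' ⟶ P ⟶ J`. -/
lemma exists_fac_tot_of_projective
    (hS : ∀ n : ℤ, (S.map (HomologicalComplex.eval C _ n)).ShortExact)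
    (hP : ∀ n, Projective (S'.X₂.X n)) (g : S'.X₃ ⟶ tot S) :
    ∃ (a : S'.X₃ ⟶ tot S') (b : tot S' ⟶ tot S), a ≫ b = g := by
  change S'.X₃ ⟶ mappingCone (totMap S) at g
  suffices ∃ (a : S'.X₃ ⟶ mappingCone (totMap S'))
    (b : mappingCone (totMap S') ⟶ mappingCone (totMap S)), a ≫ b = g from this
  have hg' : ∀ n, Epi (S.g.f n) := fun n => (hS n).epi_g
  have e₁ : (-1 : ℤ) + 1 = 0 := rfl
  have e₂ : (-2 : ℤ) + 1 = -1 := rfl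
  have e₃ : (0 : ℤ) + 1 = 1 := rfl
  have e₄ : (1 : ℤ) + 1 = 2 := rfl
  have e₅ : (2 : ℤ) + 1 = 3 := rfl
  obtain ⟨x, y, z, hg⟩ := totLift_surjective (Cochain.ofHom g) e₃ e₄
  -- The only use of projectivity. The composite from the middle row of `S'` loses its third
  -- component after subtracting the coboundary of `β₀`, and the cocycle condition then lifts its
  -- second component through `S.f`.
  obtain ⟨w, hw⟩ := exists_comp_ofHom_eq_of_projective S.g hg' hP
    ((Cochain.ofHom S'.g).comp z (zero_add _))
  let β₀ : Cochain S'.X₂ (mappingCone (totMap S)) (-1) := totLift S 0 w 0 e₁ e₃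
  obtain ⟨x₁, y₁, z₁, hγ⟩ := totLift_surjective
    ((Cochain.ofHom S'.g).comp (Cochain.ofHom g) (zero_add 0) + -δ (-1) 0 β₀) e₃ e₄
  have hγ' := hγ
  have hβ₀ : -δ (-1) 0 β₀ = totLift S 0 (δ 0 1 w)
      (-w.comp (Cochain.ofHom S.g) (add_zero _)) e₃ e₄ := by
    rw [neg_eq_iff_eq_neg, eq_neg_iff_add_eq_zero, δ_totLift _ _ _ e₁ e₃ e₄, totLift_add,
      ← totLift_zero e₃ e₄, totLift_eq_iff]
    simp
  rw [hβ₀, hg, ofHom_comp_totLift, totLift_add, totLift_eq_iff] at hγ'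
  obtain ⟨hx, hy, hz⟩ := hγ'
  have hz0 : z₁ = 0 := by rw [← hz, hw]; simp
  have hcoc := congrArg (δ 0 1) hγ
  rw [δ_add, δ_neg, δ_δ, ← Cochain.ofHom_comp, δ_ofHom, neg_zero, zero_add,
    δ_totLift _ _ _ e₃ e₄ e₅, hz0, ← totLift_zero e₄ e₅, totLift_eq_iff] at hcoc
  obtain ⟨hc₁, hc₂, hc₃⟩ := hcoc
  obtain ⟨s, hs⟩ := exists_comp_f_eq hS y₁ (by simpa using hc₃.symm)
  have hδ : δ 1 2 s = -x₁ := comp_f_injective hS (by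
    rw [← δ_comp_ofHom, hs]
    rw [Cochain.neg_comp]
    exact eq_neg_of_add_eq_zero_left (neg_eq_zero.1 hc₂.symm))
  let β₁ : Cochain S'.X₂ (mappingCone (totMap S)) (-1) := totLift S s 0 0 e₁ e₃
  have hβ₁ : δ (-1) 0 β₁ + totLift S x₁ y₁ z₁ e₃ e₄ = 0 := by
    rw [δ_totLift _ _ _ e₁ e₃ e₄, totLift_add, ← totLift_zero e₃ e₄, totLift_eq_iff]
    simp [hz0, hs, hδ]
  obtain ⟨v, hv⟩ := exists_comp_f_eq hS ((Cochain.ofHom S'.f).comp w (zero_add _)) (by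
    rw [Cochain.comp_assoc_of_first_is_zero_cochain, hw,
      ← Cochain.comp_assoc_of_first_is_zero_cochain, ← Cochain.ofHom_comp, S'.zero]
    simp)
  have hδv : δ 0 1 v = (Cochain.ofHom S'.f).comp s (zero_add _) := comp_f_injective hS (by
    rw [← δ_comp_ofHom, hv, Cochain.comp_assoc_of_first_is_zero_cochain, hs, ← hy,
      δ_ofHom_comp, Cochain.comp_add, ← Cochain.comp_assoc_of_first_is_zero_cochain,
      ← Cochain.ofHom_comp, S'.zero]
    simp)
  let α₁ : Cochain S'.X₁ (mappingCone (totMap S)) (-2) := totLift S v 0 0 e₂ e₁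
  let α₂ := β₀ - β₁
  have hα₂ : δ (-1) 0 α₂ = Cochain.ofHom (S'.g ≫ g) := by
    rw [δ_sub, eq_neg_of_add_eq_zero_left hβ₁, ← hγ, ← Cochain.ofHom_comp]
    abel
  have hα₁ : δ (-2) (-1) α₁ + (Cochain.ofHom S'.f).comp α₂ (zero_add _) = 0 := by
    have H : δ (-2) (-1) α₁ + (Cochain.ofHom S'.f).comp β₀ (zero_add _) =
        (Cochain.ofHom S'.f).comp β₁ (zero_add _) := by
      rw [δ_totLift _ _ _ e₂ e₁ e₃, ofHom_comp_totLift, ofHom_comp_totLift, totLift_add,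
        totLift_eq_iff]
      simp [hv, hδv]
    rw [Cochain.comp_sub, ← add_sub_assoc, H, sub_self]
  -- No shift is needed here: the third row is a subcomplex of the total complex. Extending `g` over
  -- the total complex takes the null-homotopy `α₂` on the middle row and the correction `α₁` on the
  -- first.
  refine ⟨mappingCone.inr (totMap S'),
    mappingCone.desc (totMap S') (mappingCone.descCochain S'.f α₁ α₂ e₂) g ?_,
    mappingCone.inr_desc _ _ _ _⟩
  rw [mappingCone.δ_descCochain _ _ _ _ _ e₁, hα₂]
  rw [Int.negOnePow_zero, one_smul, hα₁, Cochain.ofHom_comp, Cochain.ofHom_comp,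
    mappingCone.ofHom_desc]
  simp [mappingCone.descCochain]

end TotalComplex

/-! ### Coproducts and products in the homotopy category -/

section Coproducts

open CochainComplex CochainComplex.HomComplex

variable {E : Type u₁} [Category.{v₁} E] [Preadditive E] {J : Type u₂}
  {K : J → CochainComplex E ℤ}

lemma cochain_ext_of_isColimit [HasColimitsOfShape (Discrete J) E] {c : Cofan K}
    (hc : IsColimit c) {L : CochainComplex E ℤ} {n : ℤ} {z z' : Cochain c.pt L n}
    (h : ∀ j, (Cochain.ofHom (c.inj j)).comp z (zero_add n) =
      (Cochain.ofHom (c.inj j)).comp z' (zero_add n)) : z = z' := by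
  ext p q hpq
  refine (isColimitOfPreserves (HomologicalComplex.eval E _ p) hc).hom_ext fun ⟨j⟩ => ?_
  have := Cochain.congr_v (h j) p q hpq
  rwa [Cochain.zero_cochain_comp_v, Cochain.zero_cochain_comp_v, Cochain.ofHom_v] at this

lemma exists_cochain_of_isColimit [HasColimitsOfShape (Discrete J) E] {c : Cofan K}
    (hc : IsColimit c) {L : CochainComplex E ℤ} {n : ℤ} (z : ∀ j, Cochain (K j) L n) :
    ∃ z' : Cochain c.pt L n, ∀ j, (Cochain.ofHom (c.inj j)).comp z' (zero_add n) = z j := by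
  refine ⟨Cochain.mk fun p q hpq =>
    (isColimitOfPreserves (HomologicalComplex.eval E _ p) hc).desc
      ⟨L.X q, Discrete.natTrans fun j => (z j.as).v p q hpq⟩, fun j => ?_⟩
  ext p q hpq
  rw [Cochain.zero_cochain_comp_v, Cochain.ofHom_v]
  exact (isColimitOfPreserves (HomologicalComplex.eval E _ p) hc).fac _ ⟨j⟩

lemma cochain_ext_of_isLimit [HasLimitsOfShape (Discrete J) E] {c : Fan K}
    (hc : IsLimit c) {L : CochainComplex E ℤ} {n : ℤ} {z z' : Cochain L c.pt n}
    (h : ∀ j, z.comp (Cochain.ofHom (c.proj j)) (add_zero n) =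
      z'.comp (Cochain.ofHom (c.proj j)) (add_zero n)) : z = z' := by
  ext p q hpq
  refine (isLimitOfPreserves (HomologicalComplex.eval E _ q) hc).hom_ext fun ⟨j⟩ => ?_
  have := Cochain.congr_v (h j) p q hpq
  rwa [Cochain.comp_zero_cochain_v, Cochain.comp_zero_cochain_v, Cochain.ofHom_v] at this

lemma exists_cochain_of_isLimit [HasLimitsOfShape (Discrete J) E] {c : Fan K}
    (hc : IsLimit c) {L : CochainComplex E ℤ} {n : ℤ} (z : ∀ j, Cochain L (K j) n) :
    ∃ z' : Cochain L c.pt n, ∀ j, z'.comp (Cochain.ofHom (c.proj j)) (add_zero n) = z j := by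
  refine ⟨Cochain.mk fun p q hpq =>
    (isLimitOfPreserves (HomologicalComplex.eval E _ q) hc).lift
      ⟨L.X p, Discrete.natTrans fun j => (z j.as).v p q hpq⟩, fun j => ?_⟩
  ext p q hpq
  rw [Cochain.comp_zero_cochain_v, Cochain.ofHom_v]
  exact (isLimitOfPreserves (HomologicalComplex.eval E _ q) hc).fac _ ⟨j⟩

lemma quotient_map_eq_zero_iff {K L : CochainComplex E ℤ} (f : K ⟶ L) :
    (HomotopyCategory.quotient E _).map f = 0 ↔
      ∃ z : Cochain K L (-1), δ (-1) 0 z = Cochain.ofHom f := by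
  rw [HomotopyCategory.quotient_map_eq_zero_iff]
  refine ⟨fun ⟨h⟩ => ⟨(Cochain.equivHomotopy f 0 h).1, ?_⟩,
    fun ⟨z, hz⟩ => ⟨(Cochain.equivHomotopy f 0).symm ⟨z, by simp [hz]⟩⟩⟩
  simp

/-- Null-homotopies on the summands assemble in each degree into one on the coproduct. With
`exists_hot_desc` this says that coproducts of complexes remain coproducts up to homotopy. -/
lemma hot_hom_ext_of_isColimit [HasColimitsOfShape (Discrete J) E] {c : Cofan K}
    (hc : IsColimit c) {X : Hot E} {f g : toHot c.pt ⟶ X}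
    (h : ∀ j, (HomotopyCategory.quotient E _).map (c.inj j) ≫ f =
      (HomotopyCategory.quotient E _).map (c.inj j) ≫ g) : f = g := by
  obtain ⟨X, rfl⟩ := HomotopyCategory.quotient_obj_surjective X
  rw [← sub_eq_zero]
  obtain ⟨φ, hφ⟩ := (HomotopyCategory.quotient E _).map_surjective (f - g)
  rw [← hφ, quotient_map_eq_zero_iff]
  have h' : ∀ j, (HomotopyCategory.quotient E _).map (c.inj j ≫ φ) = 0 := fun j => by
    rw [Functor.map_comp, hφ, Preadditive.comp_sub, h, sub_self]
  simp only [quotient_map_eq_zero_iff] at h'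
  choose z hz using h'
  obtain ⟨z', hz'⟩ := exists_cochain_of_isColimit hc z
  refine ⟨z', cochain_ext_of_isColimit hc fun j => ?_⟩
  rw [← δ_ofHom_comp, hz', hz, Cochain.ofHom_comp]

lemma hot_hom_ext_of_isLimit [HasLimitsOfShape (Discrete J) E] {c : Fan K}
    (hc : IsLimit c) {X : Hot E} {f g : X ⟶ toHot c.pt}
    (h : ∀ j, f ≫ (HomotopyCategory.quotient E _).map (c.proj j) =
      g ≫ (HomotopyCategory.quotient E _).map (c.proj j)) : f = g := by
  obtain ⟨X, rfl⟩ := HomotopyCategory.quotient_obj_surjective X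
  rw [← sub_eq_zero]
  obtain ⟨φ, hφ⟩ := (HomotopyCategory.quotient E _).map_surjective (f - g)
  rw [← hφ, quotient_map_eq_zero_iff]
  have h' : ∀ j, (HomotopyCategory.quotient E _).map (φ ≫ c.proj j) = 0 := fun j => by
    rw [Functor.map_comp, hφ, Preadditive.sub_comp, h, sub_self]
  simp only [quotient_map_eq_zero_iff] at h'
  choose z hz using h'
  obtain ⟨z', hz'⟩ := exists_cochain_of_isLimit hc z
  refine ⟨z', cochain_ext_of_isLimit hc fun j => ?_⟩
  rw [← δ_comp_ofHom, hz', hz, Cochain.ofHom_comp]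

lemma exists_hot_desc {c : Cofan K} (hc : IsColimit c) {X : Hot E} (f : ∀ j, toHot (K j) ⟶ X) :
    ∃ g : toHot c.pt ⟶ X, ∀ j, (HomotopyCategory.quotient E _).map (c.inj j) ≫ g = f j := by
  obtain ⟨X, rfl⟩ := HomotopyCategory.quotient_obj_surjective X
  choose φ hφ using fun j => (HomotopyCategory.quotient E _).map_surjective (f j)
  refine ⟨(HomotopyCategory.quotient E _).map (Cofan.IsColimit.desc hc φ), fun j => ?_⟩
  rw [← Functor.map_comp, Cofan.IsColimit.fac, hφ]

lemma exists_hot_lift {c : Fan K} (hc : IsLimit c) {X : Hot E} (f : ∀ j, X ⟶ toHot (K j)) :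
    ∃ g : X ⟶ toHot c.pt, ∀ j, g ≫ (HomotopyCategory.quotient E _).map (c.proj j) = f j := by
  obtain ⟨X, rfl⟩ := HomotopyCategory.quotient_obj_surjective X
  choose φ hφ using fun j => (HomotopyCategory.quotient E _).map_surjective (f j)
  refine ⟨(HomotopyCategory.quotient E _).map (Fan.IsLimit.lift hc φ), fun j => ?_⟩
  rw [← Functor.map_comp, Fan.IsLimit.fac, hφ]

end Coproducts

/-! ### Closure under retracts by Eilenberg's swindle. -/

section Retracts

open Pretriangulated

/-- The five identities say `A ≅ A ⊞ X`, so the split triangle on `A ⟶ A ⊞ X ⟶ X` has two vertices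
in `P`. -/
lemma prop_of_biproduct_decomposition {T : Type u₁} [Category.{v₁} T] [HasZeroObject T]
    [HasShift T ℤ] [Preadditive T] [∀ n : ℤ, (shiftFunctor T n).Additive] [Pretriangulated T]
    (P : ObjectProperty T) [P.IsTriangulated] [P.IsClosedUnderIsomorphisms]
    {A X : T} (hA : P A) (θ ρ : A ⟶ A) (σ : X ⟶ A) (π : A ⟶ X) (h₁ : θ ≫ ρ = 𝟙 A)
    (h₂ : θ ≫ π = 0) (h₃ : σ ≫ ρ = 0) (h₄ : σ ≫ π = 𝟙 X) (h₅ : ρ ≫ θ + π ≫ σ = 𝟙 A) : P X := by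
  let e : A ≅ A ⊞ X := ⟨biprod.lift ρ π, biprod.desc θ σ, by simpa using h₅, by
    apply biprod.hom_ext' <;> apply biprod.hom_ext <;> simp [h₁, h₂, h₃, h₄]⟩
  exact P.ext_of_isTriangulatedClosed₃ _ (binaryBiproductTriangle_distinguished A X) hA
    (P.prop_of_iso e hA)

variable {E : Type u} [Category.{v} E] [Preadditive E] [HasZeroObject E] [HasBinaryBiproducts E]
  (P : ObjectProperty (Hot E)) [P.IsTriangulated] [P.IsClosedUnderIsomorphisms]

/-- Eilenberg's swindle. -/
lemma ClosedUnderSums.isStableUnderRetracts [HasCoproducts.{v} E] (hP : ClosedUnderSums P) :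
    P.IsStableUnderRetracts where
  of_retract {X Y} r hY := by
    obtain ⟨Y, rfl⟩ := HomotopyCategory.quotient_obj_surjective Y
    let K : ULift.{v} ℕ → CochainComplex E ℤ := fun _ => Y
    have hc : IsColimit (colimit.cocone (Discrete.functor K)) := colimit.isColimit _
    let c : Cofan K := colimit.cocone (Discrete.functor K)
    let ι : ℕ → (toHot Y ⟶ toHot c.pt) := fun n => (HomotopyCategory.quotient E _).map (c.inj ⟨n⟩)
    have ext {Z : Hot E} {f g : toHot c.pt ⟶ Z} (h : ∀ n, ι n ≫ f = ι n ≫ g) : f = g :=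
      hot_hom_ext_of_isColimit hc fun j => h j.down
    have desc {Z : Hot E} (f : ℕ → (toHot Y ⟶ Z)) : ∃ g : toHot c.pt ⟶ Z, ∀ n, ι n ≫ g = f n :=
      (exists_hot_desc hc fun j => f j.down).imp fun g hg n => hg ⟨n⟩
    let e : toHot Y ⟶ toHot Y := r.r ≫ r.i
    have he : e ≫ e = e := by simp [e]
    have hie : r.i ≫ e = r.i := by simp [e]
    have her : e ≫ r.r = r.r := by simp [e]
    -- The `e`-part of each copy of `Y` moves one place to the right and the complementary part
    -- stays, which frees a copy of `X` at place 0. Writing this with the idempotent `e` avoids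
    -- needing a complement of `X` in `Y`.
    obtain ⟨θ, hθ⟩ := desc fun n => (𝟙 _ - e) ≫ ι n + e ≫ ι (n + 1)
    obtain ⟨ρ, hρ⟩ := desc fun n => (𝟙 _ - e) ≫ ι n + Nat.casesOn n 0 fun m => e ≫ ι m
    obtain ⟨π, hπ⟩ := desc fun n => Nat.casesOn n r.r fun _ => 0
    refine prop_of_biproduct_decomposition P (hP _ K c hc fun _ => hY) θ ρ (r.i ≫ ι 0) π
      (ext fun n => ?_) (ext fun n => ?_) ?_ ?_ (ext fun n => ?_)
    · cases n <;> simp [reassoc_of% hθ, hρ, Preadditive.sub_comp, Preadditive.comp_sub,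
        reassoc_of% he]
    · cases n <;> simp [reassoc_of% hθ, hπ, Preadditive.sub_comp, her]
    · simp [hρ, Preadditive.sub_comp, Preadditive.comp_sub, reassoc_of% hie]
    · simp [hπ]
    · cases n <;> simp [reassoc_of% hρ, reassoc_of% hπ, hθ, Preadditive.sub_comp,
        Preadditive.comp_sub, e]

lemma ClosedUnderProds.isStableUnderRetracts [HasProducts.{v} E] (hP : ClosedUnderProds P) :
    P.IsStableUnderRetracts where
  of_retract {X Y} r hY := by
    obtain ⟨Y, rfl⟩ := HomotopyCategory.quotient_obj_surjective Y
    let K : ULift.{v} ℕ → CochainComplex E ℤ := fun _ => Y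
    have hc : IsLimit (limit.cone (Discrete.functor K)) := limit.isLimit _
    let c : Fan K := limit.cone (Discrete.functor K)
    let p : ℕ → (toHot c.pt ⟶ toHot Y) := fun n => (HomotopyCategory.quotient E _).map (c.proj ⟨n⟩)
    have ext {Z : Hot E} {f g : Z ⟶ toHot c.pt} (h : ∀ n, f ≫ p n = g ≫ p n) : f = g :=
      hot_hom_ext_of_isLimit hc fun j => h j.down
    have lift {Z : Hot E} (f : ℕ → (Z ⟶ toHot Y)) : ∃ g : Z ⟶ toHot c.pt, ∀ n, g ≫ p n = f n :=
      (exists_hot_lift hc fun j => f j.down).imp fun g hg n => hg ⟨n⟩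
    let e : toHot Y ⟶ toHot Y := r.r ≫ r.i
    have he : e ≫ e = e := by simp [e]
    have hie : r.i ≫ e = r.i := by simp [e]
    have her : e ≫ r.r = r.r := by simp [e]
    -- The same displacement, described by coordinates of the product: `ρ` drops the `e`-part at
    -- place 0 and `θ` reinserts zero there.
    obtain ⟨ρ, hρ⟩ := lift fun n => p n ≫ (𝟙 _ - e) + p (n + 1) ≫ e
    obtain ⟨θ, hθ⟩ := lift fun n => p n ≫ (𝟙 _ - e) + Nat.casesOn n 0 fun m => p m ≫ e
    obtain ⟨σ, hσ⟩ := lift fun n => Nat.casesOn n r.i fun _ => 0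
    refine prop_of_biproduct_decomposition P (hP _ K c hc fun _ => hY) θ ρ σ (p 0 ≫ r.r)
      (ext fun n => ?_) ?_ (ext fun n => ?_) ?_ (ext fun n => ?_)
    · cases n <;> simp [reassoc_of% hθ, hθ, hρ, Preadditive.sub_comp, Preadditive.comp_sub, he]
    · simp [reassoc_of% hθ, Preadditive.sub_comp, Preadditive.comp_sub, her]
    · cases n <;> simp [reassoc_of% hσ, hσ, hρ, Preadditive.comp_sub, hie]
    · simp [reassoc_of% hσ]
    · cases n <;> simp [reassoc_of% hρ, hρ, hσ, hθ, Preadditive.sub_comp,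
        Preadditive.comp_sub, he, e]

end Retracts

/-! ### Coacyclic and contraacyclic complexes under exact functors -/

section Functoriality

open CochainComplex Pretriangulated

variable {E : Type u} [Category.{v} E] [Preadditive E] [HasZeroObject E] [HasBinaryBiproducts E]

lemma prop_mappingCone_iff (P : ObjectProperty (Hot E)) [P.IsClosedUnderIsomorphisms]
    {K L : CochainComplex E ℤ} (φ : K ⟶ L) :
    P (toHot (mappingCone φ)) ↔ P.trW ((HomotopyCategory.quotient E _).map φ) :=
  (P.trW_iff_of_distinguished _ (HomotopyCategory.mappingCone_triangleh_distinguished φ)).symm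

lemma containsTot_coacyclic (conf : ObjectProperty (ShortComplex E)) :
    ContainsTot conf (coacyclic conf) := fun S hS _ _ _ h₃ _ => h₃ S hS

lemma containsTot_contraacyclic (conf : ObjectProperty (ShortComplex E)) :
    ContainsTot conf (contraacyclic conf) := fun S hS _ _ _ h₃ _ => h₃ S hS

lemma closedUnderSums_coacyclic (conf : ObjectProperty (ShortComplex E)) :
    ClosedUnderSums (coacyclic conf) := fun J K c hc hK P h₁ h₂ h₃ h₄ =>
  h₄ J K c hc fun j => hK j P h₁ h₂ h₃ h₄

lemma closedUnderProds_contraacyclic (conf : ObjectProperty (ShortComplex E)) :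
    ClosedUnderProds (contraacyclic conf) := fun J K c hc hK P h₁ h₂ h₃ h₄ =>
  h₄ J K c hc fun j => hK j P h₁ h₂ h₃ h₄

variable {E' : Type u₂} [Category.{v} E'] [Preadditive E'] [HasZeroObject E']
  [HasBinaryBiproducts E'] (G : E ⥤ E') [G.Additive]

lemma add_comp_comp_eq_of_eq_zero {C : Type u₁} [Category.{v₁} C] [Preadditive C]
    {A B X D Y : C} (a : A ⟶ B) (b : A ⟶ X) {i : B ⟶ D} {j : X ⟶ D} {s : D ⟶ X}
    (hi : i ≫ s = 0) (hj : j ≫ s = 𝟙 X) (t : X ⟶ Y) :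
    (a ≫ i + b ≫ j) ≫ s ≫ t = b ≫ t := by
  rw [Preadditive.add_comp, Category.assoc, Category.assoc, reassoc_of% hi, reassoc_of% hj,
    zero_comp, comp_zero, zero_add]

/-- Additive functors commute with cones, and `tot` is a cone on a map out of a cone. The inner
cones are compared as complexes, the outer ones only as third vertices of isomorphic triangles. -/
lemma nonempty_mapHomotopyCategory_tot_iso (S : ShortComplex (CochainComplex E ℤ)) :
    Nonempty ((G.mapHomotopyCategory (ComplexShape.up ℤ)).obj (toHot (tot S)) ≅
      toHot (tot (S.map (G.mapHomologicalComplex (ComplexShape.up ℤ))))) := by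
  have e : (G.mapHomologicalComplex _).map (mappingCone.desc S.f 0 S.g (by simp)) =
      (mappingCone.mapHomologicalComplexIso S.f G).hom ≫
        mappingCone.desc ((G.mapHomologicalComplex _).map S.f) 0
          ((G.mapHomologicalComplex _).map S.g) (by
            rw [← Functor.map_comp, S.zero, Functor.map_zero]; simp) := by
    ext n
    simp [mappingCone.mapHomologicalComplexIso, mappingCone.mapHomologicalComplexXIso,
      mappingCone.desc_f _ _ _ _ n (n + 1) rfl]
    exact (add_comp_comp_eq_of_eq_zero _ _
      (mappingCone.inl_v_snd_v ((G.mapHomologicalComplex (.up ℤ)).map S.f) _ _ _)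
      (mappingCone.inr_f_snd_v ((G.mapHomologicalComplex (.up ℤ)).map S.f) _) _).symm
  exact ⟨Triangle.π₃.mapIso <| isoTriangleOfIso₁₂ _ _
    ((G.mapHomotopyCategory (ComplexShape.up ℤ)).map_distinguished _
      (HomotopyCategory.mappingCone_triangleh_distinguished (mappingCone.desc S.f 0 S.g (by simp))))
    (HomotopyCategory.mappingCone_triangleh_distinguished
      (mappingCone.desc ((G.mapHomologicalComplex (.up ℤ)).map S.f) 0
        ((G.mapHomologicalComplex (.up ℤ)).map S.g) (by
            rw [← Functor.map_comp, S.zero, Functor.map_zero]; simp)))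
    ((HomotopyCategory.quotient E' _).mapIso (mappingCone.mapHomologicalComplexIso S.f G))
    (Iso.refl _) ((Category.comp_id _).trans
      ((congrArg (HomotopyCategory.quotient E' _).map e).trans (Functor.map_comp _ _ _)))⟩

lemma containsTot_inverseImage (conf : ObjectProperty (ShortComplex E))
    (conf' : ObjectProperty (ShortComplex E')) (hG : ∀ S, conf S → conf' (S.map G))
    (P : ObjectProperty (Hot E')) [P.IsClosedUnderIsomorphisms]
    (hP : ContainsTot conf' P) :
    ContainsTot conf (P.inverseImage (G.mapHomotopyCategory (ComplexShape.up ℤ))) :=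
  fun S hS => P.prop_of_iso (nonempty_mapHomotopyCategory_tot_iso G S).some.symm
    (hP (S.map (G.mapHomologicalComplex _)) fun n => hG _ (hS n))

/-- The inverse image of the coacyclic complexes has all the closure properties over which
`coacyclic` is minimal. -/
lemma coacyclic_le_inverseImage [HasCoproducts.{v} E]
    [∀ J : Type v, PreservesColimitsOfShape (Discrete J) G] (conf : ObjectProperty (ShortComplex E))
    (conf' : ObjectProperty (ShortComplex E')) (hG : ∀ S, conf S → conf' (S.map G)) :
    coacyclic conf ≤ (coacyclic conf').inverseImage
      (G.mapHomotopyCategory (ComplexShape.up ℤ)) := by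
  refine fun X hX => hX _ inferInstance inferInstance
    (containsTot_inverseImage G conf conf' hG _ (containsTot_coacyclic conf'))
    fun J K c hc hK => ?_
  have : PreservesColimitsOfShape (Discrete J) (G.mapHomologicalComplex (ComplexShape.up ℤ)) :=
    HomologicalComplex.preservesColimitsOfShape_of_eval _ fun i =>
      inferInstanceAs (PreservesColimitsOfShape (Discrete J) (HomologicalComplex.eval E _ i ⋙ G))
  exact closedUnderSums_coacyclic conf' J _ _
    (isColimitCofanMkObjOfIsColimit (G.mapHomologicalComplex _) K c.inj
      (hc.ofIsoColimit (Cofan.ext (Iso.refl _)))) hK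

lemma contraacyclic_le_inverseImage [HasProducts.{v} E]
    [∀ J : Type v, PreservesLimitsOfShape (Discrete J) G] (conf : ObjectProperty (ShortComplex E))
    (conf' : ObjectProperty (ShortComplex E')) (hG : ∀ S, conf S → conf' (S.map G)) :
    contraacyclic conf ≤ (contraacyclic conf').inverseImage
      (G.mapHomotopyCategory (ComplexShape.up ℤ)) := by
  refine fun X hX => hX _ inferInstance inferInstance
    (containsTot_inverseImage G conf conf' hG _ (containsTot_contraacyclic conf'))
    fun J K c hc hK => ?_
  have : PreservesLimitsOfShape (Discrete J) (G.mapHomologicalComplex (ComplexShape.up ℤ)) :=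
    HomologicalComplex.preservesLimitsOfShape_of_eval _ fun i =>
      inferInstanceAs (PreservesLimitsOfShape (Discrete J) (HomologicalComplex.eval E _ i ⋙ G))
  exact closedUnderProds_contraacyclic conf' J _ _
    (isLimitFanMkObjOfIsLimit (G.mapHomologicalComplex _) K c.proj
      (hc.ofIsoLimit (Fan.ext (Iso.refl _)))) hK

end Functoriality

/-! ### Objects all of whose morphisms factor through a triangulated subcategory -/

section Factorization

open Pretriangulated

variable {T : Type u₁} [Category.{v₁} T] [HasZeroObject T] [HasShift T ℤ] [Preadditive T]
  [∀ n : ℤ, (shiftFunctor T n).Additive] [Pretriangulated T] [IsTriangulated T]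
  {T' : Type u₂} [Category.{v₂} T'] [HasZeroObject T'] [HasShift T' ℤ] [Preadditive T']
  [∀ n : ℤ, (shiftFunctor T' n).Additive] [Pretriangulated T'] [IsTriangulated T']
  (G : T ⥤ T') [G.CommShift ℤ] [G.IsTriangulated]
  (P : ObjectProperty T) [P.IsTriangulated]

/-- The objects `N` such that every morphism from `N` to an object `G.obj J` factors through the
image under `G` of a morphism from an object of `P` to `J`. -/
def rightFactoring : ObjectProperty T' := fun N =>
  ∀ (J : T) (g : N ⟶ G.obj J), ∃ (L : T) (_ : P L) (a : N ⟶ G.obj L) (u : L ⟶ J),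
    a ≫ G.map u = g

/-- The objects `N` such that every morphism from an object `G.obj J` to `N` factors through the
image under `G` of a morphism from `J` to an object of `P`. -/
def leftFactoring : ObjectProperty T' := fun N =>
  ∀ (J : T) (g : G.obj J ⟶ N), ∃ (L : T) (_ : P L) (u : J ⟶ L) (a : G.obj L ⟶ N),
    G.map u ≫ a = g

variable {G P} in
-- The triangle `L ⟶ J ⟶ J'` translates factoring through `L` into dying in `J'`. In the second form
-- two successive steps simply compose, which is how closure under extensions is obtained.
lemma exists_right_fac_iff {N : T'} {J : T} (g : N ⟶ G.obj J) :
    (∃ (L : T) (_ : P L) (a : N ⟶ G.obj L) (u : L ⟶ J), a ≫ G.map u = g) ↔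
      ∃ (J' : T) (s : J ⟶ J'), P.trW s ∧ g ≫ G.map s = 0 := by
  constructor
  · rintro ⟨L, hL, a, u, rfl⟩
    obtain ⟨J', s, w, hT⟩ := distinguished_cocone_triangle u
    have h0 : u ≫ s = 0 := comp_distTriang_mor_zero₁₂ _ hT
    exact ⟨J', s, (P.trW_iff' s).2 ⟨L, u, w, hT, hL⟩, by
      rw [Category.assoc, ← G.map_comp, h0, G.map_zero, comp_zero]⟩
  · rintro ⟨J', s, hs, h0⟩
    obtain ⟨L, u, w, hT, hL⟩ := (P.trW_iff' s).1 hs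
    obtain ⟨a, ha⟩ := Triangle.coyoneda_exact₂ _ (G.map_distinguished _ hT) g h0
    exact ⟨L, hL, a, u, ha.symm⟩

variable {G P} in
lemma exists_left_fac_iff {N : T'} {J : T} (g : G.obj J ⟶ N) :
    (∃ (L : T) (_ : P L) (u : J ⟶ L) (a : G.obj L ⟶ N), G.map u ≫ a = g) ↔
      ∃ (J' : T) (s : J' ⟶ J), P.trW s ∧ G.map s ≫ g = 0 := by
  constructor
  · rintro ⟨L, hL, u, a, rfl⟩
    obtain ⟨J', s, w, hT⟩ := distinguished_cocone_triangle₁ u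
    have h0 : s ≫ u = 0 := comp_distTriang_mor_zero₁₂ _ hT
    exact ⟨J', s, ⟨L, u, w, hT, hL⟩, by
      rw [← Category.assoc, ← G.map_comp, h0, G.map_zero, zero_comp]⟩
  · rintro ⟨J', s, ⟨L, u, w, hT, hL⟩, h0⟩
    obtain ⟨a, ha⟩ := Triangle.yoneda_exact₂ _ (G.map_distinguished _ hT) g h0
    exact ⟨L, hL, u, a, ha.symm⟩

instance : (rightFactoring G P).IsClosedUnderIsomorphisms where
  of_iso e hX J g := by
    obtain ⟨L, hL, a, u, h⟩ := hX J (e.hom ≫ g)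
    exact ⟨L, hL, e.inv ≫ a, u, by rw [Category.assoc, h, e.inv_hom_id_assoc]⟩

instance : (leftFactoring G P).IsClosedUnderIsomorphisms where
  of_iso e hX J g := by
    obtain ⟨L, hL, u, a, h⟩ := hX J (g ≫ e.inv)
    exact ⟨L, hL, u, a ≫ e.hom, by rw [reassoc_of% h, e.inv_hom_id, Category.comp_id]⟩

instance : (rightFactoring G P).IsTriangulated where
  exists_zero := ⟨_, isZero_zero T', fun J g =>
    have ⟨Z, _, hZ⟩ := P.exists_prop_of_containsZero
    ⟨Z, hZ, 0, 0, (isZero_zero T').eq_of_src _ _⟩⟩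
  isStableUnderShiftBy n := ⟨fun N hN J g => by
    -- Morphisms from a shift of `N` by `n` to `J` are shifts of morphisms from `N` to `J⟦-n⟧`.
    let α : (G.obj (J⟦-n⟧))⟦n⟧ ≅ G.obj J :=
      (G.commShiftIso n).symm.app (J⟦-n⟧) ≪≫ G.mapIso (shiftNegShift J n)
    obtain ⟨h, hh⟩ := (shiftFunctor T' n).map_surjective (g ≫ α.inv)
    obtain ⟨L, hL, a, u, rfl⟩ := hN _ h
    refine ⟨L⟦n⟧, P.le_shift n _ hL, a⟦n⟧' ≫ (G.commShiftIso n).inv.app L,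
      u⟦n⟧' ≫ (shiftNegShift J n).hom, ?_⟩
    rw [← cancel_mono α.inv, ← hh, Functor.map_comp, Functor.map_comp, Iso.trans_inv,
      Iso.app_inv, Iso.symm_inv, Functor.mapIso_inv, Category.assoc, Category.assoc,
      Category.assoc, ← G.map_comp_assoc (Iso.hom _),
      Iso.hom_inv_id, G.map_id, Category.id_comp]
    simp⟩
  toIsTriangulatedClosed₂ := .mk' fun D hD h₁ h₃ J g => by
    -- Once `s₁` kills `g` on the first vertex, the composite comes from the third vertex, where a
    -- second map `s₂` kills it.
    obtain ⟨J₁, s₁, hs₁, e₁⟩ := (exists_right_fac_iff _).1 (h₁ J (D.mor₁ ≫ g))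
    obtain ⟨k, hk⟩ := Triangle.yoneda_exact₂ _ hD (g ≫ G.map s₁) (by simpa using e₁)
    obtain ⟨J₂, s₂, hs₂, e₂⟩ := (exists_right_fac_iff _).1 (h₃ J₁ k)
    refine (exists_right_fac_iff _).2 ⟨J₂, s₁ ≫ s₂, P.trW.comp_mem _ _ hs₁ hs₂, ?_⟩
    rw [G.map_comp, reassoc_of% hk, e₂, comp_zero]

instance : (leftFactoring G P).IsTriangulated where
  exists_zero := ⟨_, isZero_zero T', fun J g =>
    have ⟨Z, _, hZ⟩ := P.exists_prop_of_containsZero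
    ⟨Z, hZ, 0, 0, (isZero_zero T').eq_of_tgt _ _⟩⟩
  isStableUnderShiftBy n := ⟨fun N hN J g => by
    let α : (G.obj (J⟦-n⟧))⟦n⟧ ≅ G.obj J :=
      (G.commShiftIso n).symm.app (J⟦-n⟧) ≪≫ G.mapIso (shiftNegShift J n)
    obtain ⟨h, hh⟩ := (shiftFunctor T' n).map_surjective (α.hom ≫ g)
    obtain ⟨L, hL, u, a, rfl⟩ := hN _ h
    refine ⟨L⟦n⟧, P.le_shift n _ hL, (shiftNegShift J n).inv ≫ u⟦n⟧',
      (G.commShiftIso n).hom.app L ≫ a⟦n⟧', ?_⟩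
    rw [← cancel_epi α.hom, ← hh, Functor.map_comp, Functor.map_comp, Iso.trans_hom,
      Iso.app_hom, Iso.symm_hom, Functor.mapIso_hom, Category.assoc, Category.assoc,
      ← G.map_comp_assoc, Iso.hom_inv_id, G.map_id, Category.id_comp]
    simp⟩
  toIsTriangulatedClosed₂ := .mk' fun D hD h₁ h₃ J g => by
    obtain ⟨J₁, s₁, hs₁, e₁⟩ := (exists_left_fac_iff _).1 (h₃ J (g ≫ D.mor₂))
    obtain ⟨k, hk⟩ := Triangle.coyoneda_exact₂ _ hD (G.map s₁ ≫ g) (by simpa using e₁)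
    obtain ⟨J₂, s₂, hs₂, e₂⟩ := (exists_left_fac_iff _).1 (h₁ J₁ k)
    refine (exists_left_fac_iff _).2 ⟨J₂, s₂ ≫ s₁, P.trW.comp_mem _ _ hs₂ hs₁, ?_⟩
    rw [G.map_comp, Category.assoc, hk, reassoc_of% e₂, zero_comp]

variable {G P} [G.Full] [G.Faithful] [P.IsStableUnderRetracts]

/-- Factoring the identity of `G.obj X` exhibits `X` as a retract of an object of `P`. -/
lemma prop_of_rightFactoring {X : T} (h : rightFactoring G P (G.obj X)) : P X := by
  obtain ⟨L, hL, a, u, hau⟩ := h X (𝟙 _)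
  exact P.prop_of_retract ⟨G.preimage a, u, G.map_injective (by simpa using hau)⟩ hL

lemma prop_of_leftFactoring {X : T} (h : leftFactoring G P (G.obj X)) : P X := by
  obtain ⟨L, hL, u, a, hau⟩ := h X (𝟙 _)
  exact P.prop_of_retract ⟨u, G.preimage a, G.map_injective (by simpa using hau)⟩ hL

end Factorization

/-! ### Factoring classes in homotopy categories under infinite sums and products. -/

section Factorization

variable {E : Type u} [Category.{v} E] [Preadditive E] [HasZeroObject E] [HasBinaryBiproducts E]
  {E' : Type u₂} [Category.{v} E'] [Preadditive E'] [HasZeroObject E'] [HasBinaryBiproducts E']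
  (G : E ⥤ E') [G.Additive] (P : ObjectProperty (Hot E)) [P.IsTriangulated]

/-- The sum of the objects through which the summands factor serves for the whole; `G` need not
preserve it, because maps into its image are built from the images of the injections. -/
lemma closedUnderSums_rightFactoring [HasCoproducts.{v} E] [HasCoproducts.{v} E']
    [P.IsClosedUnderIsomorphisms] (hP : ClosedUnderSums P) :
    ClosedUnderSums (rightFactoring (G.mapHomotopyCategory (ComplexShape.up ℤ)) P) := by
  intro J K c hc hK M g
  choose L hL a u hau using fun j =>
    hK j M ((HomotopyCategory.quotient E' _).map (c.inj j) ≫ g)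
  choose L' hL' using fun j => HomotopyCategory.quotient_obj_surjective (L j)
  obtain rfl : (fun j => toHot (L' j)) = L := funext hL'
  let c' : Cofan L' := colimit.cocone (Discrete.functor L')
  have hc' : IsColimit c' := colimit.isColimit _
  obtain ⟨u', hu'⟩ := exists_hot_desc hc' u
  obtain ⟨a', ha'⟩ := exists_hot_desc hc fun j => a j ≫
    (G.mapHomotopyCategory _).map ((HomotopyCategory.quotient E _).map (c'.inj j))
  refine ⟨toHot c'.pt, hP J _ c' hc' hL, a', u', hot_hom_ext_of_isColimit hc fun j => ?_⟩
  rw [← Category.assoc, ha', Category.assoc, ← Functor.map_comp, hu', hau]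

lemma closedUnderProds_leftFactoring [HasProducts.{v} E] [HasProducts.{v} E']
    [P.IsClosedUnderIsomorphisms] (hP : ClosedUnderProds P) :
    ClosedUnderProds (leftFactoring (G.mapHomotopyCategory (ComplexShape.up ℤ)) P) := by
  intro J K c hc hK M g
  choose L hL u a hau using fun j =>
    hK j M (g ≫ (HomotopyCategory.quotient E' _).map (c.proj j))
  choose L' hL' using fun j => HomotopyCategory.quotient_obj_surjective (L j)
  obtain rfl : (fun j => toHot (L' j)) = L := funext hL'
  let c' : Fan L' := limit.cone (Discrete.functor L')
  have hc' : IsLimit c' := limit.isLimit _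
  obtain ⟨u', hu'⟩ := exists_hot_lift hc' u
  obtain ⟨a', ha'⟩ := exists_hot_lift hc fun j =>
    (G.mapHomotopyCategory _).map ((HomotopyCategory.quotient E _).map (c'.proj j)) ≫ a j
  refine ⟨toHot c'.pt, hP J _ c' hc' hL, u', a', hot_hom_ext_of_isLimit hc fun j => ?_⟩
  rw [Category.assoc, ha', ← Category.assoc, ← Functor.map_comp, hu', hau]

end Factorization

/-! ### Embeddings into complexes with given terms -/

section Disk

open CochainComplex HomComplex

variable {C : Type u₁} [Category.{v₁} C] [Preadditive C] [HasZeroObject C] [HasBinaryBiproducts C]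

lemma isInjective_split : ClosedUnderSplit (isInjective C) :=
  fun X Y Z i₁ p₁ i₂ p₂ h hX hY => ⟨fun g f _ => by
    have : Injective X := hX
    have : Injective Y := hY
    refine ⟨Injective.factorThru (g ≫ p₁) f ≫ i₁ + Injective.factorThru (g ≫ p₂) f ≫ i₂, ?_⟩
    rw [Preadditive.comp_add, Injective.comp_factorThru_assoc, Injective.comp_factorThru_assoc,
      Category.assoc, Category.assoc, ← Preadditive.comp_add, h, Category.comp_id]⟩

lemma isProjective_split : ClosedUnderSplit (isProjective C) :=
  fun X Y Z i₁ p₁ i₂ p₂ h hX hY => ⟨fun g f _ => by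
    have : Projective X := hX
    have : Projective Y := hY
    refine ⟨p₁ ≫ Projective.factorThru (i₁ ≫ g) f + p₂ ≫ Projective.factorThru (i₂ ≫ g) f, ?_⟩
    rw [Preadditive.add_comp, Category.assoc, Category.assoc, Projective.factorThru_comp,
      Projective.factorThru_comp, ← Category.assoc, ← Category.assoc, ← Preadditive.add_comp, h,
      Category.id_comp]⟩

/-- The complex with the given terms and with zero differential. -/
def zeroDifferential (M : ℤ → C) : CochainComplex C ℤ where
  X := M
  d _ _ := 0

lemma isZero_toHot_mappingCone_id (M : CochainComplex C ℤ) :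
    IsZero (toHot (mappingCone (𝟙 M))) :=
  (Pretriangulated.Triangle.isZero₃_iff_isIso₁ _
    (HomotopyCategory.mappingCone_triangleh_distinguished (𝟙 M))).2
    (inferInstanceAs (IsIso ((HomotopyCategory.quotient C _).map (𝟙 M))))

lemma ClosedUnderSplit.mappingCone {P : ObjectProperty C} (hP : ClosedUnderSplit P)
    {K L : CochainComplex C ℤ} (φ : K ⟶ L)
    (hK : ∀ n, P (K.X n)) (hL : ∀ n, P (L.X n)) (n : ℤ) : P ((mappingCone φ).X n) :=
  hP _ _ _ _ _ _ _ (mappingCone.id_X φ n (n + 1) rfl) (hK (n + 1)) (hL n)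

/-- A family of morphisms from the terms of a complex factors through a morphism to a contractible
complex. -/
lemma exists_contractible_right (K : CochainComplex C ℤ) {I : ℤ → C} (i : ∀ n, K.X n ⟶ I n) :
    ∃ (E : CochainComplex C ℤ) (f : K ⟶ E), IsZero (toHot E) ∧
      (∀ P : ObjectProperty C, ClosedUnderSplit P → (∀ n, P (I n)) → ∀ n, P (E.X n)) ∧
      ∀ n, ∃ r : E.X n ⟶ I n, f.f n ≫ r = i n := by
  -- The cone of an identity imposes no compatibility on the family: its second component is chosen
  -- freely, and minus its coboundary is forced as the first.
  let β : Cochain K (zeroDifferential I) 0 := Cochain.ofHoms i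
  let α : Cocycle K (zeroDifferential I) 1 := .mk (-δ 0 1 β) 2 rfl (by rw [δ_neg, δ_δ, neg_zero])
  refine ⟨mappingCone (𝟙 (zeroDifferential I)), mappingCone.lift _ α β (by simp [α]),
    isZero_toHot_mappingCone_id _, fun P hP hI => hP.mappingCone _ (fun n => hI _) hI, fun n =>
    ⟨(mappingCone.snd (𝟙 (zeroDifferential I))).v n n (add_zero n), ?_⟩⟩
  exact (mappingCone.lift_f_snd_v _ α β _ n n (add_zero n)).trans (Cochain.ofHoms_v _ _)

/-- A family of morphisms to the terms of a complex factors through a morphism from a contractible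
complex. -/
lemma exists_contractible_left (K : CochainComplex C ℤ) {I : ℤ → C} (p : ∀ n, I n ⟶ K.X n) :
    ∃ (E : CochainComplex C ℤ) (f : E ⟶ K), IsZero (toHot E) ∧
      (∀ P : ObjectProperty C, ClosedUnderSplit P → (∀ n, P (I n)) → ∀ n, P (E.X n)) ∧
      ∀ n, ∃ s : I n ⟶ E.X n, s ≫ f.f n = p n := by
  -- The index is displaced so that the first summand of the cone in degree `n`, which is the term
  -- of `M` in degree `n + 1`, is `I n`.
  let M := zeroDifferential fun n => I (n - 1)
  let α : Cochain M K (-1) := Cochain.mk fun m n hmn =>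
    p (m - 1) ≫ (K.XIsoOfEq (by lia)).hom
  let β : Cocycle M K 0 := .mk (δ (-1) 0 α) 1 rfl (δ_δ _ _ _ _)
  refine ⟨mappingCone (𝟙 M), mappingCone.desc _ α (Cocycle.homOf β) (by
    rw [Category.id_comp, Cocycle.cochain_ofHom_homOf_eq_coe]; rfl),
    isZero_toHot_mappingCone_id _, fun P hP hI => hP.mappingCone _ (fun n => hI _) fun n => hI _,
    fun n => ⟨eqToHom (by congr 1; lia) ≫ (mappingCone.inl (𝟙 M)).v (n + 1) n (by lia), ?_⟩⟩
  rw [Category.assoc, mappingCone.inl_v_desc_f]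
  have key : ∀ m (h : m = n), eqToHom (congrArg I h.symm) ≫ p m ≫ (K.XIsoOfEq h).hom = p n := by
    rintro m rfl
    simp
  exact key _ (by lia)

variable {P : ObjectProperty C} (hP : ClosedUnderSplit P)
include hP

lemma ClosedUnderSplit.exists_mono (h : ∀ X : C, ∃ (I : C) (_ : P I) (i : X ⟶ I), Mono i)
    (K : CochainComplex C ℤ) :
    ∃ (I : CochainComplex C ℤ) (i : K ⟶ I), (∀ n, P (I.X n)) ∧ ∀ n, Mono (i.f n) := by
  choose I hI i hi using h
  obtain ⟨E, f, -, hE, hf⟩ := exists_contractible_right K fun n => i (K.X n)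
  refine ⟨E, f, hE P hP fun n => hI _, fun n => ?_⟩
  obtain ⟨r, hr⟩ := hf n
  exact @mono_of_mono _ _ _ _ _ (f.f n) r (hr ▸ hi _)

lemma ClosedUnderSplit.exists_epi (h : ∀ X : C, ∃ (I : C) (_ : P I) (p : I ⟶ X), Epi p)
    (K : CochainComplex C ℤ) :
    ∃ (I : CochainComplex C ℤ) (p : I ⟶ K), (∀ n, P (I.X n)) ∧ ∀ n, Epi (p.f n) := by
  choose I hI p hp using h
  obtain ⟨E, f, -, hE, hf⟩ := exists_contractible_left K fun n => p (K.X n)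
  refine ⟨E, f, hE P hP fun n => hI _, fun n => ?_⟩
  obtain ⟨s, hs⟩ := hf n
  exact @epi_of_epi _ _ _ _ _ s (f.f n) (hs ▸ hp _)

end Disk

/-! ### Coacyclicity in a full subcategory -/

section FullSubcategory

open CochainComplex

lemma comp_inv_comp_hom_comp_eq {T : Type u₁} [Category.{v₁} T] {A B X Y : T} {a : A ⟶ X}
    (e : Y ≅ X) {b : X ⟶ B} {c : A ⟶ B} (h : a ≫ b = c) : (a ≫ e.inv) ≫ e.hom ≫ b = c := by
  rw [Category.assoc, e.inv_hom_id_assoc, h]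

variable {C : Type u} [Category.{v} C] [Abelian C] (P : ObjectProperty C) [P.ContainsZero]
  [P.IsClosedUnderIsomorphisms] [P.IsClosedUnderBinaryProducts]

lemma cokernel_shortExact {K L : CochainComplex C ℤ} (i : K ⟶ L) (hi : ∀ n, Mono (i.f n)) :
    (ShortComplex.mk i (cokernel.π i) (cokernel.condition i)).ShortExact where
  exact := ShortComplex.exact_cokernel i
  mono_f := HomologicalComplex.mono_of_mono_f i hi
  epi_g := inferInstance

lemma kernel_shortExact {K L : CochainComplex C ℤ} (p : K ⟶ L) (hp : ∀ n, Epi (p.f n)) :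
    (ShortComplex.mk (kernel.ι p) p (kernel.condition p)).ShortExact where
  exact := ShortComplex.exact_kernel p
  mono_f := inferInstance
  epi_g := HomologicalComplex.epi_of_epi_f p hp

variable {P} in
/-- A sequence of complexes whose terms are in `P`, as a sequence of complexes over
the full subcategory. -/
def liftSequence {K : CochainComplex P.FullSubcategory ℤ} {L M : CochainComplex C ℤ}
    (f : (P.ι.mapHomologicalComplex _).obj K ⟶ L) (g : L ⟶ M) (w : f ≫ g = 0)
    (hL : ∀ n, P (L.X n)) (hM : ∀ n, P (M.X n)) :
    ShortComplex (CochainComplex P.FullSubcategory ℤ) where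
  X₁ := K
  X₂ := HomologicalComplex.liftObjectProperty P L hL
  X₃ := HomologicalComplex.liftObjectProperty P M hM
  f := { f n := ObjectProperty.homMk (f.f n)
         comm' i j h := by ext; exact f.comm' i j h }
  g := { f n := ObjectProperty.homMk (g.f n)
         comm' i j h := by ext; exact g.comm' i j h }
  zero := by ext n; exact congrArg (fun z => z.f n) w

variable {P} in
/-- A sequence of complexes whose terms are in `P`, as a sequence of complexes over the full
subcategory. -/
def liftSequence' {M : CochainComplex P.FullSubcategory ℤ} {K L : CochainComplex C ℤ}
    (f : K ⟶ L) (g : L ⟶ (P.ι.mapHomologicalComplex _).obj M) (w : f ≫ g = 0)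
    (hK : ∀ n, P (K.X n)) (hL : ∀ n, P (L.X n)) :
    ShortComplex (CochainComplex P.FullSubcategory ℤ) where
  X₁ := HomologicalComplex.liftObjectProperty P K hK
  X₂ := HomologicalComplex.liftObjectProperty P L hL
  X₃ := M
  f := { f n := ObjectProperty.homMk (f.f n)
         comm' i j h := by ext; exact f.comm' i j h }
  g := { f n := ObjectProperty.homMk (g.f n)
         comm' i j h := by ext; exact g.comm' i j h }
  zero := by ext n; exact congrArg (fun z => z.f n) w

variable [HasCoproducts.{v} P.FullSubcategory] [HasCoproducts.{v} C] [EnoughInjectives C] in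
/-- Complexes over `P` that are coacyclic in `C` are coacyclic in `P`, when `P` contains the
injective objects and is closed under coproducts and cokernels of monomorphisms. -/
lemma inverseImage_coacyclic_le (hinj : isInjective C ≤ P)
    (hcok : ∀ S : ShortComplex C, S.ShortExact → P S.X₁ → P S.X₂ → P S.X₃) :
    (coacyclic (abelianConf C)).inverseImage (P.ι.mapHomotopyCategory (ComplexShape.up ℤ)) ≤
      coacyclic (inducedConf P) := by
  have := (closedUnderSums_coacyclic (inducedConf P)).isStableUnderRetracts
  refine fun X hX => prop_of_rightFactoring (G := P.ι.mapHomotopyCategory (ComplexShape.up ℤ))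
    (hX _ inferInstance inferInstance (fun S hS J g => ?_)
      (closedUnderSums_rightFactoring _ _ (closedUnderSums_coacyclic (inducedConf P))))
  obtain ⟨J, rfl⟩ := HomotopyCategory.quotient_obj_surjective J
  obtain ⟨g, rfl⟩ := (HomotopyCategory.quotient C _).map_surjective g
  obtain ⟨I, i, hI, hi⟩ := isInjective_split.exists_mono
    (fun X => ⟨Injective.under X, (inferInstance : Injective _), Injective.ι X, inferInstance⟩)
    ((P.ι.mapHomologicalComplex _).obj J)
  have hex := HomologicalComplex.shortExact_iff_degreewise_shortExact _ |>.1
    (cokernel_shortExact i hi)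
  -- Closure under cokernels makes the sequence `J ⟶ I ⟶ J'` an exact sequence inside `P`, so its
  -- total complex is coacyclic there.
  have hM n : P ((cokernel i).X n) := hcok _ (hex n) (J.X n).property (hinj _ (hI n))
  let S' := liftSequence i (cokernel.π i) (cokernel.condition i) (fun n => hinj _ (hI n)) hM
  obtain ⟨a, b, hab⟩ := exists_fac_tot_of_injective
    (S' := S'.map (P.ι.mapHomologicalComplex _)) hS hI g
  -- Identifies the shifted total complex formed in `C` with the image of the one formed over `P`,
  -- so that the factorization can be carried back along the full embedding.
  let e := ((HomotopyCategory.quotient C (.up ℤ)).commShiftIso (-2 : ℤ)).app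
    (tot (S'.map (P.ι.mapHomologicalComplex _))) ≪≫ (CategoryTheory.shiftFunctor (Hot C) (-2 : ℤ)).mapIso
    (nonempty_mapHomotopyCategory_tot_iso P.ι S').some.symm ≪≫
    ((P.ι.mapHomotopyCategory (ComplexShape.up ℤ)).commShiftIso (-2 : ℤ)).symm.app _
  refine ⟨(toHot (tot S'))⟦(-2 : ℤ)⟧, ObjectProperty.le_shift _ _ _
    (containsTot_coacyclic _ S' hex),
    (HomotopyCategory.quotient C _).map a ≫ e.hom,
    (P.ι.mapHomotopyCategory (ComplexShape.up ℤ)).preimage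
      (e.inv ≫ (HomotopyCategory.quotient C _).map b), ?_⟩
  rw [Functor.map_preimage]
  exact comp_inv_comp_hom_comp_eq e.symm
    ((Functor.map_comp _ _ _).symm.trans (congrArg (HomotopyCategory.quotient C _).map hab))

variable [HasProducts.{v} P.FullSubcategory] [HasProducts.{v} C] [EnoughProjectives C] in
/-- Complexes over `P` that are contraacyclic in `C` are contraacyclic in `P`, when `P` contains
the projective objects and is closed under products and kernels of epimorphisms. -/
lemma inverseImage_contraacyclic_le (hproj : isProjective C ≤ P)
    (hker : ∀ S : ShortComplex C, S.ShortExact → P S.X₂ → P S.X₃ → P S.X₁) :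
    (contraacyclic (abelianConf C)).inverseImage (P.ι.mapHomotopyCategory (ComplexShape.up ℤ)) ≤
      contraacyclic (inducedConf P) := by
  have := (closedUnderProds_contraacyclic (inducedConf P)).isStableUnderRetracts
  refine fun X hX => prop_of_leftFactoring (G := P.ι.mapHomotopyCategory (ComplexShape.up ℤ))
    (hX _ inferInstance inferInstance (fun S hS J g => ?_)
      (closedUnderProds_leftFactoring _ _ (closedUnderProds_contraacyclic (inducedConf P))))
  obtain ⟨J, rfl⟩ := HomotopyCategory.quotient_obj_surjective J
  obtain ⟨g, rfl⟩ := (HomotopyCategory.quotient C _).map_surjective g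
  obtain ⟨I, p, hI, hp⟩ := isProjective_split.exists_epi
    (fun X => ⟨Projective.over X, (inferInstance : Projective _), Projective.π X, inferInstance⟩)
    ((P.ι.mapHomologicalComplex _).obj J)
  have hex := HomologicalComplex.shortExact_iff_degreewise_shortExact _ |>.1
    (kernel_shortExact p hp)
  have hM n : P ((kernel p).X n) := hker _ (hex n) (hproj _ (hI n)) (J.X n).property
  let S' := liftSequence' (kernel.ι p) p (kernel.condition p) hM (fun n => hproj _ (hI n))
  obtain ⟨a, b, hab⟩ := exists_fac_tot_of_projective
    (S' := S'.map (P.ι.mapHomologicalComplex _)) hS hI g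
  let e := (nonempty_mapHomotopyCategory_tot_iso P.ι S').some
  refine ⟨toHot (tot S'), containsTot_contraacyclic _ S' hex,
    (P.ι.mapHomotopyCategory (ComplexShape.up ℤ)).preimage
      ((HomotopyCategory.quotient C _).map a ≫ e.inv),
    e.hom ≫ (HomotopyCategory.quotient C _).map b, ?_⟩
  rw [Functor.map_preimage]
  exact comp_inv_comp_hom_comp_eq e
    ((Functor.map_comp _ _ _).symm.trans (congrArg (HomotopyCategory.quotient C _).map hab))

end FullSubcategory

/-! ### One step of a resolution -/

section Step

open CochainComplex Pretriangulated

section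

variable {E : Type u} [Category.{v} E] [Preadditive E] [HasZeroObject E] [HasBinaryBiproducts E]
  {P : ObjectProperty (Hot E)} [P.IsTriangulated] [P.IsClosedUnderIsomorphisms]
  {conf : ObjectProperty (ShortComplex E)} (hP : ContainsTot conf P)
  {S : ShortComplex (CochainComplex E ℤ)}
  (hS : ∀ n : ℤ, conf (S.map (HomologicalComplex.eval E _ n)))

include hP hS

lemma ContainsTot.trW_totMap : P.trW ((HomotopyCategory.quotient E _).map
    (mappingCone.desc S.f 0 S.g (by simp))) :=
  (prop_mappingCone_iff P _).1 (hP S hS)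

/-- Since `P` contains the cone of `cone (S.f) ⟶ S.X₃`, the objects `cone (S.f)` and `S.X₃` lie in
`P` simultaneously. -/
lemma ContainsTot.prop_X₃_iff : P.trW ((HomotopyCategory.quotient E _).map S.f) ↔
    P (toHot S.X₃) := by
  have hT := HomotopyCategory.mappingCone_triangleh_distinguished
    (mappingCone.desc S.f 0 S.g (by simp))
  rw [← prop_mappingCone_iff]
  exact ⟨fun h => P.ext_of_isTriangulatedClosed₂ _ hT h (hP S hS),
    fun h => P.ext_of_isTriangulatedClosed₁ _ hT h (hP S hS)⟩

lemma ContainsTot.trW_g (h : P (toHot S.X₁)) :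
    P.trW ((HomotopyCategory.quotient E _).map S.g) := by
  have h₁ : P.trW ((HomotopyCategory.quotient E _).map (mappingCone.inr S.f)) :=
    ObjectProperty.trW.mk' P (HomotopyCategory.mappingCone_triangleh_distinguished S.f) h
  have h₂ := P.trW.comp_mem _ _ h₁ (hP.trW_totMap hS)
  rwa [← Functor.map_comp, mappingCone.inr_desc] at h₂

end

variable {C : Type u} [Category.{v} C] [Abelian C] {P : ObjectProperty (Hot C)} [P.IsTriangulated]
  [P.IsClosedUnderIsomorphisms] (hP : ContainsTot (abelianConf C) P)
include hP

/-- Embed `X` in a complex `I` of injectives and pull `I ⟶ I/X` back along a termwise split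
epimorphism `E ⟶ I/X` from a contractible complex. The pullback contains `X` with quotient `E`,
while in each degree the embedding still passes through `I`. -/
lemma exists_trW_injective_fac [EnoughInjectives C] (X : CochainComplex C ℤ) :
    ∃ (X' : CochainComplex C ℤ) (f : X ⟶ X'), P.trW ((HomotopyCategory.quotient C _).map f) ∧
      ∀ n, ∃ (I : C) (_ : Injective I) (a : X.X n ⟶ I) (b : I ⟶ X'.X n),
        Mono a ∧ Mono b ∧ a ≫ b = f.f n := by
  obtain ⟨I, i, hI, hi⟩ := isInjective_split.exists_mono
    (fun X => ⟨Injective.under X, (inferInstance : Injective _), Injective.ι X, inferInstance⟩) X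
  obtain ⟨E, p, hE, -, hp⟩ := exists_contractible_left (cokernel i) fun n => 𝟙 _
  have hS := cokernel_shortExact i hi
  have hep : ∀ n, Epi (p.f n) := fun n => by
    obtain ⟨s, hs⟩ := hp n
    exact epi_of_epi_fac hs
  have := HomologicalComplex.epi_of_epi_f p hep
  let f : X ⟶ pullback (cokernel.π i) p := pullback.lift i 0 (by simp)
  have hf : f ≫ pullback.fst _ _ = i := pullback.lift_fst _ _ _
  have hex : (ShortComplex.mk f (pullback.snd (cokernel.π i) p)
      (pullback.lift_snd _ _ _)).ShortExact := by
    have : Mono i := hS.mono_f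
    have : Mono f := mono_of_mono_fac hf
    have hw {W : CochainComplex C ℤ} (k : W ⟶ pullback (cokernel.π i) p)
        (hk : k ≫ pullback.snd _ _ = 0) : (k ≫ pullback.fst _ _) ≫ cokernel.π i = 0 := by
      rw [Category.assoc, pullback.condition, reassoc_of% hk, zero_comp]
    have hl : IsLimit (KernelFork.ofι f (pullback.lift_snd i (0 : X ⟶ E) (by simp))) :=
      KernelFork.IsLimit.ofι' _ _ fun {W} k hk => ⟨hS.fIsKernel.lift (KernelFork.ofι _ (hw k hk)), by
        have := hS.fIsKernel.fac (KernelFork.ofι _ (hw k hk)) .zero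
        apply pullback.hom_ext
        · rw [Category.assoc, hf]
          exact this
        · rw [Category.assoc, pullback.lift_snd, comp_zero, hk]⟩
    exact ⟨ShortComplex.exact_of_f_is_kernel _ hl⟩
  refine ⟨_, f, (hP.prop_X₃_iff ((HomologicalComplex.shortExact_iff_degreewise_shortExact _).1
    hex)).2 (P.prop_of_isZero hE), fun n => ?_⟩
  obtain ⟨s, hs⟩ := hp n
  have hpb : IsPullback ((pullback.fst (cokernel.π i) p).f n) ((pullback.snd (cokernel.π i) p).f n)
      ((cokernel.π i).f n) (p.f n) :=
    (IsPullback.of_hasPullback (cokernel.π i) p).map (HomologicalComplex.eval C _ n)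
  -- The degreewise section `s` of `p` embeds the term of `I` into the pullback; this need not
  -- respect differentials.
  let b : I.X n ⟶ (pullback (cokernel.π i) p).X n :=
    hpb.lift (𝟙 _) ((cokernel.π i).f n ≫ s) (by rw [Category.assoc, hs, Category.id_comp, Category.comp_id])
  have hb : b ≫ (pullback.fst (cokernel.π i) p).f n = 𝟙 _ := hpb.lift_fst _ _ _
  refine ⟨I.X n, hI n, i.f n, b, hi n, mono_of_mono_fac hb,
    hpb.hom_ext ?_ ?_⟩
  · have h₀ : f.f n ≫ (pullback.fst (cokernel.π i) p).f n = i.f n := congrArg (fun z => z.f n) hf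
    rw [h₀, Category.assoc, hb, Category.comp_id]
  · have h₁ : b ≫ (pullback.snd (cokernel.π i) p).f n = (cokernel.π i).f n ≫ s :=
      hpb.lift_snd _ _ _
    have h₂ : f.f n ≫ (pullback.snd (cokernel.π i) p).f n = 0 :=
      congrArg (fun z => z.f n) (pullback.lift_snd i (0 : X ⟶ E) (by simp))
    have h₃ : i.f n ≫ (cokernel.π i).f n = 0 := congrArg (fun z => z.f n) (cokernel.condition i)
    rw [h₂, Category.assoc, h₁, reassoc_of% h₃, zero_comp]

/-- Dually, push a cover `Q ⟶ X` by projectives out along a termwise split embedding of its kernel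
in a contractible complex. The epimorphisms of complexes are recorded because the limit of the
resulting tower needs them. -/
lemma exists_trW_projective_fac [EnoughProjectives C] (X : CochainComplex C ℤ) :
    ∃ (X' : CochainComplex C ℤ) (f : X' ⟶ X), P.trW ((HomotopyCategory.quotient C _).map f) ∧
      (∀ n, Epi (f.f n)) ∧
      ∀ n, ∃ (Q : C) (_ : Projective Q) (a : X'.X n ⟶ Q) (b : Q ⟶ X.X n),
        Epi a ∧ Epi b ∧ a ≫ b = f.f n := by
  obtain ⟨Q, q, hQ, hq⟩ := isProjective_split.exists_epi
    (fun X => ⟨Projective.over X, (inferInstance : Projective _), Projective.π X, inferInstance⟩) X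
  obtain ⟨E, j, hE, -, hj⟩ := exists_contractible_right (kernel q) fun n => 𝟙 _
  have hS := kernel_shortExact q hq
  have hmj : ∀ n, Mono (j.f n) := fun n => by
    obtain ⟨r, hr⟩ := hj n
    exact mono_of_mono_fac hr
  have := HomologicalComplex.mono_of_mono_f j hmj
  let f : pushout (kernel.ι q) j ⟶ X := pushout.desc q 0 (by simp)
  have hf : pushout.inl _ _ ≫ f = q := pushout.inl_desc _ _ _
  have hex : (ShortComplex.mk (pushout.inr (kernel.ι q) j) f
      (pushout.inr_desc _ _ _)).ShortExact := by
    have : Epi q := hS.epi_g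
    have : Epi f := epi_of_epi_fac hf
    have hw {W : CochainComplex C ℤ} (k : pushout (kernel.ι q) j ⟶ W)
        (hk : pushout.inr _ _ ≫ k = 0) : kernel.ι q ≫ pushout.inl _ _ ≫ k = 0 := by
      rw [pushout.condition_assoc, hk, comp_zero]
    have hl : IsColimit (CokernelCofork.ofπ f (pushout.inr_desc q (0 : E ⟶ X) (by simp))) :=
      CokernelCofork.IsColimit.ofπ' _ _ fun {W} k hk =>
        ⟨hS.gIsCokernel.desc (CokernelCofork.ofπ _ (hw k hk)), by
        have := hS.gIsCokernel.fac (CokernelCofork.ofπ _ (hw k hk)) .one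
        apply pushout.hom_ext
        · rw [reassoc_of% hf]
          exact this
        · rw [← Category.assoc, pushout.inr_desc, zero_comp, hk]⟩
    exact ⟨ShortComplex.exact_of_g_is_cokernel _ hl⟩
  have hex' := (HomologicalComplex.shortExact_iff_degreewise_shortExact _).1 hex
  refine ⟨_, f, hP.trW_g hex' (P.prop_of_isZero hE), fun n => (hex' n).epi_g, fun n => ?_⟩
  obtain ⟨r, hr⟩ := hj n
  have hpo : IsPushout ((kernel.ι q).f n) (j.f n) ((pushout.inl (kernel.ι q) j).f n)
      ((pushout.inr (kernel.ι q) j).f n) :=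
    (IsPushout.of_hasPushout (kernel.ι q) j).map (HomologicalComplex.eval C _ n)
  let a : (pushout (kernel.ι q) j).X n ⟶ Q.X n :=
    hpo.desc (𝟙 _) (r ≫ (kernel.ι q).f n) (by rw [reassoc_of% hr, Category.comp_id])
  have ha : (pushout.inl (kernel.ι q) j).f n ≫ a = 𝟙 _ := hpo.inl_desc _ _ _
  refine ⟨Q.X n, hQ n, a, q.f n, epi_of_epi_fac ha, hq n,
    hpo.hom_ext ?_ ?_⟩
  · have h₀ : (pushout.inl (kernel.ι q) j).f n ≫ f.f n = q.f n := congrArg (fun z => z.f n) hf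
    rw [h₀, reassoc_of% ha]
  · have h₁ : (pushout.inr (kernel.ι q) j).f n ≫ a = r ≫ (kernel.ι q).f n :=
      hpo.inr_desc _ _ _
    have h₂ : (pushout.inr (kernel.ι q) j).f n ≫ f.f n = 0 :=
      congrArg (fun z => z.f n) (pushout.inr_desc q (0 : E ⟶ X) (by simp))
    have h₃ : (kernel.ι q).f n ≫ q.f n = 0 := congrArg (fun z => z.f n) (kernel.condition q)
    rw [h₂, reassoc_of% h₁, h₃, comp_zero]

end Step

/-! ### Colimits and limits of sequences -/

section Sequences

variable {C : Type u₁} [Category.{v₁} C]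

/-- The universal property of the colimit of a sequence of morphisms. -/
structure IsSeqColimit {X : ℕ → C} (φ : ∀ n, X n ⟶ X (n + 1)) {Z : C} (z : ∀ n, X n ⟶ Z) :
    Prop where
  w (n : ℕ) : φ n ≫ z (n + 1) = z n
  exists_desc {W : C} (k : ∀ n, X n ⟶ W) (hk : ∀ n, φ n ≫ k (n + 1) = k n) :
    ∃ d : Z ⟶ W, ∀ n, z n ≫ d = k n
  hom_ext {W : C} {d d' : Z ⟶ W} (h : ∀ n, z n ≫ d = z n ≫ d') : d = d'

/-- The universal property of the limit of a sequence of morphisms. -/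
structure IsSeqLimit {X : ℕ → C} (φ : ∀ n, X (n + 1) ⟶ X n) {Z : C} (z : ∀ n, Z ⟶ X n) :
    Prop where
  w (n : ℕ) : z (n + 1) ≫ φ n = z n
  exists_lift {W : C} (k : ∀ n, W ⟶ X n) (hk : ∀ n, k (n + 1) ≫ φ n = k n) :
    ∃ d : W ⟶ Z, ∀ n, d ≫ z n = k n
  hom_ext {W : C} {d d' : W ⟶ Z} (h : ∀ n, d ≫ z n = d' ≫ z n) : d = d'

lemma isSeqColimit_of_isColimit {F : ℕ ⥤ C} {c : Cocone F} (hc : IsColimit c) :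
    IsSeqColimit (fun n => F.map (homOfLE n.le_succ)) c.ι.app where
  w _ := c.w _
  exists_desc {W} k hk := ⟨hc.desc ⟨W, NatTrans.ofSequence k fun n =>
    (hk n).trans (Category.comp_id _).symm⟩, fun n => hc.fac _ n⟩
  hom_ext h := hc.hom_ext h

lemma isSeqLimit_of_isLimit {F : ℕᵒᵖ ⥤ C} {c : Cone F} (hc : IsLimit c) :
    IsSeqLimit (fun n => F.map (homOfLE n.le_succ).op) fun n => c.π.app ⟨n⟩ where
  w _ := c.w _
  exists_lift {W} k hk := ⟨hc.lift ⟨W, NatTrans.ofOpSequence k fun n =>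
    (Category.id_comp _).trans (hk n).symm⟩, fun n => hc.fac _ ⟨n⟩⟩
  hom_ext h := hc.hom_ext fun ⟨n⟩ => h n

section

variable {D : Type u₂} [Category.{v₂} D]

/-- The second clause is used for evaluation in each degree of a complex. -/
lemma exists_isSeqColimit [HasColimitsOfShape ℕ C] {X : ℕ → C} (φ : ∀ n, X n ⟶ X (n + 1)) :
    ∃ (Z : C) (z : ∀ n, X n ⟶ Z), IsSeqColimit φ z ∧ ∀ {D : Type u₂} [Category.{v₂} D]
      (G : C ⥤ D) [PreservesColimitsOfShape ℕ G],
      IsSeqColimit (fun n => G.map (φ n)) fun n => G.map (z n) := by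
  let F := Functor.ofSequence φ
  have e : (fun n => F.map (homOfLE n.le_succ)) = φ :=
    funext fun n => Functor.ofSequence_map_homOfLE_succ φ n
  refine ⟨colimit F, colimit.ι F, ?_, fun {D} _ G _ => ?_⟩
  · have := isSeqColimit_of_isColimit (colimit.isColimit F)
    rwa [e] at this
  · have := isSeqColimit_of_isColimit (isColimitOfPreserves G (colimit.isColimit F))
    simpa only [← e] using! this

lemma exists_isSeqLimit [HasLimitsOfShape ℕᵒᵖ C] {X : ℕ → C} (φ : ∀ n, X (n + 1) ⟶ X n) :
    ∃ (Z : C) (z : ∀ n, Z ⟶ X n), IsSeqLimit φ z ∧ ∀ {D : Type u₂} [Category.{v₂} D]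
      (G : C ⥤ D) [PreservesLimitsOfShape ℕᵒᵖ G],
      IsSeqLimit (fun n => G.map (φ n)) fun n => G.map (z n) := by
  let F := Functor.ofOpSequence φ
  have e : (fun n => F.map (homOfLE n.le_succ).op) = φ :=
    funext fun n => Functor.ofOpSequence_map_homOfLE_succ φ n
  refine ⟨limit F, fun n => limit.π F ⟨n⟩, ?_, fun {D} _ G _ => ?_⟩
  · have := isSeqLimit_of_isLimit (limit.isLimit F)
    rwa [e] at this
  · have := isSeqLimit_of_isLimit (isLimitOfPreserves G (limit.isLimit F))
    simpa only [← e] using! this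

end

variable [Preadditive C]

/-- If the maps of a sequence factor through injective objects by monomorphisms, then its colimit
is a retract of the coproduct of these objects. -/
lemma IsSeqColimit.nonempty_retract {X : ℕ → C} {φ : ∀ n, X n ⟶ X (n + 1)} {Z : C}
    {z : ∀ n, X n ⟶ Z} (hz : IsSeqColimit φ z) {I : ℕ → C} (hI : ∀ n, Injective (I n))
    (a : ∀ n, X n ⟶ I n) (b : ∀ n, I n ⟶ X (n + 1)) (ha : ∀ n, Mono (a n)) (hb : ∀ n, Mono (b n))
    (hab : ∀ n, a n ≫ b n = φ n) {c : Cofan fun j : ULift.{u} ℕ => I j.down} (hc : IsColimit c) :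
    Nonempty (Retract Z c.pt) := by
  have hm n : Mono (b n ≫ a (n + 1)) := mono_comp _ _
  -- The composites `I n ⟶ X (n + 1) ⟶ I (n + 1)` have the same colimit as the `X n`, and
  -- injectivity splits them by `ρ n`.
  let ρ n : I (n + 1) ⟶ I n := Injective.factorThru (𝟙 _) (b n ≫ a (n + 1))
  have hρ n : b n ≫ a (n + 1) ≫ ρ n = 𝟙 _ := by
    rw [← Category.assoc]
    exact Injective.comp_factorThru _ _
  let q : c.pt ⟶ Z := Cofan.IsColimit.desc hc fun j => b j.down ≫ z (j.down + 1)
  have hq n : c.inj ⟨n⟩ ≫ q = b n ≫ z (n + 1) := Cofan.IsColimit.fac hc _ ⟨n⟩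
  -- Splitting `I (n + 1)` as `I n` plus a complement, `w` keeps its earlier value on `I n` and uses
  -- the new injection on the complement. It is therefore compatible with the sequence, and it lifts
  -- the canonical maps to the colimit through `q`.
  let w : ∀ n, I n ⟶ c.pt := fun n => Nat.rec (motive := fun n => I n ⟶ c.pt) (c.inj ⟨0⟩)
    (fun n w => ρ n ≫ w + (𝟙 _ - ρ n ≫ b n ≫ a (n + 1)) ≫ c.inj ⟨n + 1⟩) n
  have hw n : w (n + 1) = ρ n ≫ w n + (𝟙 _ - ρ n ≫ b n ≫ a (n + 1)) ≫ c.inj ⟨n + 1⟩ := rfl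
  have hwq n : w n ≫ q = b n ≫ z (n + 1) := by
    induction n with
    | zero => exact hq 0
    | succ n ih =>
      rw [hw, Preadditive.add_comp, Category.assoc, ih, Category.assoc, hq, Preadditive.sub_comp,
        Category.assoc, Category.assoc, reassoc_of% hab (n + 1), hz.w, Category.id_comp,
        add_sub_cancel]
  obtain ⟨d, hd⟩ := hz.exists_desc (fun n => a n ≫ w n) fun n => by
    rw [← hab, hw, Preadditive.comp_add, Preadditive.comp_add, Category.assoc,
      reassoc_of% hρ, ← Category.assoc (a (n + 1)), Preadditive.comp_sub, Category.comp_id,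
      Preadditive.sub_comp, Preadditive.comp_sub, Category.assoc, Category.assoc, Category.assoc,
      Category.assoc, Category.assoc, reassoc_of% hρ, sub_self, add_zero]
  exact ⟨⟨d, q, hz.hom_ext fun n => by
    rw [reassoc_of% hd, hwq, reassoc_of% hab, hz.w, Category.comp_id]⟩⟩

/-- If the maps of a sequence factor through projective objects by epimorphisms, then its limit
is a retract of the product of these objects. -/
lemma IsSeqLimit.nonempty_retract {X : ℕ → C} {φ : ∀ n, X (n + 1) ⟶ X n} {Z : C}
    {z : ∀ n, Z ⟶ X n} (hz : IsSeqLimit φ z) {Q : ℕ → C} (hQ : ∀ n, Projective (Q n))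
    (a : ∀ n, X (n + 1) ⟶ Q n) (b : ∀ n, Q n ⟶ X n) (ha : ∀ n, Epi (a n)) (hb : ∀ n, Epi (b n))
    (hab : ∀ n, a n ≫ b n = φ n) {c : Fan fun j : ULift.{u} ℕ => Q j.down} (hc : IsLimit c) :
    Nonempty (Retract Z c.pt) := by
  have hm n : Epi (b (n + 1) ≫ a n) := epi_comp _ _
  let ρ n : Q n ⟶ Q (n + 1) := Projective.factorThru (𝟙 _) (b (n + 1) ≫ a n)
  have hρ n : ρ n ≫ b (n + 1) ≫ a n = 𝟙 _ := Projective.factorThru_comp _ _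
  let q : Z ⟶ c.pt := Fan.IsLimit.lift hc fun j => z (j.down + 1) ≫ a j.down
  have hq n : q ≫ c.proj ⟨n⟩ = z (n + 1) ≫ a n := Fan.IsLimit.fac hc _ ⟨n⟩
  -- The first component is lifted by the section `ρ`, and a new coordinate is added only on the
  -- kernel of `Q (n + 1) ⟶ Q n`; this makes the `w n` a compatible family.
  let w : ∀ n, c.pt ⟶ Q n := fun n => Nat.rec (motive := fun n => c.pt ⟶ Q n) (c.proj ⟨0⟩)
    (fun n w => w ≫ ρ n + c.proj ⟨n + 1⟩ ≫ (𝟙 _ - b (n + 1) ≫ a n ≫ ρ n)) n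
  have hw n : w (n + 1) = w n ≫ ρ n + c.proj ⟨n + 1⟩ ≫ (𝟙 _ - b (n + 1) ≫ a n ≫ ρ n) := rfl
  have hwq n : q ≫ w n = z (n + 1) ≫ a n := by
    induction n with
    | zero => exact hq 0
    | succ n ih =>
      rw [hw, Preadditive.comp_add, reassoc_of% ih, reassoc_of% hq (n + 1), Preadditive.comp_sub,
        Preadditive.comp_sub, reassoc_of% hab (n + 1), reassoc_of% hz.w (n + 1), Category.comp_id,
        add_sub_cancel]
  obtain ⟨d, hd⟩ := hz.exists_lift (fun n => w n ≫ b n) fun n => by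
    have hρ' := hρ n
    have h0 : (𝟙 _ - b (n + 1) ≫ a n ≫ ρ n) ≫ b (n + 1) ≫ a n = 0 := by
      rw [Preadditive.sub_comp, Category.id_comp, Category.assoc, Category.assoc, hρ',
        Category.comp_id, sub_self]
    rw [← hab, hw, Preadditive.add_comp, Preadditive.add_comp, Category.assoc, Category.assoc,
      reassoc_of% hρ', Category.assoc, Category.assoc, reassoc_of% h0, zero_comp, comp_zero,
      add_zero]
  exact ⟨⟨q, d, hz.hom_ext fun n => by
    rw [Category.assoc, hd, reassoc_of% hwq, hab, hz.w, Category.id_comp]⟩⟩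

end Sequences

/-! ### Telescopes -/

section Telescope

variable {R : Type u} [Ring R]

lemma eq_zero_of_forall_proj {ι : Type u} [DecidableEq ι] {K : ι → ModuleCat.{u} R} {c : Cofan K}
    (hc : IsColimit c) (p : ∀ j, c.pt ⟶ K j) (hp : ∀ j, c.inj j ≫ p j = 𝟙 _)
    (hp' : ∀ i j, i ≠ j → c.inj i ≫ p j = 0) (x : c.pt) (hx : ∀ j, p j x = 0) : x = 0 := by
  let e : c.pt ≅ ModuleCat.of R (DirectSum ι fun i => K i) :=
    hc.coconePointUniqueUpToIso (ModuleCat.coproductCoconeIsColimit K)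
  have he i : c.inj i ≫ e.hom = ModuleCat.ofHom (DirectSum.lof R ι (fun i => K i) i) :=
    hc.comp_coconePointUniqueUpToIso_hom _ ⟨i⟩
  have hpe j : e.hom ≫ ModuleCat.ofHom (DirectSum.component R ι (fun i => K i) j) = p j :=
    Cofan.IsColimit.hom_ext hc _ _ fun i => by
      rw [reassoc_of% he i]
      by_cases h : i = j
      · subst h
        rw [hp]
        ext x
        exact DirectSum.component.lof_self (R := R) (M := fun i => K i) i x
      · rw [hp' i j h]
        ext x
        exact (DirectSum.component.of (R := R) (M := fun i => K i) j i x).trans (dif_neg h)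
  have h0 : e.hom x = 0 := DFinsupp.ext fun j => by
    have := congrArg (fun f => f.hom x) (hpe j)
    exact this.trans (hx j)
  exact (ModuleCat.mono_iff_injective e.hom).1 inferInstance (h0.trans (map_zero _).symm)

lemma exists_forall_proj_eq {ι : Type u} {K : ι → ModuleCat.{u} R} {c : Fan K}
    (hc : IsLimit c) (y : ∀ j, K j) : ∃ x : c.pt, ∀ j, c.proj j x = y j := by
  let e := (ModuleCat.productConeIsLimit K).conePointUniqueUpToIso hc
  have he i : e.hom ≫ c.proj i = (ModuleCat.productCone K).proj i :=
    IsLimit.conePointUniqueUpToIso_hom_comp _ hc ⟨i⟩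
  exact ⟨e.hom y, fun j => congrArg (fun f => f.hom y) (he j)⟩

/-- The telescope sequence. Exactness on the right is the universal property of the colimit;
injectivity of `t` is read off coordinate by coordinate, because coordinate `n + 1` of `t x`
involves only coordinates `n` and `n + 1` of `x`. -/
lemma IsSeqColimit.shortExact {X : ℕ → ModuleCat.{u} R} {φ : ∀ n, X n ⟶ X (n + 1)}
    {Z : ModuleCat.{u} R} {z : ∀ n, X n ⟶ Z} (hz : IsSeqColimit φ z)
    {c : Cofan fun j : ULift.{u} ℕ => X j.down} (hc : IsColimit c) (t : c.pt ⟶ c.pt)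
    (ht : ∀ n, c.inj ⟨n⟩ ≫ t = c.inj ⟨n⟩ - φ n ≫ c.inj ⟨n + 1⟩) (g : c.pt ⟶ Z)
    (hg : ∀ n, c.inj ⟨n⟩ ≫ g = z n) (w : t ≫ g = 0) : (ShortComplex.mk t g w).ShortExact := by
  classical
  have hl : IsColimit (CokernelCofork.ofπ g w) := by
    have key {W : ModuleCat.{u} R} (k : c.pt ⟶ W) (hk : t ≫ k = 0) : ∃ d : Z ⟶ W, g ≫ d = k := by
      obtain ⟨d, hd⟩ := hz.exists_desc (fun n => c.inj ⟨n⟩ ≫ k) fun n => by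
        have := ht n =≫ k
        rw [Category.assoc, hk, comp_zero, Preadditive.sub_comp, Category.assoc] at this
        exact (sub_eq_zero.1 this.symm).symm
      exact ⟨d, Cofan.IsColimit.hom_ext hc _ _ fun ⟨n⟩ => by rw [reassoc_of% hg n, hd]⟩
    refine CokernelCofork.IsColimit.ofπ _ _ (fun k hk => (key k hk).choose)
      (fun k hk => (key k hk).choose_spec) fun k hk m hm => hz.hom_ext fun n => ?_
    rw [← hg, Category.assoc, Category.assoc, hm, (key k hk).choose_spec]
  let p (j : ULift.{u} ℕ) : c.pt ⟶ X j.down :=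
    Cofan.IsColimit.desc hc fun i => if h : i = j then eqToHom (by rw [h]) else 0
  have hp j : c.inj j ≫ p j = 𝟙 _ := (Cofan.IsColimit.fac hc _ j).trans (by simp)
  have hp' i j (h : i ≠ j) : c.inj i ≫ p j = 0 :=
    (Cofan.IsColimit.fac hc _ i).trans (by simp [h])
  have e₀ : t ≫ p ⟨0⟩ = p ⟨0⟩ := Cofan.IsColimit.hom_ext hc _ _ fun ⟨n⟩ => by
    rw [reassoc_of% ht n, Preadditive.sub_comp, Category.assoc, hp' ⟨n + 1⟩ ⟨0⟩ (by simp),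
      comp_zero, sub_zero]
  have e₁ n : t ≫ p ⟨n + 1⟩ = p ⟨n + 1⟩ - p ⟨n⟩ ≫ φ n :=
    Cofan.IsColimit.hom_ext hc _ _ fun ⟨m⟩ => by
      rw [reassoc_of% ht m, Preadditive.sub_comp, Preadditive.comp_sub, Category.assoc]
      by_cases h : m = n
      · subst h
        rw [hp ⟨m + 1⟩, reassoc_of% hp ⟨m⟩, Category.comp_id]
      · rw [hp' ⟨m + 1⟩ ⟨n + 1⟩ (by simpa using h), reassoc_of% hp' ⟨m⟩ ⟨n⟩ (by simpa using h),
          comp_zero, zero_comp]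
  have : Mono t := by
    refine (ModuleCat.mono_iff_injective t).2 ((injective_iff_map_eq_zero t.hom).2 fun x hx => ?_)
    refine eq_zero_of_forall_proj hc p hp hp' x fun ⟨n⟩ => ?_
    induction n with
    | zero =>
      have := congrArg (fun f => f.hom x) e₀
      exact this.symm.trans ((congrArg (p ⟨0⟩).hom hx).trans (map_zero _))
    | succ n ih =>
      have := congrArg (fun f => f.hom x) (e₁ n)
      have h2 : (p ⟨n + 1⟩).hom (t.hom x) = (p ⟨n + 1⟩).hom x - (φ n).hom ((p ⟨n⟩).hom x) := this
      rw [hx, map_zero, show (p ⟨n⟩).hom x = 0 from ih, map_zero, sub_zero] at h2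
      exact h2.symm
  have : Epi g := epi_of_isColimit_cofork hl
  exact ⟨ShortComplex.exact_of_g_is_cokernel _ hl⟩

/-- Surjectivity of `t` is the vanishing of the derived limit, for which the transition maps must be
epimorphisms. -/
lemma IsSeqLimit.shortExact {X : ℕ → ModuleCat.{u} R} {φ : ∀ n, X (n + 1) ⟶ X n}
    {Z : ModuleCat.{u} R} {z : ∀ n, Z ⟶ X n} (hz : IsSeqLimit φ z) (hφ : ∀ n, Epi (φ n))
    {c : Fan fun j : ULift.{u} ℕ => X j.down} (hc : IsLimit c) (t : c.pt ⟶ c.pt)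
    (ht : ∀ n, t ≫ c.proj ⟨n⟩ = c.proj ⟨n⟩ - c.proj ⟨n + 1⟩ ≫ φ n) (g : Z ⟶ c.pt)
    (hg : ∀ n, g ≫ c.proj ⟨n⟩ = z n) (w : g ≫ t = 0) : (ShortComplex.mk g t w).ShortExact := by
  have hl : IsLimit (KernelFork.ofι g w) := by
    have key {W : ModuleCat.{u} R} (k : W ⟶ c.pt) (hk : k ≫ t = 0) : ∃ d : W ⟶ Z, d ≫ g = k := by
      obtain ⟨d, hd⟩ := hz.exists_lift (fun n => k ≫ c.proj ⟨n⟩) fun n => by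
        have := k ≫= ht n
        rw [reassoc_of% hk, zero_comp, Preadditive.comp_sub] at this
        rw [Category.assoc]
        exact (sub_eq_zero.1 this.symm).symm
      exact ⟨d, Fan.IsLimit.hom_ext hc _ _ fun ⟨n⟩ => by rw [Category.assoc, hg, hd]⟩
    refine KernelFork.IsLimit.ofι _ _ (fun k hk => (key k hk).choose)
      (fun k hk => (key k hk).choose_spec) fun k hk m hm => hz.hom_ext fun n => ?_
    rw [← hg, ← Category.assoc, ← Category.assoc, hm, (key k hk).choose_spec]
  have : Epi t := by
    refine (ModuleCat.epi_iff_surjective t).2 fun y => ?_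
    choose s hs using fun n => (ModuleCat.epi_iff_surjective (φ n)).1 (hφ n)
    -- Solves `x n - φ n (x (n + 1)) = y n` recursively; the initial value 0 is arbitrary.
    let x : ∀ n, X n := fun n => Nat.rec (motive := fun n => X n) 0
      (fun n x => s n (x - (c.proj ⟨n⟩).hom y)) n
    obtain ⟨x', hx'⟩ := exists_forall_proj_eq hc fun j => x j.down
    refine ⟨x', Concrete.isLimit_ext _ hc _ _ fun ⟨⟨n⟩⟩ => ?_⟩
    have h₁ : (c.proj ⟨n⟩).hom (t.hom x') =
        (c.proj ⟨n⟩).hom x' - (φ n).hom ((c.proj ⟨n + 1⟩).hom x') :=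
      congrArg (fun f => f.hom x') (ht n)
    have h₂ : (φ n).hom (x (n + 1)) = x n - (c.proj ⟨n⟩).hom y := hs n _
    have h₃ : (c.proj ⟨n⟩).hom x' = x n := hx' ⟨n⟩
    have h₄ : (c.proj ⟨n + 1⟩).hom x' = x (n + 1) := hx' ⟨n + 1⟩
    rw [h₃, h₄, h₂, sub_sub_cancel] at h₁
    exact h₁
  have : Mono g := mono_of_isLimit_fork hl
  exact ⟨ShortComplex.exact_of_f_is_kernel _ hl⟩

variable {P : ObjectProperty (Hot (ModuleCat.{u} R))} [P.IsTriangulated]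
  [P.IsClosedUnderIsomorphisms] (hP : ContainsTot (abelianConf (ModuleCat.{u} R)) P)
include hP

lemma ContainsTot.prop_of_isSeqColimit (hP' : ClosedUnderSums P)
    {X : ℕ → CochainComplex (ModuleCat.{u} R) ℤ} {φ : ∀ n, X n ⟶ X (n + 1)}
    {Z : CochainComplex (ModuleCat.{u} R) ℤ} {z : ∀ n, X n ⟶ Z}
    (hz : ∀ i : ℤ, IsSeqColimit (fun n => (φ n).f i) fun n => (z n).f i)
    (hX : ∀ n, P (toHot (X n))) : P (toHot Z) := by
  let K : ULift.{u} ℕ → CochainComplex (ModuleCat.{u} R) ℤ := fun j => X j.down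
  let c : Cofan K := Cofan.mk (∐ K) (Sigma.ι K)
  have hc : IsColimit c := coproductIsCoproduct K
  let t : c.pt ⟶ c.pt := Cofan.IsColimit.desc hc fun j =>
    c.inj j - φ j.down ≫ c.inj ⟨j.down + 1⟩
  have ht n : c.inj ⟨n⟩ ≫ t = c.inj ⟨n⟩ - φ n ≫ c.inj ⟨n + 1⟩ := Cofan.IsColimit.fac hc _ ⟨n⟩
  let g : c.pt ⟶ Z := Cofan.IsColimit.desc hc fun j => z j.down
  have hg n : c.inj ⟨n⟩ ≫ g = z n := Cofan.IsColimit.fac hc _ ⟨n⟩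
  have w : t ≫ g = 0 := Cofan.IsColimit.hom_ext hc _ _ fun ⟨n⟩ => by
    rw [reassoc_of% ht n, Preadditive.sub_comp, Category.assoc, hg, hg, comp_zero, sub_eq_zero]
    ext i : 1
    exact ((hz i).w n).symm
  have hS (i : ℤ) := (hz i).shortExact
    (isColimitCofanMkObjOfIsColimit (HomologicalComplex.eval _ _ i) K c.inj hc) (t.f i)
    (fun n => congrArg (fun f => f.f i) (ht n)) (g.f i) (fun n => congrArg (fun f => f.f i) (hg n))
    (congrArg (fun f => f.f i) w)
  have hY : P (toHot c.pt) := hP' _ K c hc fun j => hX _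
  exact (hP.prop_X₃_iff (S := ShortComplex.mk t g w) hS).1
    (P.trW_iff_of_distinguished _ (HomotopyCategory.mappingCone_triangleh_distinguished t) |>.2
      (P.ext_of_isTriangulatedClosed₃ _
        (HomotopyCategory.mappingCone_triangleh_distinguished t) hY hY))

lemma ContainsTot.prop_of_isSeqLimit (hP' : ClosedUnderProds P)
    {X : ℕ → CochainComplex (ModuleCat.{u} R) ℤ} {φ : ∀ n, X (n + 1) ⟶ X n}
    {Z : CochainComplex (ModuleCat.{u} R) ℤ} {z : ∀ n, Z ⟶ X n}
    (hz : ∀ i : ℤ, IsSeqLimit (fun n => (φ n).f i) fun n => (z n).f i)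
    (hφ : ∀ n i, Epi ((φ n).f i))
    (hX : ∀ n, P (toHot (X n))) : P (toHot Z) := by
  let K : ULift.{u} ℕ → CochainComplex (ModuleCat.{u} R) ℤ := fun j => X j.down
  let c : Fan K := Fan.mk (∏ᶜ K) (Pi.π K)
  have hc : IsLimit c := productIsProduct K
  let t : c.pt ⟶ c.pt := Fan.IsLimit.lift hc fun j =>
    c.proj j - c.proj ⟨j.down + 1⟩ ≫ φ j.down
  have ht n : t ≫ c.proj ⟨n⟩ = c.proj ⟨n⟩ - c.proj ⟨n + 1⟩ ≫ φ n := Fan.IsLimit.fac hc _ ⟨n⟩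
  let g : Z ⟶ c.pt := Fan.IsLimit.lift hc fun j => z j.down
  have hg n : g ≫ c.proj ⟨n⟩ = z n := Fan.IsLimit.fac hc _ ⟨n⟩
  have w : g ≫ t = 0 := Fan.IsLimit.hom_ext hc _ _ fun ⟨n⟩ => by
    rw [Category.assoc, ht n, Preadditive.comp_sub, reassoc_of% hg (n + 1), hg, zero_comp,
      sub_eq_zero]
    ext i : 1
    exact ((hz i).w n).symm
  have hS (i : ℤ) := (hz i).shortExact (fun n => hφ n i)
    (isLimitFanMkObjOfIsLimit (HomologicalComplex.eval _ _ i) K c.proj hc) (t.f i)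
    (fun n => congrArg (fun f => f.f i) (ht n)) (g.f i) (fun n => congrArg (fun f => f.f i) (hg n))
    (congrArg (fun f => f.f i) w)
  have hY : P (toHot c.pt) := hP' _ K c hc fun j => hX _
  have h₁ := (hP.prop_X₃_iff (S := ShortComplex.mk g t w) hS).2 hY
  have h₂ := (P.trW_iff_of_distinguished _
    (HomotopyCategory.mappingCone_triangleh_distinguished g)).1 h₁
  exact P.ext_of_isTriangulatedClosed₁ _
    (HomotopyCategory.mappingCone_triangleh_distinguished g) hY h₂

end Telescope

/-! ### Resolutions -/

section Resolutions

open CochainComplex HomComplex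

section

variable {C : Type u₁} [Category.{v₁} C] [Preadditive C] [HasBinaryBiproducts C]

lemma inl_v_mappingCone_map_f {K L K' L' : CochainComplex C ℤ} (f : K ⟶ L) (f' : K' ⟶ L')
    (a : K ⟶ K') (b : L ⟶ L') (comm : f ≫ b = a ≫ f') (p q : ℤ) (h : p + -1 = q) :
    (mappingCone.inl f).v p q h ≫ (mappingCone.map f f' a b comm).f q =
      a.f p ≫ (mappingCone.inl f').v p q h := by
  rw [mappingCone.map, mappingCone.inl_v_desc_f, Cochain.zero_cochain_comp_v, Cochain.ofHom_v]

lemma inr_f_mappingCone_map_f {K L K' L' : CochainComplex C ℤ} (f : K ⟶ L) (f' : K' ⟶ L')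
    (a : K ⟶ K') (b : L ⟶ L') (comm : f ≫ b = a ≫ f') (p : ℤ) :
    (mappingCone.inr f).f p ≫ (mappingCone.map f f' a b comm).f p =
      b.f p ≫ (mappingCone.inr f').f p := by
  rw [mappingCone.map, mappingCone.inr_f_desc_f, HomologicalComplex.comp_f]

lemma mappingCone_map_f_fst_v {K L K' L' : CochainComplex C ℤ} (f : K ⟶ L) (f' : K' ⟶ L')
    (a : K ⟶ K') (b : L ⟶ L') (comm : f ≫ b = a ≫ f') (p q : ℤ) (h : p + 1 = q) :
    (mappingCone.map f f' a b comm).f p ≫ (mappingCone.fst f').1.v p q h =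
      (mappingCone.fst f).1.v p q h ≫ a.f q := by
  apply mappingCone.ext_from _ q p h
  · rw [reassoc_of% inl_v_mappingCone_map_f, mappingCone.inl_v_fst_v,
      mappingCone.inl_v_fst_v_assoc, Category.comp_id]
  · rw [reassoc_of% inr_f_mappingCone_map_f, mappingCone.inr_f_fst_v,
      mappingCone.inr_f_fst_v_assoc, zero_comp, comp_zero]

lemma mappingCone_map_f_snd_v {K L K' L' : CochainComplex C ℤ} (f : K ⟶ L) (f' : K' ⟶ L')
    (a : K ⟶ K') (b : L ⟶ L') (comm : f ≫ b = a ≫ f') (p : ℤ) :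
    (mappingCone.map f f' a b comm).f p ≫ (mappingCone.snd f').v p p (add_zero p) =
      (mappingCone.snd f).v p p (add_zero p) ≫ b.f p := by
  apply mappingCone.ext_from _ (p + 1) p rfl
  · rw [reassoc_of% inl_v_mappingCone_map_f, mappingCone.inl_v_snd_v,
      mappingCone.inl_v_snd_v_assoc, zero_comp, comp_zero]
  · rw [reassoc_of% inr_f_mappingCone_map_f, mappingCone.inr_f_snd_v,
      mappingCone.inr_f_snd_v_assoc, Category.comp_id]

/-- The `A`-summand of the cones is constant along the sequence, so only the terms of the `X n` in
degree `i` have to form a colimit. -/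
lemma isSeqColimit_mappingCone {A Z : CochainComplex C ℤ} {X : ℕ → CochainComplex C ℤ}
    {φ : ∀ n, X n ⟶ X (n + 1)} {z : ∀ n, X n ⟶ Z} {i : ℤ}
    (hz : IsSeqColimit (fun n => (φ n).f i) fun n => (z n).f i) (s : ∀ n, A ⟶ X n)
    (hs : ∀ n, s n ≫ φ n = 𝟙 A ≫ s (n + 1)) (r : A ⟶ Z) (hr : ∀ n, s n ≫ z n = 𝟙 A ≫ r) :
    IsSeqColimit (fun n => (mappingCone.map _ _ _ _ (hs n)).f i)
      fun n => (mappingCone.map _ _ _ _ (hr n)).f i where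
  w n := by
    apply mappingCone.ext_from _ (i + 1) i rfl
    · rw [reassoc_of% inl_v_mappingCone_map_f, inl_v_mappingCone_map_f, inl_v_mappingCone_map_f,
        HomologicalComplex.id_f, Category.id_comp]
    · rw [reassoc_of% inr_f_mappingCone_map_f, inr_f_mappingCone_map_f, inr_f_mappingCone_map_f,
        ← hz.w n, Category.assoc]
  exists_desc {W} k hk := by
    obtain ⟨d, hd⟩ := hz.exists_desc (fun n => (mappingCone.inr (s n)).f i ≫ k n) fun n => by
      rw [← hk n, reassoc_of% inr_f_mappingCone_map_f]
    refine ⟨(mappingCone.fst r).1.v i (i + 1) rfl ≫ (mappingCone.inl (s 0)).v (i + 1) i (by lia) ≫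
      k 0 + (mappingCone.snd r).v i i (add_zero i) ≫ d, fun n => ?_⟩
    have hα : (mappingCone.inl (s n)).v (i + 1) i (by lia) ≫ k n =
        (mappingCone.inl (s 0)).v (i + 1) i (by lia) ≫ k 0 := by
      induction n with
      | zero => rfl
      | succ n ih =>
        rw [← ih, ← hk n, reassoc_of% inl_v_mappingCone_map_f, HomologicalComplex.id_f,
          Category.id_comp]
    apply mappingCone.ext_from _ (i + 1) i rfl
    · rw [reassoc_of% inl_v_mappingCone_map_f, hα, HomologicalComplex.id_f, Category.id_comp,
        Preadditive.comp_add, mappingCone.inl_v_fst_v_assoc, mappingCone.inl_v_snd_v_assoc,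
        zero_comp, add_zero]
    · rw [reassoc_of% inr_f_mappingCone_map_f, Preadditive.comp_add, mappingCone.inr_f_fst_v_assoc,
        mappingCone.inr_f_snd_v_assoc, zero_comp, zero_add, hd]
  hom_ext {W} d d' h := by
    apply mappingCone.ext_from _ (i + 1) i rfl
    · have := (mappingCone.inl (s 0)).v (i + 1) i (by lia) ≫= h 0
      rwa [reassoc_of% inl_v_mappingCone_map_f, reassoc_of% inl_v_mappingCone_map_f,
        HomologicalComplex.id_f,
        Category.id_comp, Category.id_comp] at this
    · refine hz.hom_ext fun n => ?_
      have := (mappingCone.inr (s n)).f i ≫= h n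
      rwa [reassoc_of% inr_f_mappingCone_map_f, reassoc_of% inr_f_mappingCone_map_f] at this

/-- Here `A` is the target, so the varying summand of the cone in degree `i` sits in degree `i + 1`.
-/
lemma isSeqLimit_mappingCone {A Z : CochainComplex C ℤ} {X : ℕ → CochainComplex C ℤ}
    {φ : ∀ n, X (n + 1) ⟶ X n} {z : ∀ n, Z ⟶ X n} {i : ℤ}
    (hz : IsSeqLimit (fun n => (φ n).f (i + 1)) fun n => (z n).f (i + 1)) (s : ∀ n, X n ⟶ A)
    (hs : ∀ n, s (n + 1) ≫ 𝟙 A = φ n ≫ s n) (r : Z ⟶ A) (hr : ∀ n, r ≫ 𝟙 A = z n ≫ s n) :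
    IsSeqLimit (fun n => (mappingCone.map _ _ _ _ (hs n)).f i)
      fun n => (mappingCone.map _ _ _ _ (hr n)).f i where
  w n := by
    apply mappingCone.ext_to _ i (i + 1) rfl
    · rw [Category.assoc, mappingCone_map_f_fst_v, mappingCone_map_f_fst_v,
        reassoc_of% mappingCone_map_f_fst_v, hz.w]
    · rw [Category.assoc, mappingCone_map_f_snd_v, mappingCone_map_f_snd_v,
        reassoc_of% mappingCone_map_f_snd_v, HomologicalComplex.id_f, Category.comp_id]
  exists_lift {W} k hk := by
    obtain ⟨d, hd⟩ := hz.exists_lift (fun n => k n ≫ (mappingCone.fst (s n)).1.v i (i + 1) rfl)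
      fun n => by rw [← hk n, Category.assoc, Category.assoc, mappingCone_map_f_fst_v]
    refine ⟨d ≫ (mappingCone.inl r).v (i + 1) i (by lia) +
      (k 0 ≫ (mappingCone.snd (s 0)).v i i (add_zero i)) ≫ (mappingCone.inr r).f i, fun n => ?_⟩
    have hα : k n ≫ (mappingCone.snd (s n)).v i i (add_zero i) =
        k 0 ≫ (mappingCone.snd (s 0)).v i i (add_zero i) := by
      induction n with
      | zero => rfl
      | succ n ih =>
        rw [← ih, ← hk n, Category.assoc, mappingCone_map_f_snd_v, HomologicalComplex.id_f,
          Category.comp_id]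
    apply mappingCone.ext_to _ i (i + 1) rfl
    · rw [Category.assoc, mappingCone_map_f_fst_v, Preadditive.add_comp, Category.assoc,
        Category.assoc, mappingCone.inl_v_fst_v_assoc, mappingCone.inr_f_fst_v_assoc, zero_comp,
        comp_zero, add_zero, hd]
    · rw [Category.assoc, mappingCone_map_f_snd_v, hα, HomologicalComplex.id_f, Category.comp_id,
        Preadditive.add_comp, Category.assoc, Category.assoc, mappingCone.inl_v_snd_v,
        mappingCone.inr_f_snd_v, comp_zero, zero_add, Category.comp_id]
  hom_ext {W} d d' h := by
    apply mappingCone.ext_to _ i (i + 1) rfl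
    · refine hz.hom_ext fun n => ?_
      have := h n =≫ (mappingCone.fst (s n)).1.v i (i + 1) rfl
      rwa [Category.assoc, Category.assoc, mappingCone_map_f_fst_v, ← Category.assoc,
        ← Category.assoc] at this
    · have := h 0 =≫ (mappingCone.snd (s 0)).v i i (add_zero i)
      rwa [Category.assoc, Category.assoc, mappingCone_map_f_snd_v, HomologicalComplex.id_f,
        Category.comp_id] at this

lemma epi_mappingCone_map_f {K L K' L' : CochainComplex C ℤ} (f : K ⟶ L) (f' : K' ⟶ L')
    (a : K ⟶ K') (b : L ⟶ L') (comm : f ≫ b = a ≫ f') (ha : ∀ n, Epi (a.f n))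
    (hb : ∀ n, Epi (b.f n)) (n : ℤ) : Epi ((mappingCone.map f f' a b comm).f n) where
  left_cancellation g h e := by
    have := ha (n + 1)
    have := hb n
    apply mappingCone.ext_from _ (n + 1) n rfl
    · rw [← cancel_epi (a.f (n + 1)), ← reassoc_of% inl_v_mappingCone_map_f _ _ _ _ comm, e,
        reassoc_of% inl_v_mappingCone_map_f]
    · rw [← cancel_epi (b.f n), ← reassoc_of% inr_f_mappingCone_map_f _ _ _ _ comm, e,
        reassoc_of% inr_f_mappingCone_map_f]

end

variable {R : Type u} [Ring R]

/-- Every complex of modules admits a morphism with coacyclic cone to a complex whose terms are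
in a given class, if this class contains the injective modules and is closed under coproducts
and retracts. -/
lemma exists_trW_coacyclic (P : ObjectProperty (ModuleCat.{u} R))
    [P.IsStableUnderRetracts] [P.IsClosedUnderColimitsOfShape (Discrete (ULift.{u} ℕ))]
    (hP : isInjective _ ≤ P) (M : CochainComplex (ModuleCat.{u} R) ℤ) :
    ∃ (J : CochainComplex (ModuleCat.{u} R) ℤ) (s : M ⟶ J), (∀ n, P (J.X n)) ∧
      (coacyclic (abelianConf _)).trW ((HomotopyCategory.quotient (ModuleCat.{u} R) _).map s) := by
  have htot := containsTot_coacyclic (abelianConf (ModuleCat.{u} R))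
  choose X' f hf I hI a b ha hb hab using fun X : CochainComplex (ModuleCat.{u} R) ℤ =>
    exists_trW_injective_fac htot X
  let X : ℕ → CochainComplex (ModuleCat.{u} R) ℤ := fun n => Nat.rec M (fun _ => X') n
  let φ : ∀ n, X n ⟶ X (n + 1) := fun n => f (X n)
  obtain ⟨J, z, hz, hz'⟩ := exists_isSeqColimit φ
  have hJ (i : ℤ) : IsSeqColimit (fun n => (φ n).f i) fun n => (z n).f i :=
    hz' (HomologicalComplex.eval _ _ i)
  let s : ∀ n, M ⟶ X n := fun n => Nat.rec (motive := fun n => M ⟶ X n) (𝟙 _)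
    (fun n s => s ≫ φ n) n
  have hs n : (coacyclic (abelianConf _)).trW
      ((HomotopyCategory.quotient (ModuleCat.{u} R) _).map (s n)) := by
    induction n with
    | zero =>
      change ObjectProperty.trW _ ((HomotopyCategory.quotient (ModuleCat.{u} R) _).map (𝟙 M))
      exact ObjectProperty.trW_of_isIso _ _
    | succ n ih =>
      have := MorphismProperty.comp_mem _ _ _ ih (hf (X n))
      rwa [← Functor.map_comp] at this
  have hr n : s n ≫ z n = 𝟙 M ≫ z 0 := by
    induction n with
    | zero => rfl
    | succ n ih => rw [← ih, ← hz.w n, ← Category.assoc]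
  -- The cone of `M ⟶ J` is the colimit of the cones of `M ⟶ X n`, which are coacyclic; the
  -- telescope applies to these cones.
  refine ⟨J, z 0, fun i => ?_, (prop_mappingCone_iff _ _).1 (htot.prop_of_isSeqColimit
    (closedUnderSums_coacyclic _) (fun i => isSeqColimit_mappingCone (hJ i) s
      (fun n => (Category.id_comp _).symm) (z 0) hr) fun n => (prop_mappingCone_iff _ _).2 (hs n))⟩
  obtain ⟨r⟩ := (hJ i).nonempty_retract (fun n => hI (X n) i) (fun n => a (X n) i)
    (fun n => b (X n) i) (fun n => ha _ _) (fun n => hb _ _) (fun n => hab _ _)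
    (coproductIsCoproduct (fun j : ULift.{u} ℕ => I (X j.down) i))
  exact P.prop_of_retract r (P.prop_colimit _ fun j => hP _ (hI _ _))

/-- Every complex of modules admits a morphism with contraacyclic cone from a complex whose terms
are in a given class, if this class contains the projective modules and is closed under products
and retracts. -/
lemma exists_trW_contraacyclic (P : ObjectProperty (ModuleCat.{u} R))
    [P.IsStableUnderRetracts] [P.IsClosedUnderLimitsOfShape (Discrete (ULift.{u} ℕ))]
    (hP : isProjective _ ≤ P) (M : CochainComplex (ModuleCat.{u} R) ℤ) :
    ∃ (J : CochainComplex (ModuleCat.{u} R) ℤ) (s : J ⟶ M), (∀ n, P (J.X n)) ∧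
      (contraacyclic (abelianConf _)).trW
        ((HomotopyCategory.quotient (ModuleCat.{u} R) _).map s) := by
  have htot := containsTot_contraacyclic (abelianConf (ModuleCat.{u} R))
  choose X' f hf hfe Q hQ a b ha hb hab using fun X : CochainComplex (ModuleCat.{u} R) ℤ =>
    exists_trW_projective_fac htot X
  let X : ℕ → CochainComplex (ModuleCat.{u} R) ℤ := fun n => Nat.rec M (fun _ => X') n
  let φ : ∀ n, X (n + 1) ⟶ X n := fun n => f (X n)
  obtain ⟨J, z, hz, hz'⟩ := exists_isSeqLimit φ
  have hJ (i : ℤ) : IsSeqLimit (fun n => (φ n).f i) fun n => (z n).f i :=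
    hz' (HomologicalComplex.eval _ _ i)
  let s : ∀ n, X n ⟶ M := fun n => Nat.rec (motive := fun n => X n ⟶ M) (𝟙 _)
    (fun n s => φ n ≫ s) n
  have hs n : (contraacyclic (abelianConf _)).trW
      ((HomotopyCategory.quotient (ModuleCat.{u} R) _).map (s n)) := by
    induction n with
    | zero =>
      change ObjectProperty.trW _ ((HomotopyCategory.quotient (ModuleCat.{u} R) _).map (𝟙 M))
      exact ObjectProperty.trW_of_isIso _ _
    | succ n ih =>
      have := MorphismProperty.comp_mem _ _ _ (hf (X n)) ih
      rwa [← Functor.map_comp] at this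
  have hr n : z 0 ≫ 𝟙 M = z n ≫ s n := by
    induction n with
    | zero => rfl
    | succ n ih => rw [ih, ← hz.w n, Category.assoc]
  refine ⟨J, z 0, fun i => ?_, (prop_mappingCone_iff _ _).1 (htot.prop_of_isSeqLimit
    (closedUnderProds_contraacyclic _) (fun i => isSeqLimit_mappingCone (hJ (i + 1)) s
      (fun n => Category.comp_id _) (z 0) hr)
      (fun n i => epi_mappingCone_map_f _ _ _ _ _ (hfe _) (fun _ => inferInstance) i)
      fun n => (prop_mappingCone_iff _ _).2 (hs n))⟩
  obtain ⟨r⟩ := (hJ i).nonempty_retract (fun n => hQ (X n) i) (fun n => a (X n) i)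
    (fun n => b (X n) i) (fun n => ha _ _) (fun n => hb _ _) (fun n => hab _ _)
    (productIsProduct (fun j : ULift.{u} ℕ => Q (X j.down) i))
  exact P.prop_of_retract r (P.prop_limit _ fun j => hP _ (hQ _ _))

end Resolutions

/-! ### Homomorphisms from tensor products -/

section Lift

variable {A : Type u} [Ring A] {N F : Type u} [AddCommGroup N] [Module Aᵐᵒᵖ N] [AddCommGroup F]
  [Module A F] {G : Type v} [AddCommGroup G]

/-- The homomorphism `N ⊗_A F → G` given by a balanced biadditive map. -/
def BalancedTensor.lift (φ : N →+ F →+ G)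
    (h : ∀ n (a : A) x, φ (MulOpposite.op a • n) x = φ n (a • x)) :
    BalancedTensor A N F →+ G :=
  QuotientAddGroup.lift _
    (TensorProduct.liftAddHom φ fun r n x => by
      rw [map_zsmul, map_zsmul, AddMonoidHom.zsmul_apply]) <| by
    rw [balancedRel, AddSubgroup.closure_le]
    rintro _ ⟨n, a, x, rfl⟩
    rw [SetLike.mem_coe, AddMonoidHom.mem_ker, map_sub, TensorProduct.liftAddHom_tmul,
      TensorProduct.liftAddHom_tmul, h, sub_self]

variable (A N F) in
/-- The biadditive map `n, x ↦ n ⊗ x`. -/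
def BalancedTensor.mk : N →+ F →+ BalancedTensor A N F :=
  .mk' (fun n => .mk' (fun x => QuotientAddGroup.mk (n ⊗ₜ x)) fun x y => by
      rw [TensorProduct.tmul_add, QuotientAddGroup.mk_add]) fun n n' => by
    ext x
    exact congrArg QuotientAddGroup.mk (TensorProduct.add_tmul n n' x)

lemma BalancedTensor.mk_smul (n : N) (a : A) (x : F) :
    BalancedTensor.mk A N F (MulOpposite.op a • n) x = BalancedTensor.mk A N F n (a • x) :=
  (QuotientAddGroup.eq_iff_sub_mem).2 (AddSubgroup.subset_closure ⟨n, a, x, rfl⟩)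

end Lift

/-! ### Fp-injective modules -/

section FpInjective

variable {A : Type u} [Ring A]

/-- A finitely generated submodule of a free module is an extension of a finitely generated left
ideal, its image under the first coordinate, by a submodule of a free module of smaller rank. That
kernel is again finitely generated because the ideal is finitely presented. -/
lemma IsLeftCoherent.finitePresentation_of_injective (hA : IsLeftCoherent A) :
    ∀ (n : ℕ) (N : Type u) [AddCommGroup N] [Module A N] [Module.Finite A N]
      (f : N →ₗ[A] (Fin n → A)), Function.Injective f → Module.FinitePresentation A N
  | 0, N, _, _, _, f, hf => by
    have : Subsingleton N := hf.subsingleton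
    infer_instance
  | n + 1, N, _, _, _, f, hf => by
    let p : N →ₗ[A] A := LinearMap.proj 0 ∘ₗ f
    have hI : Module.FinitePresentation A (LinearMap.range p) :=
      hA _ (Module.Finite.iff_fg.1 (Module.Finite.range p))
    have hK : (LinearMap.ker p.rangeRestrict).FG :=
      Module.FinitePresentation.fg_ker _ p.surjective_rangeRestrict
    have := Module.Finite.iff_fg.2 hK
    have : Module.FinitePresentation A (LinearMap.ker p.rangeRestrict) :=
      finitePresentation_of_injective hA n _
        ((LinearMap.funLeft A A Fin.succ ∘ₗ f) ∘ₗ Submodule.subtype _) (by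
          rw [← LinearMap.ker_eq_bot, LinearMap.ker_eq_bot']
          intro x hx
          refine Subtype.ext (hf ?_)
          rw [ZeroMemClass.coe_zero, map_zero]
          ext i
          refine Fin.cases ?_ (fun i => congrFun hx i) i
          exact congrArg Subtype.val (LinearMap.mem_ker.1 x.2))
    exact Module.finitePresentation_of_ker _ p.surjective_rangeRestrict

scoped instance : (fpInjective A).IsStableUnderRetracts where
  of_retract {X Y} r hY S hS h₁ h₂ h₃ g := by
    obtain ⟨h, hh⟩ := hY S hS h₁ h₂ h₃ (g ≫ r.i)
    exact ⟨h ≫ r.r, by rw [reassoc_of% hh, r.retract, Category.comp_id]⟩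

lemma isInjective_le_fpInjective : isInjective (ModuleCat.{u} A) ≤ fpInjective A :=
  fun J hJ S hS _ _ _ g =>
    have := hS.mono_f
    have : Injective J := hJ
    ⟨Injective.factorThru g S.f, Injective.comp_factorThru _ _⟩

/-- Finitely many generators reach only finitely many summands; hence fp-injectives are closed under
infinite sums, by extending the components one at a time. -/
lemma exists_finset_eq_sum {ι : Type u} [DecidableEq ι] {K : ι → ModuleCat.{u} A} {c : Cofan K}
    (hc : IsColimit c) {M : ModuleCat.{u} A} [Module.Finite A M] (g : M ⟶ c.pt)
    (p : ∀ j, c.pt ⟶ K j) (hp : ∀ j, c.inj j ≫ p j = 𝟙 _)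
    (hp' : ∀ i j, i ≠ j → c.inj i ≫ p j = 0) :
    ∃ T : Finset ι, ∑ j ∈ T, g ≫ p j ≫ c.inj j = g := by
  have hfin (x : c.pt) : ∃ T : Finset ι, ∀ j ∉ T, p j x = 0 := by
    let e : c.pt ≅ ModuleCat.of A (DirectSum ι fun i => K i) :=
      hc.coconePointUniqueUpToIso (ModuleCat.coproductCoconeIsColimit K)
    let V : Submodule A c.pt :=
      { carrier := {x | ∃ T : Finset ι, ∀ j ∉ T, p j x = 0}
        add_mem' := by
          rintro x y ⟨T, hT⟩ ⟨T', hT'⟩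
          refine ⟨T ∪ T', fun j hj => ?_⟩
          rw [Finset.notMem_union] at hj
          rw [map_add, hT j hj.1, hT' j hj.2, add_zero]
        zero_mem' := ⟨∅, fun j _ => map_zero _⟩
        smul_mem' := by
          rintro a x ⟨T, hT⟩
          exact ⟨T, fun j hj => by rw [map_smul, hT j hj, smul_zero]⟩ }
    have hV : ModuleCat.ofHom V.mkQ = 0 := Cofan.IsColimit.hom_ext hc _ _ fun i => by
      ext y
      refine (Submodule.Quotient.mk_eq_zero V).2 ⟨{i}, fun j hj => ?_⟩
      exact congrArg (fun f => f.hom y) (hp' i j fun h => hj (by simp [h]))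
    exact (Submodule.Quotient.mk_eq_zero V).1 (congrArg (fun f => f.hom x) hV)
  obtain ⟨s, hs⟩ := Module.Finite.fg_top (R := A) (M := M)
  choose T hT using hfin
  have hsT (j) (hj : j ∉ s.biUnion fun x => T (g x)) : g ≫ p j = 0 := by
    ext1
    refine LinearMap.ext_on hs fun x hx => hT (g x) j fun h => hj ?_
    exact Finset.mem_biUnion.2 ⟨x, hx, h⟩
  refine ⟨s.biUnion fun x => T (g x), ?_⟩
  rw [← sub_eq_zero]
  ext x
  refine eq_zero_of_forall_proj hc p hp hp' _ fun i => ?_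
  suffices h : (∑ j ∈ s.biUnion fun x => T (g x), g ≫ p j ≫ c.inj j - g) ≫ p i = 0 from
    congrArg (fun f => f.hom x) h
  rw [Preadditive.sub_comp, Preadditive.sum_comp, sub_eq_zero]
  by_cases hi : i ∈ s.biUnion fun x => T (g x)
  · rw [Finset.sum_eq_single_of_mem i hi fun j _ hj => by
      rw [Category.assoc, Category.assoc, hp' j i hj, comp_zero, comp_zero],
      Category.assoc, Category.assoc, hp, Category.comp_id]
  · rw [hsT i hi]
    exact Finset.sum_eq_zero fun j hj => by
      rw [Category.assoc, Category.assoc, hp' j i (fun h => hi (h ▸ hj)), comp_zero, comp_zero]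

scoped instance (ι : Type u) : (fpInjective A).IsClosedUnderColimitsOfShape (Discrete ι) :=
  .mk' (by
    classical
    rintro _ ⟨F, hF⟩ S hS h₁ h₂ h₃ g
    let K : ι → ModuleCat.{u} A := fun i => F.obj ⟨i⟩
    let c : Cofan K :=
      (Cocone.precompose Discrete.natIsoFunctor.inv).obj (colimit.cocone F)
    have hc : IsColimit c :=
      (IsColimit.precomposeInvEquiv Discrete.natIsoFunctor _).symm (colimit.isColimit F)
    let p (j : ι) : c.pt ⟶ K j :=
      Cofan.IsColimit.desc hc fun i => if h : i = j then eqToHom (by rw [h]) else 0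
    have hp j : c.inj j ≫ p j = 𝟙 _ := (Cofan.IsColimit.fac hc _ j).trans (by simp)
    have hp' i j (h : i ≠ j) : c.inj i ≫ p j = 0 :=
      (Cofan.IsColimit.fac hc _ i).trans (by simp [h])
    obtain ⟨T, hT⟩ := exists_finset_eq_sum hc g p hp hp'
    choose h hh using fun j => hF ⟨j⟩ S hS h₁ h₂ h₃ (g ≫ p j)
    refine ⟨∑ j ∈ T, h j ≫ c.inj j, ?_⟩
    rw [Preadditive.comp_sum]
    exact (Finset.sum_congr rfl fun j _ => by
      rw [← Category.assoc, hh, Category.assoc]).trans hT)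

/-- A map from a finitely presented module to `S.X₃` lifts to `S.X₂`, the obstruction being an
extension class with values in the fp-injective `S.X₁`; the lift extends since `S.X₂` is
fp-injective. Coherence makes the relation module in the presentation finitely presented. -/
lemma fpInjective_X₃ (hA : IsLeftCoherent A) {S : ShortComplex (ModuleCat.{u} A)}
    (hS : S.ShortExact) (hS₁ : fpInjective A S.X₁) (hS₂ : fpInjective A S.X₂) :
    fpInjective A S.X₃ := by
  intro D hD h₁ h₂ h₃ g
  have := hS.mono_f
  have := hS.epi_g
  obtain ⟨n, p, hp⟩ := Module.Finite.exists_fin' A D.X₁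
  have hT := LinearMap.shortExact_shortComplexKer hp
  have := hT.epi_g
  have := Module.Finite.iff_fg.2 (Module.FinitePresentation.fg_ker p hp)
  have hK : Module.FinitePresentation A (LinearMap.ker p) :=
    hA.finitePresentation_of_injective n _ _ (Submodule.subtype_injective _)
  have : Projective p.shortComplexKer.X₂ :=
    ModuleCat.projective_of_categoryTheory_projective (ModuleCat.of A (Fin n → A))
  obtain ⟨h, hh⟩ : ∃ h : p.shortComplexKer.X₂ ⟶ S.X₂, h ≫ S.g = p.shortComplexKer.g ≫ g :=
    ⟨Projective.factorThru _ _, Projective.factorThru_comp _ _⟩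
  obtain ⟨k, hk⟩ := hS.exact.lift' (p.shortComplexKer.f ≫ h) (by
    rw [Category.assoc, hh, reassoc_of% p.shortComplexKer.zero, zero_comp])
  obtain ⟨k', hk'⟩ := hS₁ _ hT hK (inferInstanceAs (Module.FinitePresentation A (Fin n → A))) h₁ k
  -- Subtracting an extension of the restriction of `h` to the relations makes `h` vanish on them
  -- without changing its image in `S.X₃`.
  obtain ⟨l, hl⟩ := hT.exact.desc' (h - k' ≫ S.f) (by
    rw [Preadditive.comp_sub, reassoc_of% hk', hk, sub_self])
  obtain ⟨l', hl'⟩ := hS₂ D hD h₁ h₂ h₃ l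
  refine ⟨l' ≫ S.g, ?_⟩
  rw [reassoc_of% hl', ← cancel_epi p.shortComplexKer.g, reassoc_of% hl, Preadditive.sub_comp,
    Category.assoc, S.zero, comp_zero, sub_zero, hh]

variable {R : Type u} [Ring R]

/-- An additive map between modules over `ℤ` is linear. -/
def intLinearMap {M N : Type u} [AddCommGroup M] [AddCommGroup N] [Module ℤ M] [Module ℤ N]
    (φ : M →+ N) : M →ₗ[ℤ] N where
  toFun := φ
  map_add' := map_add φ
  map_smul' := map_intCast_smul φ ℤ ℤ

/-- Morally, maps over `A` to `I` are maps over `R` from `R ⊗_A -` to `I`, an exact functor. As the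
tensor product carries only a group structure here, `I` is replaced by the `R`-module of additive
maps from `R` to an injective group `D` containing `I`, of which it is a retract. -/
lemma exists_extension_of_flatRight {f : A →+* R}
    (hf : flatRight A ((ModuleCat.restrictScalars.{u} (RingHom.op f)).obj (ModuleCat.of Rᵐᵒᵖ R)))
    {K L : ModuleCat.{u} A} (j : K ⟶ L) [Mono j] {I : ModuleCat.{u} R} [Injective I]
    (g : K ⟶ (ModuleCat.restrictScalars.{u} f).obj I) :
    ∃ h : L ⟶ (ModuleCat.restrictScalars.{u} f).obj I, j ≫ h = g := by
  let N := (ModuleCat.restrictScalars.{u} (RingHom.op f)).obj (ModuleCat.of Rᵐᵒᵖ R)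
  obtain ⟨D, _, d, hd⟩ : ∃ (D : ModuleCat.{u} ℤ) (_ : Injective D)
      (d : (ModuleCat.restrictScalars.{u} (algebraMap ℤ R)).obj I ⟶ D), Mono d :=
    ⟨_, inferInstance, Injective.ι _, inferInstance⟩
  let d' : I →+ D := d.hom.toAddMonoidHom
  let g' : K →+ I := g.hom.toAddMonoidHom
  let φ : BalancedTensor A N K →+ D := BalancedTensor.lift
    (AddMonoidHom.mk' (fun r : R => (d'.comp (DistribSMul.toAddMonoidHom I r)).comp g')
      fun r r' => by
        ext k
        exact (congrArg d' (add_smul r r' (g' k))).trans (map_add d' _ _) : R →+ K →+ D)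
    fun (r : R) a k => congrArg d' ((mul_smul r (f a) (g' k)).trans
      (congrArg (fun y : I => r • y) (map_smul g.hom a k).symm))
  let m : ModuleCat.of ℤ (BalancedTensor A N K) ⟶ ModuleCat.of ℤ (BalancedTensor A N L) :=
    ModuleCat.ofHom (BalancedTensor.map A LinearMap.id j.hom).toIntLinearMap
  have : Mono m := (ModuleCat.mono_iff_injective _).2
    (hf K L j ((ModuleCat.mono_iff_injective j).1 inferInstance))
  obtain ⟨φ', hφ'⟩ : ∃ φ' : BalancedTensor A N L →+ D,
      ∀ (r : R) (k : K), φ' (BalancedTensor.mk A N L r (j k)) = d' (r • g' k) :=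
    ⟨(Injective.factorThru (ModuleCat.ofHom (X := BalancedTensor A N K) (intLinearMap φ))
      m).hom.toAddMonoidHom, fun r k => congrArg
      (fun f : ModuleCat.of ℤ (BalancedTensor A N K) ⟶ D => f.hom (BalancedTensor.mk A N K r k))
      (Injective.comp_factorThru
        (ModuleCat.ofHom (X := BalancedTensor A N K) (intLinearMap φ)) m)⟩
  let E := (ModuleCat.coextendScalars (algebraMap ℤ R)).obj D
  let h' : L →+ E := .mk' (fun l => (ModuleCat.CoextendScalars.equiv _ _).symm
    (intLinearMap (φ'.comp ((BalancedTensor.mk A N L).flip l)))) fun l l' => by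
      refine ModuleCat.CoextendScalars.ext (LinearMap.ext fun r => ?_)
      exact (congrArg φ' (map_add (BalancedTensor.mk A N L r) l l')).trans (map_add φ' _ _)
  have hh' (a : A) (l : L) : h' (a • l) = f a • h' l :=
    ModuleCat.CoextendScalars.ext (LinearMap.ext fun r =>
      congrArg φ' (BalancedTensor.mk_smul (N := N) r a l).symm)
  let v := ModuleCat.RestrictionCoextensionAdj.HomEquiv.fromRestriction (algebraMap ℤ R) d
  have : Mono v := by
    rw [ModuleCat.mono_iff_injective] at hd ⊢
    intro x y hxy
    have := congrArg (fun e : E => e (1 : R)) hxy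
    simp only [v, ModuleCat.RestrictionCoextensionAdj.HomEquiv.fromRestriction_hom_apply_apply,
      one_smul] at this
    exact hd this
  let ρ : E ⟶ I := Injective.factorThru (𝟙 I) v
  have hρ : v ≫ ρ = 𝟙 I := Injective.comp_factorThru _ _
  refine ⟨ModuleCat.ofHom (Y := (ModuleCat.restrictScalars.{u} f).obj I)
    { toFun := fun l => ρ (h' l)
      map_add' := fun l l' => by rw [map_add, map_add]; rfl
      map_smul' := fun a l => by rw [hh', map_smul]; rfl }, ?_⟩
  ext k
  have : h' (j k) = v (g' k) := ModuleCat.CoextendScalars.ext (LinearMap.ext fun r => hφ' r k)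
  exact (congrArg ρ this).trans (congrArg (fun f => f.hom (g' k)) hρ)

lemma isInjective_le_restrictProp_fpInjective {f : A →+* R}
    (hf : flatRight A ((ModuleCat.restrictScalars.{u} (RingHom.op f)).obj (ModuleCat.of Rᵐᵒᵖ R))) :
    isInjective (ModuleCat.{u} R) ≤ restrictProp f (fpInjective A) := fun I hI =>
  have : Injective I := hI
  isInjective_le_fpInjective _ ⟨fun g j _ => exists_extension_of_flatRight hf j g⟩

end FpInjective

/-! ### Flat modules and their character modules -/

section Flat

/-- The character group of an abelian group. -/
def CharDual (F : Type u) [AddCommGroup F] : Type u := F →+ AddCircle (1 : ℚ)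

namespace CharDual

variable {B : Type u} [Ring B] {F F' F'' : Type u} [AddCommGroup F] [Module B F]
  [AddCommGroup F'] [Module B F'] [AddCommGroup F''] [Module B F'']

instance : AddCommGroup (CharDual F) := inferInstanceAs (AddCommGroup (F →+ AddCircle (1 : ℚ)))

instance : FunLike (CharDual F) F (AddCircle (1 : ℚ)) :=
  inferInstanceAs (FunLike (F →+ AddCircle (1 : ℚ)) F (AddCircle (1 : ℚ)))

instance : AddMonoidHomClass (CharDual F) F (AddCircle (1 : ℚ)) :=
  inferInstanceAs (AddMonoidHomClass (F →+ AddCircle (1 : ℚ)) F (AddCircle (1 : ℚ)))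

@[ext] lemma ext {c c' : CharDual F} (h : ∀ x, c x = c' x) : c = c' := DFunLike.ext _ _ h

lemma add_apply (c c' : CharDual F) (x : F) : (c + c') x = c x + c' x := rfl

/-- Evaluation at an element, as a homomorphism. -/
def eval (x : F) : CharDual F →+ AddCircle (1 : ℚ) where
  toFun c := c x
  map_zero' := rfl
  map_add' _ _ := rfl

lemma sum_apply {ι : Type*} (s : Finset ι) (c : ι → CharDual F) (x : F) :
    (∑ i ∈ s, c i) x = ∑ i ∈ s, c i x := map_sum (eval x) c s

/-- The right module structure on the character group of a left module. -/
instance : Module Bᵐᵒᵖ (CharDual F) where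
  smul b c := (show F →+ _ from c).comp (DistribSMul.toAddMonoidHom F b.unop)
  one_smul c := ext fun x => congrArg c (one_smul B x)
  mul_smul a b c := ext fun x => congrArg c (mul_smul b.unop a.unop x)
  smul_zero _ := rfl
  smul_add _ _ _ := rfl
  add_smul a b c := ext fun x =>
    (congrArg c (add_smul a.unop b.unop x)).trans (map_add c _ _)
  zero_smul c := ext fun x => (congrArg c (zero_smul B x)).trans (map_zero c)

lemma smul_apply (b : Bᵐᵒᵖ) (c : CharDual F) (x : F) : (b • c) x = c (b.unop • x) := rfl

/-- The contravariant functoriality of character modules. -/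
def map (φ : F →ₗ[B] F') : CharDual F' →ₗ[Bᵐᵒᵖ] CharDual F where
  toFun c := (show F' →+ _ from c).comp φ.toAddMonoidHom
  map_add' _ _ := rfl
  map_smul' b c := ext fun x => congrArg c (map_smul φ b.unop x).symm

/-- Divisibility of `ℚ/ℤ`: the character is defined on the image of `θ` and then extended. -/
lemma exists_factor {M N : Type u} [AddCommGroup M] [AddCommGroup N] (θ : M →+ N)
    (φ : CharDual M) (h : ∀ m, θ m = 0 → φ m = 0) : ∃ c : CharDual N, ∀ m, c (θ m) = φ m := by
  obtain ⟨c, hc⟩ := CharacterModule.dual_surjective_of_injective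
    (QuotientAddGroup.kerLift θ).toIntLinearMap (QuotientAddGroup.kerLift_injective θ)
    (QuotientAddGroup.lift θ.ker (show M →+ _ from φ) h)
  exact ⟨c, fun m => DFunLike.congr_fun hc (QuotientAddGroup.mk m)⟩

lemma exists_ne_zero {M : Type u} [AddCommGroup M] (H : AddSubgroup M) {x : M} (hx : x ∉ H) :
    ∃ c : CharDual M, (∀ m ∈ H, c m = 0) ∧ c x ≠ 0 := by
  obtain ⟨c, hc⟩ := CharacterModule.exists_character_apply_ne_zero_of_ne_zero
    (a := (QuotientAddGroup.mk x : M ⧸ H)) fun h => hx ((QuotientAddGroup.eq_zero_iff x).1 h)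
  refine ⟨(show M ⧸ H →+ _ from c).comp (QuotientAddGroup.mk' H), fun m hm => ?_, hc⟩
  exact (congrArg c ((QuotientAddGroup.eq_zero_iff m).2 hm)).trans (map_zero c)

end CharDual

lemma injective_of_retract {R Q Q' : Type u} [Ring R] [AddCommGroup Q] [Module R Q]
    [AddCommGroup Q'] [Module R Q'] [hQ : Module.Injective R Q'] (i : Q →ₗ[R] Q')
    (r : Q' →ₗ[R] Q) (h : ∀ x, r (i x) = x) : Module.Injective R Q where
  out X Y _ _ _ _ f hf g := by
    obtain ⟨g', hg'⟩ := hQ.out f hf (i ∘ₗ g)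
    exact ⟨r ∘ₗ g', fun x => (congrArg r (hg' x)).trans (h _)⟩

variable {B : Type u} [Ring B]

/-- Maps of right modules from `N` to the character module of `F` are characters of `N ⊗ F`, and
`ℚ/ℤ` is an injective cogenerator of abelian groups. -/
lemma flatLeft_iff (F : ModuleCat.{u} B) :
    flatLeft B F ↔ Module.Injective Bᵐᵒᵖ (CharDual F) := by
  refine ⟨fun hF => ⟨fun X Y _ _ _ _ f hf g => ?_⟩, fun hF N N' i hi => ?_⟩
  · obtain ⟨ψ, hψ⟩ := CharDual.exists_factor
      (BalancedTensor.map B f (LinearMap.id : F →ₗ[B] F))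
      (BalancedTensor.lift (G := AddCircle (1 : ℚ))
        (show X →+ (F →+ AddCircle (1 : ℚ)) from g.toAddMonoidHom)
        fun n a x => DFunLike.congr_fun (map_smul g (MulOpposite.op a) n) x) fun m hm => by
      rw [(injective_iff_map_eq_zero _).1 (hF (.of _ X) (.of _ Y) (ModuleCat.ofHom f) hf) m hm]
      exact map_zero _
    refine ⟨{ toFun := fun y => (show _ →+ AddCircle (1 : ℚ) from ψ).comp
                (BalancedTensor.mk B Y F y)
              map_add' := fun y y' => CharDual.ext fun x => ?_
              map_smul' := fun b y => CharDual.ext fun x => ?_ }, fun x => CharDual.ext fun y => ?_⟩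
    · exact (congrArg ψ (DFunLike.congr_fun (map_add (BalancedTensor.mk B Y F) y y') x)).trans
        (map_add ψ _ _)
    · exact congrArg ψ (BalancedTensor.mk_smul y b.unop x)
    · exact hψ (BalancedTensor.mk B X F x y)
  · rw [injective_iff_map_eq_zero]
    intro t ht
    by_contra h
    obtain ⟨c, -, hc⟩ := CharDual.exists_ne_zero (⊥ : AddSubgroup (BalancedTensor B N F)) h
    let g : N →ₗ[Bᵐᵒᵖ] CharDual F :=
      { toFun := fun n => (show _ →+ AddCircle (1 : ℚ) from c).comp (BalancedTensor.mk B N F n)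
        map_add' := fun y y' => CharDual.ext fun x =>
          (congrArg c (DFunLike.congr_fun (map_add (BalancedTensor.mk B N F) y y') x)).trans
            (map_add c _ _)
        map_smul' := fun b y => CharDual.ext fun x =>
          congrArg c (BalancedTensor.mk_smul y b.unop x) }
    obtain ⟨g', hg'⟩ := hF.out i.hom hi g
    let ψ := BalancedTensor.lift (G := AddCircle (1 : ℚ))
        (show N' →+ (F →+ AddCircle (1 : ℚ)) from g'.toAddMonoidHom)
        fun n a x => DFunLike.congr_fun (map_smul g' (MulOpposite.op a) n) x
    have key t : ψ (BalancedTensor.map B i.hom (LinearMap.id : F →ₗ[B] F) t) = c t := by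
      obtain ⟨t, rfl⟩ := QuotientAddGroup.mk_surjective t
      induction t with
      | zero => rw [QuotientAddGroup.mk_zero, map_zero, map_zero, map_zero]
      | tmul n x => exact DFunLike.congr_fun (hg' n) x
      | add t t' ht ht' => rw [QuotientAddGroup.mk_add, map_add, map_add, map_add, ht, ht']
    refine hc ((key t).symm.trans ?_)
    exact (congrArg ψ ht).trans (map_zero ψ)

scoped instance : (flatLeft B).IsStableUnderRetracts where
  of_retract {X Y} r hY := by
    rw [flatLeft_iff] at hY ⊢
    exact injective_of_retract (CharDual.map r.r.hom) (CharDual.map r.i.hom) fun c =>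
      CharDual.ext fun x => congrArg c (congrArg (fun f => f.hom x) r.retract)

/-- The dual sequence starts with an injective module, so it splits and the character module of
`S.X₁` is a retract of that of `S.X₂`. -/
lemma flatLeft_X₁ {S : ShortComplex (ModuleCat.{u} B)} (hS : S.ShortExact)
    (h₂ : flatLeft B S.X₂) (h₃ : flatLeft B S.X₃) : flatLeft B S.X₁ := by
  rw [flatLeft_iff] at h₂ h₃ ⊢
  have hf := (ModuleCat.mono_iff_injective _).1 hS.mono_f
  have hg := (ModuleCat.epi_iff_surjective _).1 hS.epi_g
  have hfg := (ShortComplex.ShortExact.moduleCat_exact_iff_function_exact S).1 hS.exact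
  let p := CharDual.map S.g.hom
  let q := CharDual.map S.f.hom
  have hp : Function.Injective p := by
    intro c c' h
    ext z
    obtain ⟨y, rfl⟩ := hg z
    exact DFunLike.congr_fun h y
  have hq : Function.Surjective q := fun c => by
    obtain ⟨c', hc'⟩ := CharDual.exists_factor S.f.hom.toAddMonoidHom c fun m hm => by
      rw [(injective_iff_map_eq_zero S.f.hom).1 hf m hm, map_zero]
    exact ⟨c', CharDual.ext hc'⟩
  have hpq (c) (hc : q c = 0) : ∃ d, p d = c := by
    obtain ⟨d, hd⟩ := CharDual.exists_factor S.g.hom.toAddMonoidHom c fun m hm => by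
      obtain ⟨x, rfl⟩ := (hfg m).1 hm
      exact DFunLike.congr_fun hc x
    exact ⟨d, CharDual.ext hd⟩
  have hqp (d) : q (p d) = 0 := CharDual.ext fun x =>
    (congrArg d (congrArg (fun f => f.hom x) S.zero)).trans (map_zero d)
  obtain ⟨σ, hσ⟩ := h₃.out p hp LinearMap.id
  let e : CharDual S.X₂ →ₗ[Bᵐᵒᵖ] CharDual S.X₂ := LinearMap.id - p ∘ₗ σ
  have he : LinearMap.ker q ≤ LinearMap.ker e := fun c hc => by
    obtain ⟨d, rfl⟩ := hpq c hc
    simp [e, hσ]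
  refine injective_of_retract
    ((LinearMap.ker q).liftQ e he ∘ₗ (q.quotKerEquivOfSurjective hq).symm.toLinearMap) q fun c => ?_
  obtain ⟨c, rfl⟩ := hq c
  have : (q.quotKerEquivOfSurjective hq).symm (q c) = Submodule.Quotient.mk c := by
    rw [LinearEquiv.symm_apply_eq]; rfl
  rw [LinearMap.comp_apply, LinearEquiv.coe_coe, this, Submodule.liftQ_apply]
  simp [e, hqp]

/-- The relations satisfied by a family of elements of the ring form a right module. -/
def syzygy {ι : Type u} [Fintype ι] (b : ι → B) : (ι → B) →ₗ[Bᵐᵒᵖ] B where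
  toFun v := ∑ i, b i * v i
  map_add' v w := by simp [mul_add, Finset.sum_add_distrib]
  map_smul' r v := by simp [Finset.sum_mul, mul_assoc]

/-- The equational criterion. A character `c` separating `x` from the trivial solutions induces a
map `γ` to the character module of `F` that kills the syzygies. It extends to a map `h'` on all of
`B`, and then `c x` is `h' 1` evaluated at the relation, hence 0. -/
lemma exists_combination_of_flat {F : ModuleCat.{u} B} (hF : flatLeft B F) {ι : Type u} [Fintype ι]
    (b : ι → B) (x : ι → F) (h : ∑ i, b i • x i = 0) :
    x ∈ AddSubgroup.closure
      {z : ι → F | ∃ (v : ι → B) (y : F), syzygy b v = 0 ∧ z = fun i => v i • y} := by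
  classical
  rw [flatLeft_iff] at hF
  by_contra hx
  obtain ⟨c, hc, hcx⟩ := CharDual.exists_ne_zero _ hx
  let γ : (ι → B) →ₗ[Bᵐᵒᵖ] CharDual F :=
    { toFun := fun v => (show _ →+ AddCircle (1 : ℚ) from c).comp
        (AddMonoidHom.mk' (fun y i => v i • y) fun y y' => funext fun i => smul_add _ _ _)
      map_add' := fun v w => CharDual.ext fun y =>
        (congrArg c (funext fun i => add_smul (v i) (w i) y)).trans (map_add c _ _)
      map_smul' := fun r v => CharDual.ext fun y =>
        congrArg c (funext fun i => mul_smul (v i) r.unop y) }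
  have hγ : LinearMap.ker (syzygy b) ≤ LinearMap.ker γ := fun v hv => CharDual.ext fun y =>
    hc _ (AddSubgroup.subset_closure ⟨v, y, hv, rfl⟩)
  obtain ⟨h', hh'⟩ := hF.out ((LinearMap.ker (syzygy b)).liftQ (syzygy b) le_rfl)
    (LinearMap.ker_eq_bot.1 (Submodule.ker_liftQ_eq_bot _ _ _ le_rfl))
    ((LinearMap.ker (syzygy b)).liftQ γ hγ)
  have key (v : ι → B) : h' (syzygy b v) = γ v := hh' (Submodule.Quotient.mk v)
  refine hcx ?_
  have hx' : x = ∑ i, fun j => (Pi.single i (1 : B) : ι → B) j • x i := by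
    ext j
    simp [Finset.sum_apply, Pi.single_apply]
  have hb (i) : c (fun j => (Pi.single i (1 : B) : ι → B) j • x i) = h' 1 (b i • x i) := by
    have h₁ : syzygy b (Pi.single i (1 : B)) = MulOpposite.op (b i) • (1 : B) := by
      simp [syzygy, Pi.single_apply]
    have h₂ := key (Pi.single i (1 : B))
    rw [h₁, map_smul] at h₂
    exact (DFunLike.congr_fun h₂ (x i)).symm
  rw [hx', map_sum, Finset.sum_congr rfl fun i _ => hb i, ← map_sum, h, map_zero]

scoped instance : Module.Finite Bᵐᵒᵖ B := by
  refine ⟨⟨{1}, ?_⟩⟩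
  rw [eq_top_iff, Finset.coe_singleton]
  exact fun b _ => Submodule.mem_span_singleton.2 ⟨MulOpposite.op b, one_mul b⟩

lemma IsRightCoherent.exists_generators (hB : IsRightCoherent B) {ι : Type u} [Fintype ι]
    (b : ι → B) : ∃ (m : ℕ) (κ : Fin m → ι → B), (∀ l, syzygy b (κ l) = 0) ∧
      ∀ v, syzygy b v = 0 → ∃ c : Fin m → B, ∀ i, v i = ∑ l, κ l i * c l := by
  have : Module.FinitePresentation Bᵐᵒᵖ (LinearMap.range (syzygy b)) :=
    hB _ (Module.Finite.iff_fg.1 (Module.Finite.range _))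
  have hK := Module.FinitePresentation.fg_ker _ (syzygy b).surjective_rangeRestrict
  rw [LinearMap.ker_rangeRestrict] at hK
  obtain ⟨m, κ, hκ⟩ := Submodule.fg_iff_exists_fin_generating_family.1 hK
  refine ⟨m, κ, fun l => ?_, fun v hv => ?_⟩
  · exact (hκ ▸ Submodule.subset_span ⟨l, rfl⟩ : κ l ∈ LinearMap.ker (syzygy b))
  · have : v ∈ Submodule.span Bᵐᵒᵖ (Set.range κ) := hκ ▸ hv
    obtain ⟨c, rfl⟩ := (Submodule.mem_span_range_iff_exists_fun _).1 this
    exact ⟨fun l => (c l).unop, fun i => by simp [Finset.sum_apply]⟩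

/-- The point is uniformity: `m` and `κ` depend on `b` alone, so solutions in different flat modules
can be assembled into one in their product. -/
lemma IsRightCoherent.exists_combination (hB : IsRightCoherent B) {ι : Type u} [Fintype ι]
    (b : ι → B) : ∃ (m : ℕ) (κ : Fin m → ι → B), (∀ l, syzygy b (κ l) = 0) ∧
      ∀ (F : ModuleCat.{u} B) (_ : flatLeft B F) (x : ι → F), ∑ i, b i • x i = 0 →
        ∃ y : Fin m → F, ∀ i, x i = ∑ l, κ l i • y l := by
  obtain ⟨m, κ, hκ, hκ'⟩ := hB.exists_generators b
  refine ⟨m, κ, hκ, fun F hF x hx => ?_⟩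
  refine AddSubgroup.closure_induction
    (p := fun x _ => ∃ y : Fin m → F, ∀ i, x i = ∑ l, κ l i • y l) ?_ ⟨0, fun i => by simp⟩ ?_ ?_
    (exists_combination_of_flat hF b x hx)
  · rintro _ ⟨v, y, hv, rfl⟩
    obtain ⟨c, hc⟩ := hκ' v hv
    exact ⟨fun l => c l • y, fun i => by simp [hc, Finset.sum_smul, mul_smul]⟩
  · rintro x x' _ _ ⟨y, hy⟩ ⟨y', hy'⟩
    exact ⟨y + y', fun i => by simp [hy, hy', Finset.sum_add_distrib]⟩
  · rintro x _ ⟨y, hy⟩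
    exact ⟨-y, fun i => by simp [hy]⟩

/-- Chase's theorem, through Baer's criterion for the character module of the product. Extending `g`
from `I` means finding one character `c` with `c (r x) = g r x`. -/
lemma flatLeft_pi (hB : IsRightCoherent B) {J : Type u} (F : J → ModuleCat.{u} B)
    (hF : ∀ j, flatLeft B (F j)) : flatLeft B (.of B (∀ j, F j)) := by
  rw [flatLeft_iff]
  refine Module.Baer.injective fun I g => ?_
  let P := ∀ j, F j
  let θ : (I →₀ P) →+ P :=
    Finsupp.liftAddHom fun i => DistribSMul.toAddMonoidHom P (MulOpposite.unop (i : Bᵐᵒᵖ))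
  let φ : (I →₀ P) →+ AddCircle (1 : ℚ) :=
    Finsupp.liftAddHom fun i => (show P →+ AddCircle (1 : ℚ) from g i)
  -- Such a `c` exists once each relation `∑ bᵢ zᵢ = 0` in the product forces `∑ g(bᵢ)(zᵢ) = 0`.
  -- Writing all coordinates of `z` by the same syzygies `κ` reduces this to the linearity of `g`.
  obtain ⟨c, hc⟩ := CharDual.exists_factor θ φ fun z hz => by
    let b : z.support → B := fun i => (i : I).1.unop
    obtain ⟨m, κ, hκ, hκ'⟩ := hB.exists_combination b
    choose y hy using fun j => hκ' (F j) (hF j) (fun i => z i j) (by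
      rw [← Pi.zero_apply (M := fun j => F j) j, ← hz, Finsupp.liftAddHom_apply, Finsupp.sum,
        Finset.sum_apply]
      exact Finset.sum_coe_sort z.support fun i : I => i.1.unop • z i j)
    let y' (l : Fin m) : P := fun j => y j l
    have hz' (i : z.support) : z i = ∑ l, κ l i • y' l := by
      ext j
      rw [hy, Finset.sum_apply]; rfl
    have h₁ (l : Fin m) : ∑ i : z.support, g i (κ l i • y' l) = 0 := by
      have h₂ : ∑ i : z.support, MulOpposite.op (κ l i) • (i : I) = 0 := Subtype.ext (by
        apply MulOpposite.unop_injective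
        simpa [syzygy, b] using hκ l)
      have h₃ := congrArg (fun e => g e (y' l)) h₂
      simp only [map_sum, map_zero, map_smul, CharDual.sum_apply] at h₃
      exact h₃
    change φ z = 0
    rw [Finsupp.liftAddHom_apply, Finsupp.sum, ← Finset.sum_coe_sort]
    change ∑ i : z.support, g i (z i) = 0
    rw [Finset.sum_congr rfl fun i _ => by rw [hz', map_sum], Finset.sum_comm]
    exact Finset.sum_eq_zero fun l _ => h₁ l
  refine ⟨LinearMap.toSpanSingleton Bᵐᵒᵖ _ c, fun r hr => CharDual.ext fun x => ?_⟩
  have h₁ : θ (Finsupp.single ⟨r, hr⟩ x) = r.unop • x := Finsupp.liftAddHom_apply_single _ _ _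
  have h₂ : φ (Finsupp.single ⟨r, hr⟩ x) = g ⟨r, hr⟩ x := Finsupp.liftAddHom_apply_single _ _ _
  have h₃ := hc (Finsupp.single ⟨r, hr⟩ x)
  rw [h₁] at h₃
  exact h₃.trans h₂

lemma flatLeft_finsupp (J : Type u) {F : ModuleCat.{u} B} (hF : flatLeft B F) :
    flatLeft B (.of B (J →₀ F)) := by
  rw [flatLeft_iff] at hF ⊢
  refine ⟨fun X Y _ _ _ _ f hf g => ?_⟩
  choose h hh using fun j : J =>
    hF.out f hf (CharDual.map (Finsupp.lsingle (M := F) (R := B) j) ∘ₗ g)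
  let u (y : Y) : CharDual (J →₀ F) :=
    Finsupp.liftAddHom fun j => (show F →+ AddCircle (1 : ℚ) from h j y)
  have hu y j (x : F) : u y (Finsupp.single j x) = h j y x :=
    Finsupp.liftAddHom_apply_single _ _ _
  have hext {c c' : CharDual (J →₀ F)}
      (H : ∀ j x, c (Finsupp.single j x) = c' (Finsupp.single j x)) : c = c' :=
    Finsupp.addHom_ext H
  refine ⟨{ toFun := u
            map_add' := fun y y' => hext fun j x => ?_
            map_smul' := fun b y => hext fun j x => ?_ }, fun x => hext fun j z => ?_⟩
  · rw [CharDual.add_apply, hu, hu, hu, map_add, CharDual.add_apply]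
  · rw [RingHom.id_apply, CharDual.smul_apply, Finsupp.smul_single, hu, hu, map_smul,
      CharDual.smul_apply]
  · exact (hu _ _ _).trans (DFunLike.congr_fun (hh j x) z)

/-- A projective `S`-module is a retract of a free one, which over `B` is a direct sum of copies of
the flat module `S`. -/
lemma isProjective_le_restrictProp_flatLeft {S : Type u} [Ring S] {f : B →+* S}
    (hf : flatLeft B ((ModuleCat.restrictScalars.{u} f).obj (ModuleCat.of S S))) :
    isProjective (ModuleCat.{u} S) ≤ restrictProp f (flatLeft B) := fun M hM => by
  have : Module.Projective S M := (IsProjective.iff_projective M).2 hM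
  obtain ⟨s, hs⟩ := Module.projective_def.1 this
  let F := (ModuleCat.restrictScalars.{u} f).obj (ModuleCat.of S S)
  let i : (ModuleCat.restrictScalars.{u} f).obj M ⟶ .of B (M →₀ F) :=
    ModuleCat.ofHom (X := (ModuleCat.restrictScalars.{u} f).obj M)
      { toFun := fun x => (s x : M →₀ S)
        map_add' := map_add s
        map_smul' := fun b x => map_smul s (f b) x }
  let r : .of B (M →₀ F) ⟶ (ModuleCat.restrictScalars.{u} f).obj M :=
    ModuleCat.ofHom (Y := (ModuleCat.restrictScalars.{u} f).obj M)
      { toFun := fun z => Finsupp.linearCombination S (id : M → M) z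
        map_add' := map_add _
        map_smul' := fun b z => map_smul (Finsupp.linearCombination S (id : M → M)) (f b) z }
  exact (flatLeft B).prop_of_retract ⟨i, r, by ext x; exact hs x⟩ (flatLeft_finsupp M hf)

/-- Maps of right modules to the character module of `B` correspond to characters through evaluation
at `1`, and characters extend. -/
lemma flatLeft_self : flatLeft B (.of B B) := by
  rw [flatLeft_iff]
  refine ⟨fun X Y _ _ _ _ f hf g => ?_⟩
  obtain ⟨c, hc⟩ := CharDual.exists_factor f.toAddMonoidHom
    ((CharDual.eval (1 : B)).comp g.toAddMonoidHom) fun m hm => by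
      rw [(injective_iff_map_eq_zero f).1 hf m hm]
      exact map_zero ((CharDual.eval (1 : B)).comp g.toAddMonoidHom)
  refine ⟨{ toFun := fun y => (show Y →+ AddCircle (1 : ℚ) from c).comp
              ((LinearMap.toSpanSingleton Bᵐᵒᵖ Y y).toAddMonoidHom.comp
                (MulOpposite.opAddEquiv (α := B)).toAddMonoidHom)
            map_add' := fun y y' => CharDual.ext fun b => ?_
            map_smul' := fun b y => CharDual.ext fun x => ?_ }, fun x => CharDual.ext fun b => ?_⟩
  · exact (congrArg c (smul_add (MulOpposite.op b) y y')).trans (map_add c _ _)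
  · exact congrArg c (smul_smul (MulOpposite.op x) b y)
  · refine (congrArg c (map_smul f (MulOpposite.op b) x).symm).trans ((hc _).trans ?_)
    refine (DFunLike.congr_fun (map_smul g (MulOpposite.op b) x) (1 : B)).trans ?_
    exact congrArg (g x) (mul_one b)

lemma isProjective_le_flatLeft : isProjective (ModuleCat.{u} B) ≤ flatLeft B := fun M hM =>
  (flatLeft B).prop_of_iso ((ModuleCat.restrictScalarsId B).app M)
    (isProjective_le_restrictProp_flatLeft (f := RingHom.id B)
      ((flatLeft B).prop_of_iso ((ModuleCat.restrictScalarsId B).app _).symm flatLeft_self) M hM)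

lemma IsRightCoherent.isClosedUnderLimitsOfShape (hB : IsRightCoherent B) (J : Type u) :
    (flatLeft B).IsClosedUnderLimitsOfShape (Discrete J) :=
  .mk' (by
    rintro _ ⟨F, hF⟩
    exact (flatLeft B).prop_of_iso
      ((ModuleCat.piIsoPi fun j => F.obj ⟨j⟩).symm ≪≫ (Pi.isoLimit F))
      (flatLeft_pi hB _ fun j => hF ⟨j⟩))

end Flat

/-! ### Semiderived categories -/

section Restriction

scoped instance {C : Type u₁} {D : Type u₂} [Category.{v₁} C] [Category.{v₂} D] (F : C ⥤ D)
    (P : ObjectProperty D) [P.IsStableUnderRetracts] :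
    (P.inverseImage F).IsStableUnderRetracts where
  of_retract r h := P.prop_of_retract (r.map F) h

variable {A R : Type u} [Ring A] [Ring R] (f : A →+* R)

scoped instance : PreservesLimitsOfSize.{u, u} (ModuleCat.restrictScalars.{u} f) where
  preservesLimitsOfShape := { preservesLimit := inferInstance }

scoped instance : PreservesFiniteLimits (ModuleCat.restrictScalars.{u} f) :=
  PreservesLimitsOfSize.preservesFiniteLimits.{u, u} _

scoped instance : PreservesFiniteColimits (ModuleCat.restrictScalars.{u} f) :=
  PreservesColimitsOfSize.preservesFiniteColimits.{u, u} _

variable (P : ObjectProperty (ModuleCat.{u} A))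
  [P.ContainsZero] [P.IsClosedUnderIsomorphisms] [P.IsClosedUnderBinaryProducts]

lemma inverseImage_restrictHot_embedHot (Q : ObjectProperty (Hot (ModuleCat.{u} A))) :
    (Q.inverseImage (restrictHot f)).inverseImage (embedHot f P) =
      (Q.inverseImage (P.ι.mapHomotopyCategory (ComplexShape.up ℤ))).inverseImage
        (restrictSubHot f P) := by
  ext X
  obtain ⟨K, rfl⟩ := HomotopyCategory.quotient_obj_surjective X
  exact Iff.rfl

end Restriction

/-! ### The semicoderived case. -/

section Semico

variable {A R : Type u} [Ring A] [Ring R] (f : A →+* R)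

lemma semicoAcyclicFpi_eq (hA : IsLeftCoherent A) :
    semicoAcyclicFpi f = (semicoAcyclic f).inverseImage (embedHot f (fpInjective A)) := by
  have : HasCoproducts.{u} (fpInjective A).FullSubcategory := fun J => inferInstance
  rw [inverseImage_restrictHot_embedHot]
  refine congrArg (ObjectProperty.inverseImage · _) ?_
  exact le_antisymm
    (coacyclic_le_inverseImage (fpInjective A).ι (inducedConf _) (abelianConf _) fun S hS => hS)
    (inverseImage_coacyclic_le _ isInjective_le_fpInjective fun S hS => fpInjective_X₃ hA hS)

/-- The resolution is made over `R`; restriction of scalars is exact and preserves sums, so a cone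
coacyclic over `R` is coacyclic over `A`. -/
lemma exists_trW_semicoAcyclic
    (hf : flatRight A ((ModuleCat.restrictScalars.{u} (RingHom.op f)).obj (ModuleCat.of Rᵐᵒᵖ R)))
    (Y : Hot (ModuleCat.{u} R)) :
    ∃ (X : _) (s : Y ⟶ (embedHot f (fpInjective A)).obj X), (semicoAcyclic f).trW s := by
  obtain ⟨M, rfl⟩ := HomotopyCategory.quotient_obj_surjective Y
  obtain ⟨J, s, hJ, hs⟩ := exists_trW_coacyclic (restrictProp f (fpInjective A))
    (isInjective_le_restrictProp_fpInjective hf) M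
  refine ⟨(HomotopyCategory.quotient _ _).obj
    (HomologicalComplex.liftObjectProperty (restrictProp f (fpInjective A)) J hJ),
    (HomotopyCategory.quotient _ _).map s, ObjectProperty.trW_monotone ?_ _ hs⟩
  exact coacyclic_le_inverseImage _ _ _ fun S hS => hS.map_of_exact _

end Semico

/-! ### The semicontraderived case. -/

section Semictr

variable {B S : Type u} [Ring B] [Ring S] (f : B →+* S)

/-- Coherence serves only to give the flat modules products computed in all modules; kernels of
epimorphisms of flats are flat over any ring. -/
lemma semictrAcyclicFl_eq (hB : IsRightCoherent B) :
    semictrAcyclicFl f = (semictrAcyclic f).inverseImage (embedHot f (flatLeft B)) := by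
  have := hB.isClosedUnderLimitsOfShape
  have : HasProducts.{u} (flatLeft B).FullSubcategory := fun J => inferInstance
  rw [inverseImage_restrictHot_embedHot]
  refine congrArg (ObjectProperty.inverseImage · _) ?_
  exact le_antisymm
    (contraacyclic_le_inverseImage (flatLeft B).ι (inducedConf _) (abelianConf _) fun S hS => hS)
    (inverseImage_contraacyclic_le _ isProjective_le_flatLeft fun S hS => flatLeft_X₁ hS)

lemma exists_trW_semictrAcyclic (hB : IsRightCoherent B)
    (hf : flatLeft B ((ModuleCat.restrictScalars.{u} f).obj (ModuleCat.of S S)))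
    (Y : Hot (ModuleCat.{u} S)) :
    ∃ (X : _) (s : (embedHot f (flatLeft B)).obj X ⟶ Y), (semictrAcyclic f).trW s := by
  have := hB.isClosedUnderLimitsOfShape
  obtain ⟨M, rfl⟩ := HomotopyCategory.quotient_obj_surjective Y
  obtain ⟨J, s, hJ, hs⟩ := exists_trW_contraacyclic (restrictProp f (flatLeft B))
    (isProjective_le_restrictProp_flatLeft hf) M
  refine ⟨(HomotopyCategory.quotient _ _).obj
    (HomologicalComplex.liftObjectProperty (restrictProp f (flatLeft B)) J hJ),
    (HomotopyCategory.quotient _ _).map s, ObjectProperty.trW_monotone ?_ _ hs⟩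
  exact contraacyclic_le_inverseImage _ _ _ fun S hS => hS.map_of_exact _

end Semictr

end Semiderived

end

/-! ### The two equivalences. -/

theorem mainTheorem11 :
    (∀ (A R : Type u) [Ring A] [Ring R] (f : A →+* R), Semiderived.IsLeftCoherent A →
      Semiderived.flatRight A
        ((ModuleCat.restrictScalars.{u} (RingHom.op f)).obj (ModuleCat.of Rᵐᵒᵖ R)) →
      ∃ h : Semiderived.semicoAcyclicFpi f ≤ (Semiderived.semicoAcyclic f).inverseImage
          (Semiderived.embedHot f (Semiderived.fpInjective A)),
        (Semiderived.sicoFunctor f h).IsTriangulated ∧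
        (Semiderived.sicoFunctor f h).IsEquivalence) ∧
    (∀ (B S : Type u) [Ring B] [Ring S] (f : B →+* S), Semiderived.IsRightCoherent B →
      Semiderived.flatLeft B
        ((ModuleCat.restrictScalars.{u} f).obj (ModuleCat.of S S)) →
      ∃ h : Semiderived.semictrAcyclicFl f ≤ (Semiderived.semictrAcyclic f).inverseImage
          (Semiderived.embedHot f (Semiderived.flatLeft B)),
        (Semiderived.sictrFunctor f h).IsTriangulated ∧
        (Semiderived.sictrFunctor f h).IsEquivalence) := by
  refine ⟨fun A R _ _ f hA hf => ?_, fun B S _ _ f hB hf => ?_⟩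
  · have h := Semiderived.semicoAcyclicFpi_eq f hA
    exact ⟨h.le, Semiderived.quotientFunctor_isTriangulated _ _ _ _,
      Semiderived.quotientFunctor_isEquivalence_of_right _ _ h.ge
        (Semiderived.exists_trW_semicoAcyclic f hf)⟩
  · have h := Semiderived.semictrAcyclicFl_eq f hB
    exact ⟨h.le, Semiderived.quotientFunctor_isTriangulated _ _ _ _,
      Semiderived.quotientFunctor_isEquivalence_of_left _ _ h.ge
        (Semiderived.exists_trW_semictrAcyclic f hB hf)⟩
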